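/- Setting. Let $1<p<\infty$, $1/p+1/q=1$, let $\mathbb T$ be the unit circle, $L^p=L^p(\mathbb T)$, and let $H^p$ (respectively $\overline{H^p}$) be the space of all $f\in L^p$ whose Fourier coefficients $\widehat f_k$ vanish for $k<0$ (respectively for $k>0$). Let $P$ be the projection of $L^p$ onto $H^p$ that deletes all Fourier coefficients of negative index, and $Q=I-P$. Fix $\beta\in\mathbb C$ with $|\beta|>1$ and put $$\alpha(t)=\frac{t-\beta}{\overline\beta t-1},\quad \lambda=i\sqrt{|\beta|^2-1},\quad \alpha_-(t)=\frac{\lambda t}{\overline\beta t-1},\quad \chi(t)=\frac{t}{\alpha_-(t)},\quad (J_\alpha f)(t)=t^{-1}\alpha_-(t)f(\alpha(t)),$$ and $g_\alpha=g\circ\alpha$ for functions $g$ on $\mathbb T$. For $g\in L^\infty$ let $T(g)f=P(gf)$ and $H_\alpha(g)f=P(gQJ_\alpha f)$, as operators on $H^p$; the index of a Fredholm operator is the dimension of its kernel minus the dimension of its cokernel. For $g\in L^\infty$ with $gg_\alpha=1$ let $\mathbf P_\alpha^{\pm}(g)=\frac12(I\pm J_\alpha QgP)$, as an operator on $\ker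 T(g)$. A Wiener–Hopf factorization of $g\in L^\infty$ in $H^p$ is a representation $g=g_-t^kg_+$ with $k\in\mathbb Z$, $g_+\in H^q$, $g_+^{-1}\in H^p$, $g_-\in\overline{H^p}$, $g_-^{-1}\in\overline{H^q}$, $g_-(\infty)=1$ (that is, $(\widehat{g_-})_0=1$), such that the operator $g_+^{-1}Pg_-^{-1}I$, defined on polynomials, extends to a bounded operator on $H^p$. If $T(g)$ is Fredholm of index $\kappa$ and $k=-\kappa$, put $$\boldsymbol\sigma_\alpha(g)=\Bigl(\frac{\lambda}{\overline\beta}\Bigr)^{\kappa}g_+^{-1}\Bigl(\frac1{\overline\beta}\Bigr),$$ where $g_+^{-1}$ is extended analytically to the unit disc. Let $a,b\in L^\infty$, let $a$ be invertible in $L^\infty$, let $aa_\alpha=bb_\alpha$, and put $c=ab^{-1}$ and $d=ba_\alpha^{-1}$. Assume that $T(c)$ and $T(d)$ are Fredholm operators on $H^p$, with indices $\kappa_1<0$ and $\kappa_2>0$. Let $n\in\mathbb N$ be such that $2n+\kappa_1\in\{0,1\}$, and put $a'=a\chi^{-n}$, $b'=b\chi^n$, $c'=a'(b')^{-1}=c\chi^{-2n}$.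 Theorem. The function $c$ has a Wiener–Hopf factorization $c=c_-t^{-\kappa_1}c_+$ in $H^p$. The operator $T(c't^{2n+\kappa_1})$ is invertible, and $T(c't^{2n+\kappa_1})^{-1}T(t^{2n+\kappa_1})$ is a right inverse of $T(c')$. For every bounded linear right inverse $R$ of $T(c')$ and for either choice of the signs define $$\varphi_\alpha^{\pm}(s)=\tfrac12\Bigl(R\,T((a'_\alpha)^{-1})s\mp J_\alpha Qc'P\,R\,T((a'_\alpha)^{-1})s\pm J_\alpha Q(a'_\alpha)^{-1}s\Bigr),\qquad s\in \ker T(d).$$ Then $\varphi_\alpha^{\pm}$ maps $\operatorname{im}\mathbf P_\alpha^{\pm}(d)$ into $H^p$, and the following holds. (i) If $\kappa_1$ is odd, then $$\ker(T(a)\pm H_\alpha(b))=T(\chi^{-n})\Bigl(\Bigl\{\frac{1\mp\boldsymbol\sigma_\alpha(c)}2\,c_+^{-1}\mathbb C\dotplus\varphi_\alpha^{\pm}(\operatorname{im}\mathbf P_\alpha^{\pm}(d))\Bigr\}\cap\operatorname{im}T(\chi^n)\Bigr),$$ where the sum is direct. (ii) If $\kappa_1$ is even, then $$\ker(T(a)\pm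 H_\alpha(b))=T(\chi^{-n})\Bigl(\varphi_\alpha^{\pm}(\operatorname{im}\mathbf P_\alpha^{\pm}(d))\cap\operatorname{im}T(\chi^n)\Bigr).$$ -/

import Mathlib

open MeasureTheory Filter
open scoped ENNReal ComplexConjugate Real

namespace GTH

noncomputable section

/-! ### The unit circle, arc length, Fourier coefficients -/

instance instMeasurableSpaceCircle : MeasurableSpace Circle := borel Circle

instance instBorelSpaceCircle : BorelSpace Circle := ⟨rfl⟩

instance instFactTwoPi : Fact (0 < 2 * π) := ⟨Real.two_pi_pos⟩

/-- Normalised arc length `|dt| / 2π` on the unit circle: the image of `dθ / 2π` under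
`θ ↦ exp (i θ)`. -/
def arc : Measure Circle :=
  (AddCircle.haarAddCircle (T := 2 * π)).map AddCircle.toCircle

lemma measurable_toCircle : Measurable (AddCircle.toCircle (T := 2 * π)) :=
  (AddCircle.continuous_toCircle).measurable

instance instIsProbabilityMeasureArc : IsProbabilityMeasure arc :=
  Measure.isProbabilityMeasure_map measurable_toCircle.aemeasurable

/-- The Fourier coefficient `(1 / 2π) ∫ f (exp (i θ)) exp (- i n θ) dθ`. -/
def fcoeff (f : Circle → ℂ) (n : ℤ) : ℂ := ∫ t, (t : ℂ) ^ (-n) * f t ∂arc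

/-- The space `L^p` of the unit circle. -/
abbrev LpT (p : ℝ≥0∞) := Lp ℂ p arc

/-- The function `f` belongs to the Hardy space `H^p`. -/
def MemHardy (f : Circle → ℂ) (p : ℝ≥0∞) : Prop :=
  MemLp f p arc ∧ ∀ n : ℤ, n < 0 → fcoeff f n = 0

/-- The function `f` belongs to the conjugate Hardy space. -/
def MemCoHardy (f : Circle → ℂ) (p : ℝ≥0∞) : Prop :=
  MemLp f p arc ∧ ∀ n : ℤ, 0 < n → fcoeff f n = 0

/-- The value at the point `z` of the open unit disc of the analytic extension of a function
`f` of a Hardy space. -/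
def diskExt (f : Circle → ℂ) (z : ℂ) : ℂ := ∑' n : ℕ, fcoeff f n * z ^ n

/-- The function `a` is an invertible element of `L^∞`. -/
def MemGLinfty (a : Circle → ℂ) : Prop :=
  MemLp a ∞ arc ∧ (∀ᵐ t ∂arc, a t ≠ 0) ∧ MemLp a⁻¹ ∞ arc

lemma integrable_zpow_mul {f : Circle → ℂ} (hf : Integrable f arc) (n : ℤ) :
    Integrable (fun t : Circle => (t : ℂ) ^ n * f t) arc := by
  refine hf.bdd_mul (c := 1) ?_ ?_
  · refine Continuous.aestronglyMeasurable ?_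
    exact Continuous.zpow₀ continuous_subtype_val n (fun t => Or.inl (Circle.coe_ne_zero t))
  · exact Eventually.of_forall fun t => by simp [Circle.norm_coe]

lemma fcoeff_congr {f g : Circle → ℂ} (h : f =ᵐ[arc] g) (n : ℤ) : fcoeff f n = fcoeff g n := by
  refine integral_congr_ae ?_
  filter_upwards [h] with t ht
  simp [ht]

/-- The Hardy space `H^p` as a subspace of `L^p`. -/
def Hardy (p : ℝ≥0∞) [Fact (1 ≤ p)] : Submodule ℂ (LpT p) where
  carrier := {f | ∀ n : ℤ, n < 0 → fcoeff f n = 0}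
  zero_mem' := by
    intro n _
    rw [fcoeff_congr (Lp.coeFn_zero ℂ p arc)]
    simp [fcoeff]
  add_mem' := by
    intro f g hf hg n hn
    have hf1 := (Lp.memLp f).integrable (Fact.out : 1 ≤ p)
    have hg1 := (Lp.memLp g).integrable (Fact.out : 1 ≤ p)
    rw [fcoeff_congr (Lp.coeFn_add f g)]
    have h := integral_add (integrable_zpow_mul hf1 (-n)) (integrable_zpow_mul hg1 (-n))
    have hf2 := hf n hn
    have hg2 := hg n hn
    simp only [fcoeff, Pi.add_apply, mul_add] at *
    rw [h, hf2, hg2, add_zero]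
  smul_mem' := by
    intro k f hf n hn
    rw [fcoeff_congr (Lp.coeFn_smul k f)]
    have hf2 := hf n hn
    simp only [fcoeff, Pi.smul_apply, smul_eq_mul] at *
    simp_rw [mul_left_comm _ k]
    rw [integral_const_mul, hf2, mul_zero]

/-! ### The Riesz projection and multiplication operators -/

/-- `u` is obtained from `f` by deleting all Fourier coefficients with a negative index. -/
def IsAnalyticPart (f u : Circle → ℂ) : Prop :=
  ∀ n : ℤ, fcoeff u n = if 0 ≤ n then fcoeff f n else 0

open Classical in
/-- The projection `P` of `L^p` onto `H^p`: the bounded operator on `L^p` that deletes the Fourier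
coefficients with a negative index. There is at most one such operator, since an integrable
function is determined by its Fourier coefficients, and for `1 < p < ∞` there is one, by the
theorem of M. Riesz. -/
def rieszP (p : ℝ≥0∞) [Fact (1 ≤ p)] : LpT p →L[ℂ] LpT p :=
  if h : ∃ S : LpT p →L[ℂ] LpT p, ∀ f : LpT p, IsAnalyticPart f (S f) then h.choose else 0

/-- The complementary projection `Q = I - P`. -/
def rieszQ (p : ℝ≥0∞) [Fact (1 ≤ p)] : LpT p →L[ℂ] LpT p :=
  ContinuousLinearMap.id ℂ (LpT p) - rieszP p

lemma rieszP_mem (p : ℝ≥0∞) [Fact (1 ≤ p)] (f : LpT p) : rieszP p f ∈ Hardy p := by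
  unfold rieszP
  split_ifs with h
  · intro n hn
    rw [h.choose_spec f n, if_neg (not_le.mpr hn)]
  · simp

open Classical in
/-- Multiplication by a function `a` of `L^∞` as an operator on `L^p`. -/
def mulOp (p : ℝ≥0∞) [Fact (1 ≤ p)] (a : Circle → ℂ) : LpT p →L[ℂ] LpT p :=
  if h : MemLp a ∞ arc then
    (ContinuousLinearMap.mul ℂ ℂ).holderL arc ∞ p p (h.toLp a)
  else 0

lemma coeFn_mulOp (p : ℝ≥0∞) [Fact (1 ≤ p)] {a : Circle → ℂ} (ha : MemLp a ∞ arc) (f : LpT p) :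
    mulOp p a f =ᵐ[arc] fun t => a t * f t := by
  rw [mulOp, dif_pos ha, ContinuousLinearMap.holderL_apply_apply]
  filter_upwards [(ContinuousLinearMap.mul ℂ ℂ).coeFn_holder (r := p) (ha.toLp a) f,
    ha.coeFn_toLp] with t h1 h2
  rw [h1, h2]
  rfl

/-! ### The Carleman shift -/

/-- The parameters of the shift: complex numbers outside the closed unit disc. -/
abbrev OuterPoint := {β : ℂ // 1 < ‖β‖}

lemma norm_sub_eq (β : ℂ) (t : Circle) : ‖(t : ℂ) - β‖ = ‖conj β * t - 1‖ := by
  have h : conj β * t - 1 = -(t * conj ((t : ℂ) - β)) := by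
    have : (t : ℂ) * conj (t : ℂ) = 1 := by
      rw [Complex.mul_conj, Complex.normSq_eq_norm_sq, Circle.norm_coe]; simp
    rw [map_sub, mul_sub, this]
    ring
  rw [h, norm_neg, norm_mul, RCLike.norm_conj, Circle.norm_coe, one_mul]

lemma norm_sub_ge (β : ℂ) (t : Circle) : ‖β‖ - 1 ≤ ‖conj β * t - 1‖ := by
  have := norm_sub_norm_le (conj β * t) 1
  simpa [Circle.norm_coe] using this

lemma den_ne_zero (β : OuterPoint) (t : Circle) : conj (β : ℂ) * t - 1 ≠ 0 := by
  intro h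
  have h1 := norm_sub_ge β t
  rw [h, norm_zero] at h1
  linarith [β.2]

/-- The shift `α (t) = (t - β) / (conj β * t - 1)` of the unit circle. -/
def shift (β : OuterPoint) (t : Circle) : Circle :=
  ⟨((t : ℂ) - β) / (conj (β : ℂ) * t - 1), by
    rw [← SetLike.mem_coe, Submonoid.coe_unitSphere, mem_sphere_zero_iff_norm, norm_div,
      norm_sub_eq, div_self]
    exact norm_ne_zero_iff.mpr (den_ne_zero β t)⟩

lemma coe_shift (β : OuterPoint) (t : Circle) :
    (shift β t : ℂ) = ((t : ℂ) - β) / (conj (β : ℂ) * t - 1) := rfl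

lemma shift_shift (β : OuterPoint) (t : Circle) : shift β (shift β t) = t := by
  apply Circle.ext
  have h1 := den_ne_zero β t
  have h2 := den_ne_zero β (shift β t)
  rw [coe_shift, div_eq_iff h2, coe_shift]
  generalize conj (β : ℂ) = g at *
  have h3 : g * t = (g * t - 1) + 1 := by ring
  generalize g * (t : ℂ) - 1 = w at *
  field_simp
  linear_combination ((β : ℂ) - t) * h3

/-- The shift is Lipschitz. -/
lemma lipschitz_shift (β : OuterPoint) :
    ∃ K : NNReal, LipschitzWith K (shift β) := by
  have hβ : 0 < ‖(β : ℂ)‖ - 1 := by linarith [β.2]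
  refine ⟨Real.toNNReal (‖1 - (β : ℂ) * conj (β : ℂ)‖ / (‖(β : ℂ)‖ - 1) ^ 2),
    LipschitzWith.of_dist_le_mul fun t s => ?_⟩
  rw [Real.coe_toNNReal _ (by positivity)]
  change dist (shift β t : ℂ) (shift β s : ℂ) ≤ _ * dist (t : ℂ) (s : ℂ)
  have h1 := den_ne_zero β t
  have h2 := den_ne_zero β s
  have h : (shift β t : ℂ) - shift β s = -((1 - (β : ℂ) * conj (β : ℂ)) * ((t : ℂ) - s)) /
      ((conj (β : ℂ) * t - 1) * (conj (β : ℂ) * s - 1)) := by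
    rw [coe_shift, coe_shift, div_sub_div _ _ h1 h2]
    congr 1
    ring
  rw [dist_eq_norm, dist_eq_norm, h, norm_div, norm_neg, norm_mul, norm_mul, div_mul_eq_mul_div]
  have h3 := norm_sub_ge β t
  have h4 := norm_sub_ge β s
  gcongr
  rw [sq]
  gcongr

lemma continuous_shift (β : OuterPoint) : Continuous (shift β) :=
  (lipschitz_shift β).choose_spec.continuous

instance instLeftInvariantArc : arc.IsMulLeftInvariant := by
  constructor
  intro z
  obtain ⟨y, rfl⟩ : ∃ y : AddCircle (2 * π), AddCircle.toCircle y = z := by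
    obtain ⟨x, rfl⟩ := AddCircle.homeomorphCircle'.surjective z
    refine ⟨x, ?_⟩
    induction x using QuotientAddGroup.induction_on with
    | H x => rw [AddCircle.homeomorphCircle'_apply_mk, AddCircle.toCircle_apply_mk]; congr 1; field_simp
  rw [arc, Measure.map_map (measurable_const_mul _) measurable_toCircle]
  have h : (fun x => AddCircle.toCircle y * x) ∘ AddCircle.toCircle =
      AddCircle.toCircle ∘ fun x : AddCircle (2 * π) => y + x := by
    funext x
    simp [AddCircle.toCircle_add]
  rw [h, ← Measure.map_map measurable_toCircle (measurable_const_add _), map_add_left_eq_self]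

/-- Arc length is a multiple of the one-dimensional Hausdorff measure. -/
lemma exists_hausdorff_eq : ∃ k : NNReal, k ≠ 0 ∧
    (Measure.hausdorffMeasure 1 : Measure Circle) = k • arc := by
  have hiso : IsIsometricSMul Circle Circle := ⟨fun z => Isometry.of_dist_eq fun u v => by
    change dist ((z : ℂ) * u) ((z : ℂ) * v) = dist (u : ℂ) (v : ℂ)
    rw [dist_eq_norm, dist_eq_norm, ← mul_sub, norm_mul, Circle.norm_coe, one_mul]⟩
  have hexp : LipschitzWith 1 (Circle.exp : ℝ → Circle) := by
    refine LipschitzWith.of_dist_le_mul fun x y => ?_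
    change dist (Circle.exp x : ℂ) (Circle.exp y : ℂ) ≤ _
    have h : (Circle.exp x : ℂ) - Circle.exp y =
        Circle.exp y * (Complex.exp (Complex.I * ((x - y : ℝ) : ℂ)) - 1) := by
      rw [mul_sub, Circle.coe_exp, Circle.coe_exp, ← Complex.exp_add, mul_one]
      congr 2
      push_cast
      ring
    rw [dist_eq_norm, h, norm_mul, Circle.norm_coe, NNReal.coe_one]
    gcongr
    exact Real.norm_exp_I_mul_ofReal_sub_one_le
  have hfin : (Measure.hausdorffMeasure 1 : Measure Circle) Set.univ < ∞ := by
    have h := hexp.hausdorffMeasure_image_le zero_le_one (Set.Icc (-π) π)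
    have h2 : Circle.exp '' Set.Icc (-π) π = Set.univ := by
      refine Set.eq_univ_of_forall fun z => ⟨Complex.arg z, ?_, Circle.exp_arg z⟩
      exact ⟨(Complex.neg_pi_lt_arg _).le, Complex.arg_le_pi _⟩
    rw [h2, hausdorffMeasure_real, Real.volume_Icc] at h
    exact h.trans_lt (by simp)
  have hpos : (Measure.hausdorffMeasure 1 : Measure Circle) Set.univ ≠ 0 := by
    have hre : LipschitzWith 1 (fun z : Circle => (z : ℂ).re) := by
      refine LipschitzWith.of_dist_le_mul fun x y => ?_
      change _ ≤ _ * dist (x : ℂ) (y : ℂ)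
      rw [dist_eq_norm, dist_eq_norm, NNReal.coe_one, one_mul, ← Complex.sub_re]
      exact Complex.abs_re_le_norm _
    have h := hre.hausdorffMeasure_image_le zero_le_one Set.univ
    have h2 : Set.Icc (-1 : ℝ) 1 ⊆ (fun z : Circle => (z : ℂ).re) '' Set.univ := by
      intro x hx
      refine ⟨Circle.exp (Real.arccos x), trivial, ?_⟩
      change (Circle.exp (Real.arccos x) : ℂ).re = x
      rw [Circle.coe_exp, Complex.exp_ofReal_mul_I_re, Real.cos_arccos hx.1 hx.2]
    intro h0
    rw [h0, mul_zero, hausdorffMeasure_real] at h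
    have h3 := (measure_mono h2).trans h
    rw [Real.volume_Icc] at h3
    norm_num at h3
  have : IsFiniteMeasure (Measure.hausdorffMeasure 1 : Measure Circle) := ⟨hfin⟩
  have : arc.IsHaarMeasure := Measure.isHaarMeasure_of_isCompact_nonempty_interior arc Set.univ
    isCompact_univ (by simp) (by simp) (by simp)
  have heq := Measure.isMulInvariant_eq_smul_of_compactSpace
    (Measure.hausdorffMeasure 1 : Measure Circle) arc
  refine ⟨_, fun h0 => hpos ?_, heq⟩
  rw [heq, h0]
  simp

lemma exists_map_shift_le (β : OuterPoint) :
    ∃ k : NNReal, arc.map (shift β) ≤ (k : ℝ≥0∞) • arc := by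
  obtain ⟨K, hK⟩ := lipschitz_shift β
  obtain ⟨k, hk, h⟩ := exists_hausdorff_eq
  refine ⟨K, Measure.le_iff.mpr fun s hs => ?_⟩
  rw [Measure.map_apply (continuous_shift β).measurable hs]
  have himg : shift β ⁻¹' s = shift β '' s := by
    ext t
    exact ⟨fun ht => ⟨shift β t, ht, shift_shift β t⟩,
      fun ⟨u, hu, hut⟩ => by rw [Set.mem_preimage, ← hut, shift_shift]; exact hu⟩
  have h1 := hK.hausdorffMeasure_image_le zero_le_one s
  rw [h, ← himg] at h1
  simp only [Measure.smul_apply, ENNReal.rpow_one, ENNReal.smul_def, smul_eq_mul] at h1 ⊢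
  have hk0 : (k : ℝ≥0∞) ≠ 0 := by exact_mod_cast hk
  rw [mul_left_comm] at h1
  exact (ENNReal.mul_le_mul_iff_right hk0 ENNReal.coe_ne_top).mp h1

lemma quasiMeasurePreserving_shift (β : OuterPoint) :
    Measure.QuasiMeasurePreserving (shift β) arc arc :=
  ⟨(continuous_shift β).measurable,
    Measure.absolutelyContinuous_of_le_smul (exists_map_shift_le β).choose_spec⟩

lemma memLp_comp_shift (p : ℝ≥0∞) [Fact (1 ≤ p)] (β : OuterPoint) (f : LpT p) :
    MemLp (fun t => f (shift β t)) p arc :=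
  ((Lp.memLp f).of_measure_le_smul ENNReal.coe_ne_top
    (exists_map_shift_le β).choose_spec).comp_of_map (continuous_shift β).measurable.aemeasurable

/-- The composition operator `f ↦ f ∘ α` on `L^p`. -/
def compShift (p : ℝ≥0∞) [Fact (1 ≤ p)] (β : OuterPoint) : LpT p →L[ℂ] LpT p :=
  LinearMap.mkContinuous
    { toFun := fun f => (memLp_comp_shift p β f).toLp fun t => f (shift β t)
      map_add' := fun f g => by
        rw [← MemLp.toLp_add]
        exact MemLp.toLp_congr _ _ ((quasiMeasurePreserving_shift β).ae (Lp.coeFn_add f g))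
      map_smul' := fun k f => by
        rw [RingHom.id_apply, ← MemLp.toLp_const_smul]
        exact MemLp.toLp_congr _ _ ((quasiMeasurePreserving_shift β).ae (Lp.coeFn_smul k f)) }
    (((exists_map_shift_le β).choose : ℝ≥0∞) ^ (1 / p).toReal).toReal
    (fun f => by
      have hle := eLpNorm_le_of_measure_le_smul (f := f) (p := p)
        (exists_map_shift_le β).choose_spec
      rw [eLpNorm_map_measure ((Lp.aestronglyMeasurable f).mono_ac (quasiMeasurePreserving_shift β).absolutelyContinuous)
        (continuous_shift β).measurable.aemeasurable] at hle
      rw [LinearMap.coe_mk, AddHom.coe_mk, Lp.norm_toLp, Lp.norm_def, ← ENNReal.toReal_mul]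
      refine ENNReal.toReal_mono (ENNReal.mul_ne_top ?_ (Lp.memLp f).2.ne) hle
      exact ENNReal.rpow_ne_top_of_nonneg ENNReal.toReal_nonneg ENNReal.coe_ne_top)

lemma coeFn_compShift (p : ℝ≥0∞) [Fact (1 ≤ p)] (β : OuterPoint) (f : LpT p) :
    compShift p β f =ᵐ[arc] fun t => f (shift β t) :=
  MemLp.coeFn_toLp (memLp_comp_shift p β f)

/-- The number `λ = i √(|β|² - 1)`. -/
def lam (β : OuterPoint) : ℂ := Complex.I * (Real.sqrt (‖(β : ℂ)‖ ^ 2 - 1) : ℂ)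

/-- The factor `α₋ (t) = λ t / (conj β * t - 1)` of the shift. -/
def alphaMinus (β : OuterPoint) (t : Circle) : ℂ := lam β * t / (conj (β : ℂ) * t - 1)

/-- The function `χ (t) = t / α₋ (t)`. -/
def chi (β : OuterPoint) (t : Circle) : ℂ := t / alphaMinus β t

/-- The weighted shift operator `(J f) (t) = t⁻¹ α₋ (t) f (α (t))` on `L^p`. -/
def shiftJ (p : ℝ≥0∞) [Fact (1 ≤ p)] (β : OuterPoint) : LpT p →L[ℂ] LpT p :=
  mulOp p (fun t => (t : ℂ)⁻¹ * alphaMinus β t) ∘L compShift p β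

/-! ### Toeplitz and generalized Hankel operators -/

/-- The Toeplitz operator `T (a) f = P a f` on `H^p`. -/
def toeplitz (p : ℝ≥0∞) [Fact (1 ≤ p)] (a : Circle → ℂ) : Hardy p →L[ℂ] Hardy p :=
  (rieszP p ∘L mulOp p a ∘L (Hardy p).subtypeL).codRestrict (Hardy p) fun _ => rieszP_mem p _

/-- The generalized Hankel operator `H_α (b) f = P b Q J_α f` on `H^p`. -/
def hankel (p : ℝ≥0∞) [Fact (1 ≤ p)] (β : OuterPoint) (b : Circle → ℂ) : Hardy p →L[ℂ] Hardy p :=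
  (rieszP p ∘L mulOp p b ∘L rieszQ p ∘L shiftJ p β ∘L (Hardy p).subtypeL).codRestrict (Hardy p)
    fun _ => rieszP_mem p _

/-- The operator `J_α Q g P`. -/
def shiftQP (p : ℝ≥0∞) [Fact (1 ≤ p)] (β : OuterPoint) (g : Circle → ℂ) : LpT p →L[ℂ] LpT p :=
  shiftJ p β ∘L rieszQ p ∘L mulOp p g ∘L rieszP p

/-- For `ε = 1` and `ε = -1`, the image of `(1/2) (I ± J_α Q g P)` on `ker T (g)`. This operator
maps `ker T (g)` into itself when `g * (g ∘ α) = 1`, so its image is a subspace of `H^p`. -/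
def imProj (p : ℝ≥0∞) [Fact (1 ≤ p)] (β : OuterPoint) (ε : ℂ) (g : Circle → ℂ) :
    Submodule ℂ (Hardy p) :=
  ((toeplitz p g).ker.map
    (((1 / 2 : ℂ) • (ContinuousLinearMap.id ℂ (LpT p) + ε • shiftQP p β g)) ∘L
      (Hardy p).subtypeL).toLinearMap).comap (Hardy p).subtype

/-- For `ε = 1` and `ε = -1`, the map `φ_α^±` given by
`2 φ_α^± (s) = R T(a_α⁻¹) s ∓ J_α Q c P R T(a_α⁻¹) s ± J_α Q a_α⁻¹ s`, where `a_α = a ∘ α`,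
`c = a / b`, and `R` is a right inverse of `T (c)`. -/
def phi (p : ℝ≥0∞) [Fact (1 ≤ p)] (β : OuterPoint) (ε : ℂ) (a b : Circle → ℂ)
    (R : Hardy p →L[ℂ] Hardy p) : Hardy p →L[ℂ] LpT p :=
  (1 / 2 : ℂ) •
    ((Hardy p).subtypeL ∘L R ∘L toeplitz p (fun t => (a (shift β t))⁻¹)
      - ε • (shiftQP p β (a / b) ∘L (Hardy p).subtypeL ∘L R ∘L
          toeplitz p (fun t => (a (shift β t))⁻¹))
      + ε • (shiftJ p β ∘L rieszQ p ∘L mulOp p (fun t => (a (shift β t))⁻¹) ∘L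
          (Hardy p).subtypeL))

/-- The right inverse `T (g t^κ)⁻¹ T (t^κ)` of a Fredholm Toeplitz operator `T (g)` of index
`κ ≥ 0`. -/
def toeplitzRightInv (p : ℝ≥0∞) [Fact (1 ≤ p)] (g : Circle → ℂ) (κ : ℤ) :
    Hardy p →L[ℂ] Hardy p :=
  Ring.inverse (toeplitz p fun t => g t * (t : ℂ) ^ κ) * toeplitz p fun t => (t : ℂ) ^ κ

/-! ### Wiener-Hopf factorization and the signature -/

/-- `g = g₋ t^k g₊` is a Wiener-Hopf factorization in `H^p`, where `1/p + 1/q = 1`. The condition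
`g₋ (∞) = 1` is a condition on the zeroth Fourier coefficient, and the last field says that the
operator `g₊⁻¹ P g₋⁻¹` on polynomials extends to a bounded operator on `H^p`. -/
structure IsWienerHopf (p q : ℝ≥0∞) [Fact (1 ≤ p)] (g : Circle → ℂ) (k : ℤ)
    (gm gp : Circle → ℂ) : Prop where
  eq : ∀ᵐ t ∂arc, g t = gm t * (t : ℂ) ^ k * gp t
  ne_zero : ∀ᵐ t ∂arc, gm t ≠ 0 ∧ gp t ≠ 0
  plus : MemHardy gp q
  plus_inv : MemHardy gp⁻¹ p
  minus : MemCoHardy gm p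
  minus_inv : MemCoHardy gm⁻¹ q
  minus_infty : fcoeff gm 0 = 1
  bounded : ∃ B : Hardy p →L[ℂ] Hardy p, ∀ (j : ℕ) (f : Hardy p),
    ((f : LpT p) =ᵐ[arc] fun t : Circle => (t : ℂ) ^ j) →
      ∃ u : Circle → ℂ, MemHardy u q ∧
        IsAnalyticPart (fun t => (gm t)⁻¹ * (t : ℂ) ^ j) u ∧
        (B f : LpT p) =ᵐ[arc] fun t => (gp t)⁻¹ * u t

/-- The `α`-signature `(λ / conj β) ^ κ * g₊⁻¹ (1 / conj β)`, where `κ` is the index of `T (g)`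
and `g₊` is the plus factor of `g`. -/
def signature (β : OuterPoint) (κ : ℤ) (gp : Circle → ℂ) : ℂ :=
  (lam β / conj (β : ℂ)) ^ κ * diskExt gp⁻¹ (1 / conj (β : ℂ))

end

end GTH

open GTH

namespace GTH

noncomputable section

/-! ### Monomials and Fourier coefficients -/

/-! Write J for J_α, ε for the sign, c for a/b and g_α for g ∘ α. The operator J is the involution J
f = χ⁻¹ (f ∘ α), and it exchanges H^p with the range of Q (`shiftJ_mem_Minus`, `shiftJ_mem_Hardy`).
Hence Q J f = J f on H^p, and f is in ker(T(a) + ε H_α(b)) exactly when η = a f + ε b J f lies in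
the range of Q. Putting s = ε J η and using a a_α = b b_α, this becomes c f + ε J f = a_α⁻¹ s, where
s runs through the solutions in H^p of d s = ε J s. These solutions are exactly im P^±(d)
(`mem_imProj_iff`, `mem_ker_iff_exists`).

If T(c) has a right inverse, φ(s) is a particular solution of this equation (`phi_spec`). The kernel
is then the image of φ plus the solutions of the homogeneous equation c g + ε J g = 0. The sum is
direct because the right-hand side determines s.

When T(c) has negative index there is no right inverse, so a, b are replaced by a' = a χ⁻ⁿ, b' = b
χⁿ. Since χ is analytic and χ_α = χ⁻¹, multiplication by χⁿ carries one kernel equation into the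
other and leaves d unchanged (`ker_toeplitz_add_hankel_eq_map`). Because χ⁻¹ = t⁻¹ α₋, the new
symbol satisfies c' t^(2n+κ₁) = α₋^(2n) c t^κ₁, whose Toeplitz operator is invertible. If 2n + κ₁ =
0, then T(c') is invertible and the homogeneous equation has only the zero solution. If 2n + κ₁ = 1,
then ker T(c') is spanned by c₊⁻¹, and J c' acts on it as a sign σ (`exists_sign`), so homogeneous
solutions other than zero exist only for ε = -σ. Evaluating J c' c₊⁻¹ = σ c₊⁻¹ at 1/conj β
identifies σ with the signature (`diskExt_shiftJ`, `homogeneous_iff_mem_span`).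

Invertibility of T(c t^κ₁) comes from the index and Coburn's lemma, and the factorization of c is
read off from its inverse (`exists_isWienerHopf_of_isUnit`). Both use the duality of L^p and L^q and
the fact that a nonzero Hardy function is nonzero almost everywhere. Boundedness of the Riesz
projection is extracted from the Fredholm hypothesis: otherwise `rieszP` takes its default value 0,
T(c) vanishes, and its kernel is infinite-dimensional. -/

lemma continuous_zpow_circle (n : ℤ) : Continuous fun t : Circle => (t : ℂ) ^ n :=
  Continuous.zpow₀ continuous_subtype_val n fun t => Or.inl (Circle.coe_ne_zero t)

lemma norm_zpow_circle (t : Circle) (n : ℤ) : ‖(t : ℂ) ^ n‖ = 1 := by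
  simp [Circle.norm_coe]

lemma memLp_zpow (n : ℤ) (r : ℝ≥0∞) : MemLp (fun t : Circle => (t : ℂ) ^ n) r arc :=
  MemLp.of_bound (continuous_zpow_circle n).aestronglyMeasurable 1
    (Eventually.of_forall fun t => (norm_zpow_circle t n).le)

lemma memLp_of_continuous {g : Circle → ℂ} (hg : Continuous g) (r : ℝ≥0∞) : MemLp g r arc := by
  obtain ⟨C, hC⟩ := isCompact_univ.exists_bound_of_continuousOn hg.continuousOn
  exact MemLp.of_bound hg.aestronglyMeasurable C (Eventually.of_forall fun t => hC t trivial)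

/-- Arc length is rotation invariant, and the rotation by exp(iπ/j) multiplies t^j by -1, so the
integral is its own negative. -/
lemma integral_zpow_circle {j : ℤ} (hj : j ≠ 0) : ∫ t : Circle, (t : ℂ) ^ j ∂arc = 0 := by
  have h := integral_mul_left_eq_self (μ := arc) (fun t : Circle => (t : ℂ) ^ j)
    (Circle.exp (π / j))
  have hz : ((Circle.exp (π / j) : Circle) : ℂ) ^ j = -1 := by
    rw [Circle.coe_exp, ← Complex.exp_int_mul, ← Complex.exp_pi_mul_I]
    congr 1
    have : (j : ℂ) ≠ 0 := by exact_mod_cast hj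
    push_cast
    field_simp
  simp only [Circle.coe_mul, mul_zpow, hz, integral_const_mul] at h
  linear_combination (-1 / 2 : ℂ) * h

lemma fcoeff_zpow (k n : ℤ) :
    fcoeff (fun t : Circle => (t : ℂ) ^ k) n = if n = k then 1 else 0 := by
  have h : ∀ t : Circle, (t : ℂ) ^ (-n) * (t : ℂ) ^ k = (t : ℂ) ^ (k - n) := fun t => by
    rw [← zpow_add₀ (Circle.coe_ne_zero t)]
    congr 1
    ring
  simp only [fcoeff, h]
  split_ifs with hn
  · simp [hn]
  · exact integral_zpow_circle (sub_ne_zero.mpr (Ne.symm hn))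

lemma fcoeff_zpow_mul (k : ℤ) (f : Circle → ℂ) (n : ℤ) :
    fcoeff (fun t : Circle => (t : ℂ) ^ k * f t) n = fcoeff f (n - k) := by
  refine integral_congr_ae (Eventually.of_forall fun t => ?_)
  change (t : ℂ) ^ (-n) * ((t : ℂ) ^ k * f t) = _
  rw [← mul_assoc, ← zpow_add₀ (Circle.coe_ne_zero t)]
  congr 2
  ring

lemma fcoeff_add {f g : Circle → ℂ} (hf : Integrable f arc) (hg : Integrable g arc) (n : ℤ) :
    fcoeff (fun t => f t + g t) n = fcoeff f n + fcoeff g n := by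
  simp only [fcoeff, mul_add]
  exact integral_add (integrable_zpow_mul hf _) (integrable_zpow_mul hg _)

lemma fcoeff_sub {f g : Circle → ℂ} (hf : Integrable f arc) (hg : Integrable g arc) (n : ℤ) :
    fcoeff (fun t => f t - g t) n = fcoeff f n - fcoeff g n := by
  simp only [fcoeff, mul_sub]
  exact integral_sub (integrable_zpow_mul hf _) (integrable_zpow_mul hg _)

lemma fcoeff_const_mul (k : ℂ) (f : Circle → ℂ) (n : ℤ) :
    fcoeff (fun t => k * f t) n = k * fcoeff f n := by
  simp only [fcoeff, mul_left_comm _ k, integral_const_mul]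

lemma fcoeff_const (k : ℂ) (n : ℤ) : fcoeff (fun _ => k) n = if n = 0 then k else 0 := by
  have h := fcoeff_const_mul k (fun t : Circle => (t : ℂ) ^ (0 : ℤ)) n
  rw [fcoeff_zpow] at h
  simpa using h

lemma norm_fcoeff_le {f : Circle → ℂ} (n : ℤ) : ‖fcoeff f n‖ ≤ ∫ t, ‖f t‖ ∂arc := by
  refine (norm_integral_le_integral_norm _).trans_eq ?_
  simp [Circle.norm_coe]

/-! ### Density of trigonometric polynomials -/

/-- The monomial `t ^ n` as a continuous function on the circle. -/
def monomialC (n : ℤ) : C(Circle, ℂ) := ⟨fun t => (t : ℂ) ^ n, continuous_zpow_circle n⟩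

/-- The monomial `t ^ n` as an element of `L^p`. -/
def monomialLp (p : ℝ≥0∞) (n : ℤ) : LpT p := (memLp_zpow n p).toLp _

lemma coeFn_monomialLp (p : ℝ≥0∞) (n : ℤ) :
    monomialLp p n =ᵐ[arc] fun t : Circle => (t : ℂ) ^ n := MemLp.coeFn_toLp _

lemma span_monomialC : (Submodule.span ℂ (Set.range monomialC)).topologicalClosure = ⊤ := by
  let e := AddCircle.homeomorphCircle (T := 2 * π) Real.two_pi_pos.ne'
  let Φ : C(AddCircle (2 * π), ℂ) →L[ℂ] C(Circle, ℂ) :=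
    { toFun := fun f => f.comp (e.symm : C(Circle, AddCircle (2 * π)))
      map_add' := fun _ _ => rfl
      map_smul' := fun _ _ => rfl
      cont := ContinuousMap.continuous_precomp _ }
  have hΦ : ∀ n, Φ (fourier n) = monomialC n := by
    intro n
    ext t
    change fourier n (e.symm t) = (t : ℂ) ^ n
    rw [fourier_apply, AddCircle.toCircle_zsmul, ← AddCircle.homeomorphCircle_apply
      Real.two_pi_pos.ne']
    simp [e]
  have hsurj : Function.Surjective Φ := fun g =>
    ⟨g.comp (e : C(AddCircle (2 * π), Circle)), by ext t; simp [Φ]⟩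
  have h := hsurj.denseRange.topologicalClosure_map_submodule (f := Φ)
    (span_fourier_closure_eq_top (T := 2 * π))
  rw [Submodule.map_span, ← Set.range_comp] at h
  convert h using 4
  funext n
  exact (hΦ n).symm

lemma eq_top_of_monomialLp_mem {p : ℝ≥0∞} [Fact (1 ≤ p)] (hp : p ≠ ∞)
    (V : Submodule ℂ (LpT p)) (hV : IsClosed (V : Set (LpT p)))
    (h : ∀ n, monomialLp p n ∈ V) : V = ⊤ := by
  have hd := (ContinuousMap.toLp_denseRange ℂ arc ℂ hp).topologicalClosure_map_submodule
    span_monomialC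
  refine top_unique (hd.symm.le.trans (Submodule.topologicalClosure_minimal _ ?_ hV))
  rw [Submodule.map_span, Submodule.span_le]
  rintro _ ⟨_, ⟨n, rfl⟩, rfl⟩
  exact h n

/-! ### Uniqueness of Fourier coefficients -/

/-- Integration against f is a bounded functional on C(Circle) that kills the monomials, hence all
continuous functions; smooth test functions then suffice to conclude f = 0. -/
lemma ae_eq_zero_of_fcoeff_eq_zero {f : Circle → ℂ} (hf : Integrable f arc)
    (h : ∀ n, fcoeff f n = 0) : f =ᵐ[arc] 0 := by
  let Λ : C(Circle, ℂ) →L[ℂ] ℂ :=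
    LinearMap.mkContinuous
      { toFun := fun φ => ∫ t, φ t * f t ∂arc
        map_add' := fun φ ψ => by
          simp only [ContinuousMap.add_apply, add_mul]
          exact integral_add
            (hf.bdd_mul (c := ‖φ‖) φ.continuous.aestronglyMeasurable
              (Eventually.of_forall φ.norm_coe_le_norm))
            (hf.bdd_mul (c := ‖ψ‖) ψ.continuous.aestronglyMeasurable
              (Eventually.of_forall ψ.norm_coe_le_norm))
        map_smul' := fun k φ => by
          simp only [ContinuousMap.smul_apply, smul_eq_mul, mul_assoc, integral_const_mul,
            RingHom.id_apply] }
      (∫ t, ‖f t‖ ∂arc) fun φ => by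
        rw [mul_comm, ← integral_const_mul]
        refine norm_integral_le_of_norm_le (hf.norm.const_mul _) (Eventually.of_forall fun t => ?_)
        rw [norm_mul]
        gcongr
        exact φ.norm_coe_le_norm t
  have hΛ : ∀ φ, Λ φ = ∫ t, φ t * f t ∂arc := fun _ => rfl
  have hker : Λ.ker = ⊤ := by
    refine top_unique (span_monomialC.symm.le.trans
      (Submodule.topologicalClosure_minimal _ ?_ Λ.isClosed_ker))
    rw [Submodule.span_le]
    rintro _ ⟨n, rfl⟩
    have := h (-n)
    rw [fcoeff, neg_neg] at this
    exact this
  refine ae_eq_zero_of_integral_contMDiff_smul_eq_zero (modelWithCornersSelf ℝ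
    (EuclideanSpace ℝ (Fin 1))) hf.locallyIntegrable fun g hg _ => ?_
  have h0 : Λ ⟨fun t => (g t : ℂ), Complex.continuous_ofReal.comp hg.continuous⟩ = 0 := by
    rw [← ContinuousLinearMap.coe_coe, ← LinearMap.mem_ker]
    rw [hker]
    trivial
  rw [hΛ] at h0
  simpa using h0

lemma ae_eq_of_fcoeff_eq {f g : Circle → ℂ} (hf : Integrable f arc) (hg : Integrable g arc)
    (h : ∀ n, fcoeff f n = fcoeff g n) : f =ᵐ[arc] g := by
  have h0 := ae_eq_zero_of_fcoeff_eq_zero (hf.sub hg) fun n => by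
    have := fcoeff_sub hf hg n
    rw [h, sub_self] at this
    exact this
  filter_upwards [h0] with t ht
  exact sub_eq_zero.mp ht

lemma integrable_coeFn {p : ℝ≥0∞} [hp : Fact (1 ≤ p)] (f : LpT p) : Integrable f arc :=
  (Lp.memLp f).integrable hp.out

lemma Lp_ext_of_fcoeff {p : ℝ≥0∞} [Fact (1 ≤ p)] {f g : LpT p}
    (h : ∀ n, fcoeff f n = fcoeff g n) : f = g :=
  Lp.ext (ae_eq_of_fcoeff_eq (integrable_coeFn f) (integrable_coeFn g) h)

/-! ### Duality pairing -/

/-- The functional `f ↦ ∫ f g` on `L^p` defined by a function `g` of the conjugate exponent. -/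
def pairing (p : ℝ≥0∞) {q : ℝ≥0∞} [Fact (1 ≤ p)] [Fact (1 ≤ q)] [p.HolderConjugate q]
    {g : Circle → ℂ} (hg : MemLp g q arc) : LpT p →L[ℂ] ℂ :=
  ((ContinuousLinearMap.mul ℂ ℂ).lpPairing arc p q).flip (hg.toLp g)

lemma pairing_apply {p q : ℝ≥0∞} [Fact (1 ≤ p)] [Fact (1 ≤ q)] [p.HolderConjugate q]
    {g : Circle → ℂ} (hg : MemLp g q arc) (f : LpT p) :
    pairing p hg f = ∫ t, f t * g t ∂arc := by
  rw [pairing, ContinuousLinearMap.flip_apply, ContinuousLinearMap.lpPairing_eq_integral]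
  refine integral_congr_ae ?_
  filter_upwards [hg.coeFn_toLp] with t ht
  simp [ht]

lemma fcoeff_mul_eq_pairing {p q : ℝ≥0∞} [Fact (1 ≤ p)] [Fact (1 ≤ q)] [p.HolderConjugate q]
    {g : Circle → ℂ} (n : ℤ) (h : MemLp (fun t : Circle => (t : ℂ) ^ (-n) * g t) q arc)
    (f : LpT p) : fcoeff (fun t => f t * g t) n = pairing p h f := by
  rw [pairing_apply, fcoeff]
  congr 1
  funext t
  ring

lemma memLp_zpow_mul {r : ℝ≥0∞} {g : Circle → ℂ} (hg : MemLp g r arc) (n : ℤ) :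
    MemLp (fun t : Circle => (t : ℂ) ^ n * g t) r arc :=
  hg.mul (memLp_zpow n ∞)

/-! ### The Riesz projection -/

/-- The projection of `L^p` onto `H^p` that deletes the Fourier coefficients of negative index
exists as a bounded operator. -/
class HasRieszProjection (p : ℝ≥0∞) [Fact (1 ≤ p)] : Prop where
  exists_projection : ∃ S : LpT p →L[ℂ] LpT p, ∀ f : LpT p, IsAnalyticPart f (S f)

lemma integral_norm_le {p : ℝ≥0∞} [Fact (1 ≤ p)] (f : LpT p) : ∫ t, ‖f t‖ ∂arc ≤ ‖f‖ := by
  have h1 : ∫ t, ‖f t‖ ∂arc = (eLpNorm f 1 arc).toReal := by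
    rw [eLpNorm_one_eq_lintegral_enorm, integral_norm_eq_lintegral_enorm
      (Lp.aestronglyMeasurable f)]
  rw [h1, Lp.norm_def]
  exact ENNReal.toReal_mono (Lp.memLp f).2.ne
    (eLpNorm_le_eLpNorm_of_exponent_le Fact.out (Lp.aestronglyMeasurable f))

/-- The `n`-th Fourier coefficient as a bounded functional on `L^p`. -/
def fcoeffL (p : ℝ≥0∞) [Fact (1 ≤ p)] (n : ℤ) : LpT p →L[ℂ] ℂ :=
  LinearMap.mkContinuous
    { toFun := fun f => fcoeff f n
      map_add' := fun f g => by
        rw [fcoeff_congr (Lp.coeFn_add f g)]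
        exact fcoeff_add (integrable_coeFn f) (integrable_coeFn g) n
      map_smul' := fun k f => by
        rw [fcoeff_congr (Lp.coeFn_smul k f)]
        exact fcoeff_const_mul k f n }
    1 fun f => by
      rw [one_mul]
      exact (norm_fcoeff_le n).trans (integral_norm_le f)

lemma fcoeffL_apply {p : ℝ≥0∞} [Fact (1 ≤ p)] (n : ℤ) (f : LpT p) : fcoeffL p n f = fcoeff f n :=
  rfl

lemma isClosed_Hardy {p : ℝ≥0∞} [Fact (1 ≤ p)] : IsClosed (Hardy p : Set (LpT p)) := by
  have h : (Hardy p : Set (LpT p)) = ⋂ n : ℤ, ⋂ _ : n < 0, {f | fcoeffL p n f = 0} := by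
    ext f
    simp only [Set.mem_iInter]
    rfl
  rw [h]
  exact isClosed_iInter fun n => isClosed_iInter fun _ =>
    isClosed_eq (fcoeffL p n).continuous continuous_const

section Riesz

variable {p : ℝ≥0∞} [Fact (1 ≤ p)] [HasRieszProjection p]

lemma fcoeff_rieszP (f : LpT p) (n : ℤ) :
    fcoeff (rieszP p f) n = if 0 ≤ n then fcoeff f n else 0 := by
  have h : ∃ S : LpT p →L[ℂ] LpT p, ∀ f : LpT p, IsAnalyticPart f (S f) :=
    HasRieszProjection.exists_projection
  rw [rieszP, dif_pos h]
  exact h.choose_spec f n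

lemma fcoeff_rieszQ (f : LpT p) (n : ℤ) :
    fcoeff (rieszQ p f) n = if 0 ≤ n then 0 else fcoeff f n := by
  rw [← fcoeffL_apply, rieszQ, _root_.sub_apply, map_sub, fcoeffL_apply,
    fcoeffL_apply, fcoeff_rieszP, ContinuousLinearMap.id_apply]
  split_ifs <;> simp

omit [HasRieszProjection p] in
lemma rieszP_add_rieszQ (f : LpT p) : rieszP p f + rieszQ p f = f := by
  simp [rieszQ]

variable (p) in
/-- The functions of `L^p` whose Fourier coefficients of nonnegative index vanish. -/
def Minus : Submodule ℂ (LpT p) := (rieszP p).ker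

lemma rieszP_eq_self {f : LpT p} (hf : f ∈ Hardy p) : rieszP p f = f := by
  refine Lp_ext_of_fcoeff fun n => ?_
  rw [fcoeff_rieszP]
  split_ifs with hn
  · rfl
  · exact (hf n (not_le.mp hn)).symm

lemma mem_Minus_iff {f : LpT p} : f ∈ Minus p ↔ ∀ n : ℤ, 0 ≤ n → fcoeff f n = 0 := by
  refine ⟨fun h n hn => ?_, fun h => ?_⟩
  · have h1 := fcoeff_rieszP f n
    rw [if_pos hn, show rieszP p f = 0 from h] at h1
    rw [← h1, ← fcoeffL_apply, map_zero]
  · change rieszP p f = 0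
    refine Lp_ext_of_fcoeff fun n => ?_
    rw [fcoeff_rieszP, ← fcoeffL_apply n (0 : LpT p), map_zero]
    split_ifs with hn
    · exact h n hn
    · rfl

omit [HasRieszProjection p] in
lemma rieszP_eq_zero {f : LpT p} (hf : f ∈ Minus p) : rieszP p f = 0 := hf

omit [HasRieszProjection p] in
lemma rieszQ_eq_self {f : LpT p} (hf : f ∈ Minus p) : rieszQ p f = f := by
  simp [rieszQ, rieszP_eq_zero hf]

lemma rieszQ_eq_zero {f : LpT p} (hf : f ∈ Hardy p) : rieszQ p f = 0 := by
  simp [rieszQ, rieszP_eq_self hf]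

lemma rieszQ_mem (f : LpT p) : rieszQ p f ∈ Minus p :=
  mem_Minus_iff.mpr fun n hn => by rw [fcoeff_rieszQ, if_pos hn]

omit [Fact (1 ≤ p)] [HasRieszProjection p] in
lemma fcoeff_monomialLp (k n : ℤ) : fcoeff (monomialLp p k) n = if n = k then 1 else 0 := by
  rw [fcoeff_congr (coeFn_monomialLp p k), fcoeff_zpow]

omit [HasRieszProjection p] in
lemma monomialLp_mem_Hardy {k : ℤ} (hk : 0 ≤ k) : monomialLp p k ∈ Hardy p := fun n hn => by
  rw [fcoeff_monomialLp, if_neg (by omega)]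

lemma monomialLp_mem_Minus {k : ℤ} (hk : k < 0) : monomialLp p k ∈ Minus p :=
  mem_Minus_iff.mpr fun n hn => by rw [fcoeff_monomialLp, if_neg (by omega)]

/-- The preimage of V under P is closed and contains every monomial, since P either fixes or kills
t^n; so it is all of L^p. This reduces closed linear statements about H^p to monomials. -/
lemma Hardy_le_of_monomialLp_mem (hp : p ≠ ∞) (V : Submodule ℂ (LpT p))
    (hV : IsClosed (V : Set (LpT p))) (h : ∀ n : ℤ, 0 ≤ n → monomialLp p n ∈ V) : Hardy p ≤ V := by
  have ht : V.comap (rieszP p).toLinearMap = ⊤ := by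
    refine eq_top_of_monomialLp_mem hp _ (hV.preimage (rieszP p).continuous) fun n => ?_
    change rieszP p _ ∈ V
    by_cases hn : 0 ≤ n
    · rw [rieszP_eq_self (monomialLp_mem_Hardy hn)]
      exact h n hn
    · rw [rieszP_eq_zero (monomialLp_mem_Minus (not_le.mp hn))]
      exact V.zero_mem
  intro f hf
  have : f ∈ V.comap (rieszP p).toLinearMap := ht ▸ trivial
  change rieszP p f ∈ V at this
  rwa [rieszP_eq_self hf] at this

lemma Minus_le_of_monomialLp_mem (hp : p ≠ ∞) (V : Submodule ℂ (LpT p))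
    (hV : IsClosed (V : Set (LpT p))) (h : ∀ n : ℤ, n < 0 → monomialLp p n ∈ V) : Minus p ≤ V := by
  have ht : V.comap (rieszQ p).toLinearMap = ⊤ := by
    refine eq_top_of_monomialLp_mem hp _ (hV.preimage (rieszQ p).continuous) fun n => ?_
    change rieszQ p _ ∈ V
    by_cases hn : 0 ≤ n
    · rw [rieszQ_eq_zero (monomialLp_mem_Hardy hn)]
      exact V.zero_mem
    · rw [rieszQ_eq_self (monomialLp_mem_Minus (not_le.mp hn))]
      exact h n (not_le.mp hn)
  intro f hf
  have : f ∈ V.comap (rieszQ p).toLinearMap := ht ▸ trivial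
  change rieszQ p f ∈ V at this
  rwa [rieszQ_eq_self hf] at this

/-! ### Products of Hardy functions -/

variable {q : ℝ≥0∞} [Fact (1 ≤ q)] [p.HolderConjugate q]

omit [Fact (1 ≤ p)] [HasRieszProjection p] in
lemma fcoeff_mul_monomialLp (g : Circle → ℂ) (k n : ℤ) :
    fcoeff (fun t => monomialLp p k t * g t) n = fcoeff g (n - k) := by
  rw [← fcoeff_zpow_mul]
  refine fcoeff_congr ?_ n
  filter_upwards [coeFn_monomialLp p k] with t ht
  rw [ht]

omit [HasRieszProjection p] in
/-- A linear relation between the Fourier coefficients of `f g` and `f` that holds for the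
monomials of a dense set holds on its closed span. -/
lemma fcoeff_mul_eq_of_monomial {g : Circle → ℂ} (hg : MemLp g q arc) (n m : ℤ) (z : ℂ)
    {W : Submodule ℂ (LpT p)} {S : Set ℤ}
    (hW : ∀ V : Submodule ℂ (LpT p), IsClosed (V : Set (LpT p)) →
      (∀ k ∈ S, monomialLp p k ∈ V) → W ≤ V)
    (h : ∀ k ∈ S, fcoeff g (n - k) = if m = k then z else 0) {f : LpT p} (hf : f ∈ W) :
    fcoeff (fun t => f t * g t) n = fcoeff f m * z := by
  let Λ : LpT p →L[ℂ] ℂ := pairing p (memLp_zpow_mul hg (-n)) - z • fcoeffL p m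
  have hΛ : ∀ f, Λ f = fcoeff (fun t => f t * g t) n - z * fcoeff f m := fun f => by
    rw [fcoeff_mul_eq_pairing n (memLp_zpow_mul hg (-n))]
    rfl
  have h0 : f ∈ Λ.ker := hW Λ.ker Λ.isClosed_ker (fun k hk => by
    change Λ _ = 0
    rw [hΛ, fcoeff_mul_monomialLp, h k hk, fcoeff_monomialLp]
    split_ifs <;> simp) hf
  have h1 : Λ f = 0 := h0
  rw [hΛ] at h1
  linear_combination h1

/-- For f = t^k with k ≥ 0, the coefficient is that of g at n - k ≤ 0, which can be nonzero only if
n = k = 0. Density does the rest. -/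
lemma fcoeff_mul_Hardy (hp : p ≠ ∞) {g : Circle → ℂ} (hg : MemHardy g q) {f : LpT p}
    (hf : f ∈ Hardy p) {n : ℤ} (hn : n ≤ 0) :
    fcoeff (fun t => f t * g t) n = if n = 0 then fcoeff f 0 * fcoeff g 0 else 0 := by
  have hW := fun V => Hardy_le_of_monomialLp_mem (p := p) hp V
  rw [fcoeff_mul_eq_of_monomial (S := {k | 0 ≤ k}) hg.1 n 0 (if n = 0 then fcoeff g 0 else 0)
    hW ?_ hf, mul_ite, mul_zero]
  intro k hk
  have hk' : 0 ≤ k := hk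
  rcases hk'.eq_or_lt with rfl | hk''
  · rcases hn.eq_or_lt with rfl | hn
    · simp
    · simp [hn.ne, hg.2 n hn]
  · rw [if_neg hk''.ne, hg.2 _ (by omega)]

lemma fcoeff_mul_Minus (hp : p ≠ ∞) {g : Circle → ℂ} (hg : MemCoHardy g q) {f : LpT p}
    (hf : f ∈ Minus p) {n : ℤ} (hn : -1 ≤ n) :
    fcoeff (fun t => f t * g t) n = if n = -1 then fcoeff f (-1) * fcoeff g 0 else 0 := by
  have hW := fun V => Minus_le_of_monomialLp_mem (p := p) hp V
  rw [fcoeff_mul_eq_of_monomial (S := {k | k < 0}) hg.1 n (-1) (if n = -1 then fcoeff g 0 else 0)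
    hW ?_ hf, mul_ite, mul_zero]
  intro k hk
  have hk' : k < 0 := hk
  by_cases h : k = -1
  · subst h
    by_cases hn' : n = -1
    · simp [hn']
    · simp [hn', hg.2 (n + 1) (by omega)]
  · rw [if_neg (Ne.symm h), hg.2 _ (by omega)]

lemma MemHardy.mul_fcoeff (hp : p ≠ ∞) {f g : Circle → ℂ} (hf : MemHardy f p)
    (hg : MemHardy g q) {n : ℤ} (hn : n ≤ 0) :
    fcoeff (fun t => f t * g t) n = if n = 0 then fcoeff f 0 * fcoeff g 0 else 0 := by
  have hc := hf.1.coeFn_toLp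
  have h : hf.1.toLp f ∈ Hardy p := fun n hn => by rw [fcoeff_congr hc, hf.2 n hn]
  rw [← fcoeff_congr hc, ← fcoeff_mul_Hardy hp hg h hn]
  refine fcoeff_congr ?_ n
  filter_upwards [hc] with t ht
  rw [ht]

lemma MemCoHardy.mul_fcoeff (hp : p ≠ ∞) {f g : Circle → ℂ} (hf : MemCoHardy f p)
    (hg : MemCoHardy g q) {n : ℤ} (hn : 0 ≤ n) :
    fcoeff (fun t => f t * g t) n = if n = 0 then fcoeff f 0 * fcoeff g 0 else 0 := by
  -- The factor t⁻¹ moves f into `Minus`; index 0 of f becomes index -1.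
  have hm := memLp_zpow_mul hf.1 (-1)
  have hc := hm.coeFn_toLp
  have h : hm.toLp _ ∈ Minus p := mem_Minus_iff.mpr fun n hn => by
    rw [fcoeff_congr hc, fcoeff_zpow_mul, hf.2 _ (by omega)]
  have h1 := fcoeff_mul_Minus hp hg h (n := n - 1) (by omega)
  rw [fcoeff_congr hc, fcoeff_zpow_mul, sub_self] at h1
  have h2 : fcoeff (fun t => hm.toLp _ t * g t) (n - 1) = fcoeff (fun t => f t * g t) n := by
    rw [← fcoeff_zpow_mul]
    refine fcoeff_congr ?_ _
    filter_upwards [hc] with t ht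
    rw [ht, ← mul_assoc, ← mul_assoc, ← zpow_add₀ (Circle.coe_ne_zero t)]
    simp
  rw [← h2, h1]
  simp only [sub_eq_neg_self]

end Riesz

/-! ### Bounded Hardy functions -/

lemma MemHardy.congr {f g : Circle → ℂ} {r : ℝ≥0∞} (hf : MemHardy f r) (h : f =ᵐ[arc] g) :
    MemHardy g r :=
  ⟨hf.1.ae_eq h, fun n hn => by rw [← fcoeff_congr h, hf.2 n hn]⟩

lemma MemCoHardy.congr {f g : Circle → ℂ} {r : ℝ≥0∞} (hf : MemCoHardy f r) (h : f =ᵐ[arc] g) :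
    MemCoHardy g r :=
  ⟨hf.1.ae_eq h, fun n hn => by rw [← fcoeff_congr h, hf.2 n hn]⟩

lemma MemHardy.of_top {g : Circle → ℂ} (hg : MemHardy g ∞) (r : ℝ≥0∞) : MemHardy g r :=
  ⟨hg.1.mono_exponent le_top, hg.2⟩

lemma MemCoHardy.of_top {g : Circle → ℂ} (hg : MemCoHardy g ∞) (r : ℝ≥0∞) : MemCoHardy g r :=
  ⟨hg.1.mono_exponent le_top, hg.2⟩

lemma MemHardy.const_mul {f : Circle → ℂ} {r : ℝ≥0∞} (hf : MemHardy f r) (k : ℂ) :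
    MemHardy (fun t => k * f t) r :=
  ⟨hf.1.const_mul k, fun n hn => by rw [fcoeff_const_mul, hf.2 n hn, mul_zero]⟩

lemma MemCoHardy.const_mul {f : Circle → ℂ} {r : ℝ≥0∞} (hf : MemCoHardy f r) (k : ℂ) :
    MemCoHardy (fun t => k * f t) r :=
  ⟨hf.1.const_mul k, fun n hn => by rw [fcoeff_const_mul, hf.2 n hn, mul_zero]⟩

lemma MemHardy.add_top {f g : Circle → ℂ} (hf : MemHardy f ∞) (hg : MemHardy g ∞) :
    MemHardy (fun t => f t + g t) ∞ :=
  ⟨hf.1.add hg.1, fun n hn => by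
    rw [fcoeff_add (hf.1.integrable le_top) (hg.1.integrable le_top), hf.2 n hn, hg.2 n hn,
      add_zero]⟩

lemma MemCoHardy.add_top {f g : Circle → ℂ} (hf : MemCoHardy f ∞) (hg : MemCoHardy g ∞) :
    MemCoHardy (fun t => f t + g t) ∞ :=
  ⟨hf.1.add hg.1, fun n hn => by
    rw [fcoeff_add (hf.1.integrable le_top) (hg.1.integrable le_top), hf.2 n hn, hg.2 n hn,
      add_zero]⟩

lemma memHardy_const (k : ℂ) (r : ℝ≥0∞) : MemHardy (fun _ => k) r :=
  ⟨memLp_const k, fun n hn => by rw [fcoeff_const, if_neg hn.ne]⟩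

lemma memCoHardy_const (k : ℂ) (r : ℝ≥0∞) : MemCoHardy (fun _ => k) r :=
  ⟨memLp_const k, fun n hn => by rw [fcoeff_const, if_neg hn.ne']⟩

lemma memHardy_zpow {k : ℤ} (hk : 0 ≤ k) (r : ℝ≥0∞) : MemHardy (fun t => (t : ℂ) ^ k) r :=
  ⟨memLp_zpow k r, fun n hn => by rw [fcoeff_zpow, if_neg (by omega)]⟩

lemma memCoHardy_zpow {k : ℤ} (hk : k ≤ 0) (r : ℝ≥0∞) : MemCoHardy (fun t => (t : ℂ) ^ k) r :=
  ⟨memLp_zpow k r, fun n hn => by rw [fcoeff_zpow, if_neg (by omega)]⟩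

lemma exists_holderConjugate (p : ℝ≥0∞) [hp : Fact (1 ≤ p)] :
    ∃ q : ℝ≥0∞, Fact (1 ≤ q) ∧ p.HolderConjugate q := by
  refine ⟨(1 - p⁻¹)⁻¹, ⟨ENNReal.one_le_inv.mpr tsub_le_self⟩,
    ENNReal.holderConjugate_iff.mpr ?_⟩
  rw [inv_inv, add_tsub_cancel_of_le (ENNReal.inv_le_one.mpr hp.out)]

/-! ### Products and powers of bounded Hardy functions -/

section Mul

variable (p : ℝ≥0∞) [Fact (1 ≤ p)] [HasRieszProjection p]

lemma MemHardy.mul_top (hp : p ≠ ∞) {f g : Circle → ℂ} (hf : MemHardy f ∞) (hg : MemHardy g ∞) :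
    MemHardy (fun t => f t * g t) ∞ := by
  obtain ⟨q, _, _⟩ := exists_holderConjugate p
  refine ⟨hg.1.mul hf.1, fun n hn => ?_⟩
  rw [MemHardy.mul_fcoeff hp (hf.of_top p) (hg.of_top q) hn.le, if_neg hn.ne]

lemma MemCoHardy.mul_top (hp : p ≠ ∞) {f g : Circle → ℂ} (hf : MemCoHardy f ∞)
    (hg : MemCoHardy g ∞) :
    MemCoHardy (fun t => f t * g t) ∞ ∧
      fcoeff (fun t => f t * g t) 0 = fcoeff f 0 * fcoeff g 0 := by
  obtain ⟨q, _, _⟩ := exists_holderConjugate p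
  refine ⟨⟨hg.1.mul hf.1, fun n hn => ?_⟩, ?_⟩
  · rw [MemCoHardy.mul_fcoeff hp (hf.of_top p) (hg.of_top q) hn.le, if_neg hn.ne']
  · rw [MemCoHardy.mul_fcoeff hp (hf.of_top p) (hg.of_top q) le_rfl, if_pos rfl]

lemma MemHardy.pow_top (hp : p ≠ ∞) {f : Circle → ℂ} (hf : MemHardy f ∞) (k : ℕ) :
    MemHardy (fun t => f t ^ k) ∞ := by
  induction k with
  | zero => simpa using memHardy_const 1 ∞
  | succ k ih => simpa only [pow_succ] using ih.mul_top p hp hf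

lemma MemCoHardy.pow_top (hp : p ≠ ∞) {f : Circle → ℂ} (hf : MemCoHardy f ∞) (k : ℕ) :
    MemCoHardy (fun t => f t ^ k) ∞ ∧ fcoeff (fun t => f t ^ k) 0 = fcoeff f 0 ^ k := by
  induction k with
  | zero => simpa [fcoeff_const] using memCoHardy_const 1 ∞
  | succ k ih =>
    have h := ih.1.mul_top p hp hf
    simp only [pow_succ]
    exact ⟨h.1, by rw [h.2, ih.2]⟩

end Mul

/-- Iteration gives v 0 = ζ^k v k, which tends to 0. Applied to Fourier coefficients, this shows
that the Cauchy kernels are analytic or coanalytic without expanding them in series. -/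
lemma eq_zero_of_geometric {v : ℕ → ℂ} {M : ℝ} {ζ : ℂ} (hζ : ‖ζ‖ < 1) (hM : ∀ k, ‖v k‖ ≤ M)
    (h : ∀ k, v k = ζ * v (k + 1)) : v 0 = 0 := by
  have hk : ∀ k, v 0 = ζ ^ k * v k := fun k => by
    induction k with
    | zero => simp
    | succ k ih => rw [ih, h k, pow_succ, mul_assoc]
  have hle : ∀ k, ‖v 0‖ ≤ ‖ζ‖ ^ k * M := fun k => by
    rw [hk k, norm_mul, norm_pow]
    gcongr
    exact hM k
  have hlim := (tendsto_pow_atTop_nhds_zero_of_lt_one (norm_nonneg ζ) hζ).mul_const M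
  rw [zero_mul] at hlim
  exact norm_le_zero_iff.mp (ge_of_tendsto' hlim hle)

lemma one_sub_ne_zero_of_norm_lt {ζ : ℂ} (hζ : ‖ζ‖ < 1) {w : ℂ} (hw : ‖w‖ = 1) :
    1 - ζ * w ≠ 0 := by
  intro h
  have h1 : ‖ζ * w‖ = 1 := by rw [← sub_eq_zero.mp h, norm_one]
  rw [norm_mul, hw, mul_one] at h1
  exact hζ.ne h1

/-- The kernel `1 / (1 - ζ t ^ k)`; it is used for `k = 1` and `k = -1`. -/
def geom (ζ : ℂ) (k : ℤ) (t : Circle) : ℂ := (1 - ζ * (t : ℂ) ^ k)⁻¹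

/-! ### Cauchy kernels and point evaluation in the disc -/

section Geom

variable {ζ : ℂ} (hζ : ‖ζ‖ < 1)
include hζ

lemma geom_den_ne_zero (k : ℤ) (t : Circle) : 1 - ζ * (t : ℂ) ^ k ≠ 0 :=
  one_sub_ne_zero_of_norm_lt hζ (norm_zpow_circle t k)

lemma memLp_geom (k : ℤ) (r : ℝ≥0∞) : MemLp (geom ζ k) r arc :=
  memLp_of_continuous ((continuous_const.sub
    (continuous_const.mul (continuous_zpow_circle k))).inv₀ (geom_den_ne_zero hζ k)) r

/-- The identity geom = 1 + ζ t^k geom, multiplied by f and read coefficientwise. -/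
lemma fcoeff_geom_mul {k : ℤ} {f : Circle → ℂ} (hf : MemLp f 1 arc) (n : ℤ) :
    fcoeff (fun t => geom ζ k t * f t) n =
      fcoeff f n + ζ * fcoeff (fun t => geom ζ k t * f t) (n - k) := by
  have hg : MemLp (fun t => geom ζ k t * f t) 1 arc := hf.mul (memLp_geom hζ k ∞)
  have hI : Integrable (fun t : Circle => ζ * ((t : ℂ) ^ k * (geom ζ k t * f t))) arc :=
    (integrable_zpow_mul (memLp_one_iff_integrable.mp hg) k).const_mul ζ
  rw [← fcoeff_zpow_mul, ← fcoeff_const_mul, ← fcoeff_add (memLp_one_iff_integrable.mp hf) hI]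
  congr 1
  funext t
  have := geom_den_ne_zero hζ k t
  simp only [geom]
  field_simp
  ring

lemma fcoeff_geom (k n : ℤ) :
    fcoeff (geom ζ k) n = (if n = 0 then 1 else 0) + ζ * fcoeff (geom ζ k) (n - k) := by
  have h := fcoeff_geom_mul hζ (k := k) (memLp_const (1 : ℂ)) n
  simpa only [mul_one, fcoeff_const] using h

lemma memHardy_geom : MemHardy (geom ζ 1) ∞ := by
  refine ⟨memLp_geom hζ 1 ∞, fun n hn => ?_⟩
  have := eq_zero_of_geometric (v := fun k : ℕ => fcoeff (geom ζ 1) (n - k)) hζ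
    (fun k => norm_fcoeff_le _) fun k => by
      rw [fcoeff_geom hζ, if_neg (by omega), zero_add]
      push_cast
      congr 2
      ring
  simpa using this

lemma memCoHardy_geom : MemCoHardy (geom ζ (-1)) ∞ := by
  refine ⟨memLp_geom hζ (-1) ∞, fun n hn => ?_⟩
  have := eq_zero_of_geometric (v := fun k : ℕ => fcoeff (geom ζ (-1)) (n + k)) hζ
    (fun k => norm_fcoeff_le _) fun k => by
      rw [fcoeff_geom hζ, if_neg (by omega), zero_add]
      push_cast
      congr 2
      ring
  simpa using this

lemma fcoeff_geom_neg_one_zero : fcoeff (geom ζ (-1)) 0 = 1 := by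
  rw [fcoeff_geom hζ, (memCoHardy_geom hζ).2 _ (by omega)]
  simp

/-- The value at `ζ` of the analytic extension is a Fourier coefficient of the product with the
Cauchy kernel. -/
lemma diskExt_eq_fcoeff {f : Circle → ℂ} (hf : Integrable f arc) :
    diskExt f ζ = fcoeff (fun t => geom ζ (-1) t * f t) 0 := by
  have hf1 := memLp_one_iff_integrable.mpr hf
  set u : ℤ → ℂ := fcoeff (fun t => geom ζ (-1) t * f t) with hu
  have hrec : ∀ n : ℤ, u n = fcoeff f n + ζ * u (n + 1) := fun n => by
    have := fcoeff_geom_mul hζ (k := -1) hf1 n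
    rwa [sub_neg_eq_add] at this
  have hpart : ∀ N : ℕ, ∑ n ∈ Finset.range N, fcoeff f n * ζ ^ n = u 0 - ζ ^ N * u N := fun N => by
    induction N with
    | zero => simp
    | succ N ih =>
      rw [Finset.sum_range_succ, ih, hrec N]
      push_cast
      ring
  have hsum : Summable fun n : ℕ => fcoeff f n * ζ ^ n := by
    refine Summable.of_norm_bounded ((summable_geometric_of_lt_one (norm_nonneg ζ) hζ).mul_left
      (∫ t, ‖f t‖ ∂arc)) fun n => ?_
    rw [norm_mul, norm_pow]
    gcongr
    exact norm_fcoeff_le _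
  refine tendsto_nhds_unique hsum.hasSum.tendsto_sum_nat ?_
  simp_rw [hpart]
  have h0 : Tendsto (fun N : ℕ => ζ ^ N * u N) atTop (nhds 0) := by
    refine squeeze_zero_norm (a := fun N : ℕ => ‖ζ‖ ^ N * ∫ t, ‖geom ζ (-1) t * f t‖ ∂arc)
      (fun N => ?_) ?_
    · rw [norm_mul, norm_pow]
      gcongr
      exact norm_fcoeff_le _
    · simpa using (tendsto_pow_atTop_nhds_zero_of_lt_one (norm_nonneg ζ) hζ).mul_const
        (∫ t, ‖geom ζ (-1) t * f t‖ ∂arc)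
  simpa using tendsto_const_nhds.sub h0

end Geom

/-! ### The functions attached to the shift -/

section Shift

variable (β : OuterPoint)

lemma coe_ne_zero : (β : ℂ) ≠ 0 := norm_pos_iff.mp (one_pos.trans β.2)

lemma conj_coe_ne_zero : conj (β : ℂ) ≠ 0 := (map_ne_zero _).mpr (coe_ne_zero β)

lemma norm_inv_lt_one : ‖(β : ℂ)⁻¹‖ < 1 := by
  rw [norm_inv]
  exact inv_lt_one_of_one_lt₀ β.2

lemma norm_inv_conj_lt_one : ‖(conj (β : ℂ))⁻¹‖ < 1 := by
  rw [norm_inv, RCLike.norm_conj]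
  exact inv_lt_one_of_one_lt₀ β.2

lemma lam_sq : lam β ^ 2 = 1 - β * conj (β : ℂ) := by
  have h : (0 : ℝ) ≤ ‖(β : ℂ)‖ ^ 2 - 1 := by nlinarith [β.2]
  rw [lam, mul_pow, Complex.I_sq, ← Complex.ofReal_pow, Real.sq_sqrt h, Complex.mul_conj,
    Complex.normSq_eq_norm_sq]
  push_cast
  ring

lemma lam_ne_zero : lam β ≠ 0 := by
  have h : (0 : ℝ) < ‖(β : ℂ)‖ ^ 2 - 1 := by nlinarith [β.2]
  refine mul_ne_zero Complex.I_ne_zero ?_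
  exact_mod_cast (Real.sqrt_pos.mpr h).ne'

lemma sub_coe_ne_zero (t : Circle) : (t : ℂ) - β ≠ 0 := by
  rw [← norm_ne_zero_iff, norm_sub_eq, norm_ne_zero_iff]
  exact den_ne_zero β t

lemma chi_eq (t : Circle) : chi β t = (conj (β : ℂ) * t - 1) / lam β := by
  have := Circle.coe_ne_zero t
  have := den_ne_zero β t
  have := lam_ne_zero β
  rw [chi, alphaMinus]
  field_simp

lemma chi_ne_zero (t : Circle) : chi β t ≠ 0 := by
  rw [chi_eq]
  exact div_ne_zero (den_ne_zero β t) (lam_ne_zero β)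

lemma inv_mul_alphaMinus (t : Circle) : (t : ℂ)⁻¹ * alphaMinus β t = (chi β t)⁻¹ := by
  rw [chi, inv_div, div_eq_inv_mul]

/-- This is where λ matters: λ² = 1 - |β|² is exactly the normalization that makes χ ∘ α = χ⁻¹, and
hence J an involution. -/
lemma chi_shift (t : Circle) : chi β (shift β t) = (chi β t)⁻¹ := by
  have h1 := den_ne_zero β t
  have h2 := lam_ne_zero β
  rw [chi_eq, chi_eq, coe_shift, inv_div, div_eq_div_iff h2 h1, ← sq, lam_sq]
  field_simp
  ring

lemma alphaMinus_eq (t : Circle) :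
    alphaMinus β t = lam β / conj (β : ℂ) * geom (conj (β : ℂ))⁻¹ (-1) t := by
  have h1 := Circle.coe_ne_zero t
  have h2 := den_ne_zero β t
  have h3 := conj_coe_ne_zero β
  have h4 := geom_den_ne_zero (norm_inv_conj_lt_one β) (-1) t
  rw [alphaMinus, geom, ← div_eq_mul_inv, div_div, div_eq_div_iff h2 (mul_ne_zero h3 h4), zpow_neg,
    zpow_one]
  field_simp

lemma memCoHardy_alphaMinus : MemCoHardy (alphaMinus β) ∞ :=
  ((memCoHardy_geom (norm_inv_conj_lt_one β)).const_mul _).congr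
    (Eventually.of_forall fun t => (alphaMinus_eq β t).symm)

lemma fcoeff_alphaMinus_zero : fcoeff (alphaMinus β) 0 = lam β / conj (β : ℂ) := by
  rw [fcoeff_congr (Eventually.of_forall (alphaMinus_eq β)), fcoeff_const_mul,
    fcoeff_geom_neg_one_zero (norm_inv_conj_lt_one β), mul_one]

lemma memHardy_chi : MemHardy (chi β) ∞ := by
  refine (((memHardy_zpow zero_le_one ∞).const_mul (conj (β : ℂ) / lam β)).add_top
    (memHardy_const (-1 / lam β) ∞)).congr (Eventually.of_forall fun t => ?_)
  simp only [chi_eq, zpow_one]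
  ring

lemma inv_sub_coe_eq (t : Circle) :
    lam β / ((t : ℂ) - β) = -lam β / β * geom (β : ℂ)⁻¹ 1 t := by
  have h2 := sub_coe_ne_zero β t
  have h3 := coe_ne_zero β
  have h4 := geom_den_ne_zero (norm_inv_lt_one β) 1 t
  rw [geom, ← div_eq_mul_inv, div_div, div_eq_div_iff h2 (mul_ne_zero h3 h4), zpow_one]
  field_simp
  ring

lemma memHardy_inv_sub : MemHardy (fun t => lam β / ((t : ℂ) - β)) ∞ :=
  ((memHardy_geom (norm_inv_lt_one β)).const_mul _).congr
    (Eventually.of_forall fun t => (inv_sub_coe_eq β t).symm)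

/-- This function is J t⁻¹. Its only pole β lies outside the disc, so it is analytic inside. -/
lemma inv_chi_mul_inv_shift (t : Circle) :
    (chi β t)⁻¹ * (shift β t : ℂ)⁻¹ = lam β / ((t : ℂ) - β) := by
  have h1 := den_ne_zero β t
  have h2 := sub_coe_ne_zero β t
  have h3 := lam_ne_zero β
  rw [chi_eq, coe_shift]
  field_simp

lemma memLp_inv_chi (r : ℝ≥0∞) : MemLp (fun t => (chi β t)⁻¹) r arc :=
  (memLp_zpow_mul ((memCoHardy_alphaMinus β).of_top r).1 (-1)).ae_eq
    (Eventually.of_forall fun t => by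
      simp only [zpow_neg, zpow_one, inv_mul_alphaMinus])

section Riesz

variable (p : ℝ≥0∞) [Fact (1 ≤ p)] [HasRieszProjection p]
include p

/-- The pole 1/conj β of α lies inside the disc and its zero β outside, so α extends analytically to
the exterior and α⁻¹ to the interior. This is why J exchanges the two halves of L^p. -/
lemma memCoHardy_shift (hp : p ≠ ∞) : MemCoHardy (fun t => (shift β t : ℂ)) ∞ := by
  have h1 : MemCoHardy (fun t : Circle => -β * (t : ℂ) ^ (-1 : ℤ) + 1) ∞ :=
    ((memCoHardy_zpow (by norm_num) ∞).const_mul _).add_top (memCoHardy_const 1 ∞)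
  refine (h1.mul_top p hp ((memCoHardy_alphaMinus β).const_mul (lam β)⁻¹)).1.congr
    (Eventually.of_forall fun t => ?_)
  have h2 := den_ne_zero β t
  have h3 := lam_ne_zero β
  have h4 := Circle.coe_ne_zero t
  simp only [coe_shift, alphaMinus, zpow_neg, zpow_one]
  field_simp
  ring

lemma memHardy_inv_shift (hp : p ≠ ∞) : MemHardy (fun t => (shift β t : ℂ)⁻¹) ∞ := by
  refine ((memHardy_chi β).mul_top p hp (memHardy_inv_sub β)).congr
    (Eventually.of_forall fun t => ?_)
  simp only [← inv_chi_mul_inv_shift]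
  rw [← mul_assoc, mul_inv_cancel₀ (chi_ne_zero β t), one_mul]

end Riesz

end Shift

/-! ### Multiplication operators and the weighted shift -/

section Operators

variable {p : ℝ≥0∞} [Fact (1 ≤ p)]

lemma mulOp_congr {a b : Circle → ℂ} (ha : MemLp a ∞ arc) (h : a =ᵐ[arc] b) :
    mulOp p a = mulOp p b := by
  refine ContinuousLinearMap.ext fun f => Lp.ext ?_
  filter_upwards [coeFn_mulOp p ha f, coeFn_mulOp p (ha.ae_eq h) f, h] with t h1 h2 h3
  rw [h1, h2, h3]

lemma mulOp_mulOp {a b : Circle → ℂ} (ha : MemLp a ∞ arc) (hb : MemLp b ∞ arc) (f : LpT p) :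
    mulOp p a (mulOp p b f) = mulOp p (fun t => a t * b t) f := by
  refine Lp.ext ?_
  filter_upwards [coeFn_mulOp p ha (mulOp p b f), coeFn_mulOp p hb f,
    coeFn_mulOp p (a := fun t => a t * b t) (hb.mul ha) f] with t h1 h2 h3
  rw [h1, h2, h3, mul_assoc]

lemma mulOp_eq_self {a : Circle → ℂ} (ha : ∀ᵐ t ∂arc, a t = 1) (f : LpT p) :
    mulOp p a f = f := by
  have h1 : MemLp a ∞ arc := (memLp_const (1 : ℂ)).ae_eq (ha.mono fun _ h => h.symm)
  refine Lp.ext ?_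
  filter_upwards [coeFn_mulOp p h1 f, ha] with t h2 h3
  rw [h2, h3, one_mul]

lemma memLp_comp {r : ℝ≥0∞} [Fact (1 ≤ r)] (β : OuterPoint) {a : Circle → ℂ} (ha : MemLp a r arc) :
    MemLp (fun t => a (shift β t)) r arc :=
  (memLp_comp_shift r β (ha.toLp a)).ae_eq
    ((quasiMeasurePreserving_shift β).ae_eq_comp ha.coeFn_toLp)

lemma coeFn_shiftJ (β : OuterPoint) (f : LpT p) :
    shiftJ p β f =ᵐ[arc] fun t => (chi β t)⁻¹ * f (shift β t) := by
  have h : (fun t : Circle => (t : ℂ)⁻¹ * alphaMinus β t) = fun t => (chi β t)⁻¹ :=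
    funext (inv_mul_alphaMinus β)
  rw [shiftJ, h]
  filter_upwards [coeFn_mulOp p (memLp_inv_chi β ∞) (compShift p β f), coeFn_compShift p β f]
    with t h1 h2
  rw [ContinuousLinearMap.comp_apply, h1, h2]

lemma shiftJ_shiftJ (β : OuterPoint) (f : LpT p) : shiftJ p β (shiftJ p β f) = f := by
  refine Lp.ext ?_
  filter_upwards [coeFn_shiftJ β (shiftJ p β f),
    (quasiMeasurePreserving_shift β).ae (coeFn_shiftJ β f)] with t h1 h2
  rw [h1, h2, shift_shift, chi_shift, inv_inv, inv_mul_cancel_left₀ (chi_ne_zero β t)]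

lemma shiftJ_mulOp (β : OuterPoint) {a : Circle → ℂ} (ha : MemLp a ∞ arc) (f : LpT p) :
    shiftJ p β (mulOp p a f) = mulOp p (fun t => a (shift β t)) (shiftJ p β f) := by
  refine Lp.ext ?_
  filter_upwards [coeFn_shiftJ β (mulOp p a f), coeFn_shiftJ β f,
    coeFn_mulOp p (memLp_comp β ha) (shiftJ p β f),
    (quasiMeasurePreserving_shift β).ae (coeFn_mulOp p ha f)] with t h1 h2 h3 h4
  rw [h1, h3, h2, h4]
  ring

variable [HasRieszProjection p]

lemma mulOp_mem_Hardy (hp : p ≠ ∞) {g : Circle → ℂ} (hg : MemHardy g ∞) {f : LpT p}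
    (hf : f ∈ Hardy p) : mulOp p g f ∈ Hardy p := fun n hn => by
  obtain ⟨q, _, _⟩ := exists_holderConjugate p
  rw [fcoeff_congr (coeFn_mulOp p hg.1 f)]
  simp only [mul_comm (g _)]
  rw [fcoeff_mul_Hardy hp (hg.of_top q) hf hn.le, if_neg hn.ne]

lemma mulOp_mem_Minus (hp : p ≠ ∞) {g : Circle → ℂ} (hg : MemCoHardy g ∞) {f : LpT p}
    (hf : f ∈ Minus p) : mulOp p g f ∈ Minus p := mem_Minus_iff.mpr fun n hn => by
  obtain ⟨q, _, _⟩ := exists_holderConjugate p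
  rw [fcoeff_congr (coeFn_mulOp p hg.1 f)]
  simp only [mul_comm (g _)]
  rw [fcoeff_mul_Minus hp (hg.of_top q) hf (by omega), if_neg (by omega)]

omit [HasRieszProjection p] in
lemma coeFn_shiftJ_monomialLp (β : OuterPoint) (k : ℤ) :
    shiftJ p β (monomialLp p k) =ᵐ[arc] fun t => (chi β t)⁻¹ * (shift β t : ℂ) ^ k := by
  filter_upwards [coeFn_shiftJ β (monomialLp p k),
    (quasiMeasurePreserving_shift β).ae (coeFn_monomialLp p k)] with t h1 h2
  rw [h1, h2]

/-- J t^k = t⁻¹ α₋ α^k with α₋ and α coanalytic, and the factor t⁻¹ removes the index 0. -/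
lemma shiftJ_mem_Minus (hp : p ≠ ∞) (β : OuterPoint) {f : LpT p} (hf : f ∈ Hardy p) :
    shiftJ p β f ∈ Minus p := by
  refine Hardy_le_of_monomialLp_mem hp ((Minus p).comap (shiftJ p β).toLinearMap)
    ((rieszP p).isClosed_ker.preimage (shiftJ p β).continuous) (fun k hk => ?_) hf
  obtain ⟨k, rfl⟩ := Int.eq_ofNat_of_zero_le hk
  refine mem_Minus_iff.mpr fun n hn => ?_
  have h : shiftJ p β (monomialLp p k) =ᵐ[arc]
      fun t => (t : ℂ) ^ (-1 : ℤ) * (alphaMinus β t * (shift β t : ℂ) ^ k) := by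
    filter_upwards [coeFn_shiftJ_monomialLp (p := p) β k] with t ht
    rw [ht, ← inv_mul_alphaMinus, zpow_natCast, zpow_neg, zpow_one, mul_assoc]
  change fcoeff (shiftJ p β (monomialLp p k)) n = 0
  rw [fcoeff_congr h, fcoeff_zpow_mul]
  exact ((memCoHardy_alphaMinus β).mul_top p hp
    ((memCoHardy_shift β p hp).pow_top p hp k).1).1.2 _ (by omega)

variable (p) in
lemma memHardy_shiftJ_neg (hp : p ≠ ∞) (β : OuterPoint) (k : ℕ) :
    MemHardy (fun t => lam β / ((t : ℂ) - β) * (shift β t : ℂ)⁻¹ ^ k) ∞ :=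
  (memHardy_inv_sub β).mul_top p hp ((memHardy_inv_shift β p hp).pow_top p hp k)

omit [HasRieszProjection p] in
lemma coeFn_shiftJ_monomialLp_neg (β : OuterPoint) (k : ℕ) :
    shiftJ p β (monomialLp p (-(k + 1))) =ᵐ[arc]
      fun t => lam β / ((t : ℂ) - β) * (shift β t : ℂ)⁻¹ ^ k := by
  filter_upwards [coeFn_shiftJ_monomialLp (p := p) β (-(k + 1))] with t ht
  rw [ht, ← inv_chi_mul_inv_shift, mul_assoc, ← pow_succ', ← zpow_natCast, inv_zpow', Nat.cast_succ]

lemma shiftJ_mem_Hardy (hp : p ≠ ∞) (β : OuterPoint) {f : LpT p} (hf : f ∈ Minus p) :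
    shiftJ p β f ∈ Hardy p := by
  refine Minus_le_of_monomialLp_mem hp ((Hardy p).comap (shiftJ p β).toLinearMap)
    (isClosed_Hardy.preimage (shiftJ p β).continuous) (fun k hk => ?_) hf
  obtain ⟨j, hj⟩ := Int.eq_ofNat_of_zero_le (show 0 ≤ -k - 1 by omega)
  obtain rfl : k = -(j + 1) := by omega
  intro n hn
  change fcoeff (shiftJ p β (monomialLp p _)) n = 0
  rw [fcoeff_congr (coeFn_shiftJ_monomialLp_neg (p := p) β j)]
  exact (memHardy_shiftJ_neg p hp β j).2 n hn

/-- The value of `J x` at `1 / conj β`, the pole of the shift, is determined by the leading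
coefficient of `x`. -/
lemma diskExt_shiftJ (hp : p ≠ ∞) (β : OuterPoint) {x : LpT p} (hx : x ∈ Minus p) :
    diskExt (shiftJ p β x) (conj (β : ℂ))⁻¹ = conj (β : ℂ) / lam β * fcoeff x (-1) := by
  obtain ⟨q, _, _⟩ := exists_holderConjugate p
  set z := (conj (β : ℂ))⁻¹ with hz_def
  have hz : ‖z‖ < 1 := norm_inv_conj_lt_one β
  let E : LpT p →L[ℂ] ℂ := pairing p (memLp_zpow_mul (memLp_geom hz (-1) q) (-0))
  have hE : ∀ f : LpT p, E f = fcoeff (fun t => geom z (-1) t * f t) 0 := fun f => by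
    rw [← fcoeff_mul_eq_pairing 0]
    simp only [mul_comm]
  -- Here `geom z (-1)` is t / (t - z), so the product is t v, which has no coefficient of index 0:
  -- evaluation at z kills multiples of t - z.
  have hvan : ∀ v : Circle → ℂ, MemHardy v ∞ →
      fcoeff (fun t => geom z (-1) t * (((t : ℂ) - z) * v t)) 0 = 0 := fun v hv => by
    rw [← hv.2 (0 - 1) (by norm_num), ← fcoeff_zpow_mul]
    congr 1
    funext t
    have h1 := geom_den_ne_zero hz (-1) t
    have h2 := Circle.coe_ne_zero t
    simp only [geom, zpow_one, zpow_neg] at h1 ⊢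
    field_simp at h1 ⊢
    have h3 : (t : ℂ) - z ≠ 0 := fun h0 => h1 (by rw [h0, zero_div])
    field_simp
  let Λ : LpT p →L[ℂ] ℂ := E ∘L shiftJ p β - (conj (β : ℂ) / lam β) • fcoeffL p (-1)
  have hΛ : ∀ f, Λ f = fcoeff (fun t => geom z (-1) t * shiftJ p β f t) 0
      - conj (β : ℂ) / lam β * fcoeff f (-1) := fun f => by
    rw [← hE]
    rfl
  have hmem : x ∈ Λ.ker := by
    refine Minus_le_of_monomialLp_mem hp Λ.ker Λ.isClosed_ker (fun k hk => ?_) hx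
    obtain ⟨j, hj⟩ := Int.eq_ofNat_of_zero_le (show 0 ≤ -k - 1 by omega)
    obtain rfl : k = -(j + 1) := by omega
    change Λ _ = 0
    have hc : (fun t => geom z (-1) t * shiftJ p β (monomialLp p (-(j + 1))) t) =ᵐ[arc]
        fun t => geom z (-1) t * (lam β / ((t : ℂ) - β) * (shift β t : ℂ)⁻¹ ^ j) := by
      filter_upwards [coeFn_shiftJ_monomialLp_neg (p := p) β j] with t ht
      rw [ht]
    rw [hΛ, fcoeff_congr hc, fcoeff_monomialLp]
    have hβ := conj_coe_ne_zero β
    cases j with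
    | zero =>
      set h : Circle → ℂ := fun t => lam β / ((t : ℂ) - β) with h_def
      have hh : MemHardy h ∞ := memHardy_inv_sub β
      have h0 := hvan h hh
      -- Evaluating (t - z) h = λ + (β - z) h at z gives h(z) = λ / (z - β), which equals conj β / λ
      -- by `lam_sq`.
      have h1 : fcoeff (fun t => geom z (-1) t * (((t : ℂ) - z) * h t)) 0 =
          fcoeff (fun t => lam β * geom z (-1) t) 0 +
          fcoeff (fun t => (β - z) * (geom z (-1) t * h t)) 0 := by
        have hg : Integrable (fun t => geom z (-1) t * h t) arc :=
          (hh.1.mul (memLp_geom hz (-1) ∞) : MemLp _ ∞ arc).integrable le_top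
        rw [← fcoeff_add (((memLp_geom hz (-1) 1).integrable le_rfl).const_mul _)
          (hg.const_mul _)]
        congr 1
        funext t
        have := sub_coe_ne_zero β t
        simp only [h_def]
        field_simp
        ring
      rw [h0, fcoeff_const_mul, fcoeff_const_mul, fcoeff_geom_neg_one_zero hz] at h1
      have hl := lam_ne_zero β
      have hl2 := lam_sq β
      have hne : (1 : ℂ) - β * conj (β : ℂ) ≠ 0 := hl2 ▸ pow_ne_zero 2 hl
      simp only [CharP.cast_eq_zero, zero_add, pow_zero, mul_one, if_true]
      set A := fcoeff (fun t => geom z (-1) t * h t) 0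
      rw [hz_def] at h1
      field_simp at h1 ⊢
      refine mul_left_cancel₀ hl ?_
      linear_combination h1 + A * hl2
    | succ j =>
      rw [if_neg (by push_cast; omega), mul_zero, sub_zero]
      -- α⁻¹ vanishes at z = 1/conj β, so monomials of index at most -2 contribute nothing.
      have h1 : ∀ t : Circle, lam β / ((t : ℂ) - β) * (shift β t : ℂ)⁻¹ ^ (j + 1) =
          ((t : ℂ) - z) * ((conj (β : ℂ) / lam β) * (lam β / ((t : ℂ) - β) *
            (lam β / ((t : ℂ) - β) * (shift β t : ℂ)⁻¹ ^ j))) := fun t => by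
        have h2 := sub_coe_ne_zero β t
        have hl := lam_ne_zero β
        rw [pow_succ, coe_shift, hz_def, inv_div]
        field_simp
      simp only [h1]
      exact hvan _ (((memHardy_inv_sub β).mul_top p hp
        (memHardy_shiftJ_neg p hp β j)).const_mul _)
  have h1 : Λ x = 0 := hmem
  rw [hΛ] at h1
  rw [diskExt_eq_fcoeff hz (integrable_coeFn _)]
  linear_combination h1

end Operators

/-! ### Toeplitz operators -/

section Toeplitz

variable {p : ℝ≥0∞} [Fact (1 ≤ p)]

lemma coe_toeplitz (a : Circle → ℂ) (f : Hardy p) :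
    (toeplitz p a f : LpT p) = rieszP p (mulOp p a f) := rfl

lemma mulOp_mulOp_eq {a b c : Circle → ℂ} (ha : MemLp a ∞ arc) (hb : MemLp b ∞ arc)
    (h : ∀ᵐ t ∂arc, a t * b t = c t) (f : LpT p) :
    mulOp p a (mulOp p b f) = mulOp p c f := by
  have hab : MemLp (fun t => a t * b t) ∞ arc := hb.mul ha
  rw [mulOp_mulOp ha hb, mulOp_congr hab h]

variable [HasRieszProjection p]

lemma toeplitz_mul_plus (hp : p ≠ ∞) {a g : Circle → ℂ} (ha : MemLp a ∞ arc)
    (hg : MemHardy g ∞) : toeplitz p a * toeplitz p g = toeplitz p fun t => a t * g t := by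
  refine ContinuousLinearMap.ext fun f => Subtype.ext ?_
  rw [mul_apply_eq_comp, coe_toeplitz, coe_toeplitz, coe_toeplitz,
    rieszP_eq_self (mulOp_mem_Hardy hp hg f.2), mulOp_mulOp ha hg.1]

/-- The part Q a f dropped by the inner projection stays in `Minus` after multiplication by g, so
the outer projection kills it anyway. -/
lemma toeplitz_minus_mul (hp : p ≠ ∞) {a g : Circle → ℂ} (ha : MemLp a ∞ arc)
    (hg : MemCoHardy g ∞) : toeplitz p g * toeplitz p a = toeplitz p fun t => g t * a t := by
  refine ContinuousLinearMap.ext fun f => Subtype.ext ?_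
  rw [mul_apply_eq_comp, coe_toeplitz, coe_toeplitz, coe_toeplitz,
    ← mulOp_mulOp hg.1 ha]
  conv_rhs => rw [← rieszP_add_rieszQ (mulOp p a f), map_add, map_add,
    rieszP_eq_zero (mulOp_mem_Minus hp hg (rieszQ_mem _)), add_zero]

lemma toeplitz_eq_one {a : Circle → ℂ} (ha : ∀ᵐ t ∂arc, a t = 1) : toeplitz p a = 1 := by
  refine ContinuousLinearMap.ext fun f => Subtype.ext ?_
  rw [coe_toeplitz, mulOp_eq_self ha, rieszP_eq_self f.2]
  rfl

omit [HasRieszProjection p] in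
lemma mem_ker_toeplitz {a : Circle → ℂ} {f : Hardy p} :
    f ∈ (toeplitz p a).ker ↔ mulOp p a f ∈ Minus p := by
  rw [LinearMap.mem_ker, ← Subtype.coe_inj]
  rfl

end Toeplitz

/-! ### The kernel of a Toeplitz plus Hankel operator with a matching pair of symbols -/

lemma MemGLinfty.comp_shift {a : Circle → ℂ} (ha : MemGLinfty a) (β : OuterPoint) :
    MemGLinfty fun t => a (shift β t) :=
  ⟨memLp_comp β ha.1, (quasiMeasurePreserving_shift β).ae ha.2.1, memLp_comp β ha.2.2⟩

lemma MemGLinfty.div {a b : Circle → ℂ} (ha : MemGLinfty a) (hb : MemGLinfty b) :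
    MemGLinfty fun t => a t / b t := by
  refine ⟨?_, ?_, ?_⟩
  · simp only [div_eq_mul_inv]
    exact hb.2.2.mul ha.1
  · filter_upwards [ha.2.1, hb.2.1] with t h1 h2 using div_ne_zero h1 h2
  · refine (ha.2.2.mul hb.1 : MemLp (b * a⁻¹) ∞ arc).ae_eq (Eventually.of_forall fun t => ?_)
    simp [div_eq_mul_inv]

/-- Invertible elements `a`, `b` of `L^∞` with `a a_α = b b_α`. -/
structure IsMatchingPair (β : OuterPoint) (a b : Circle → ℂ) : Prop where
  left : MemGLinfty a
  right : MemGLinfty b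
  eq : ∀ᵐ t ∂arc, a t * a (shift β t) = b t * b (shift β t)

/-- The matching condition gives b⁻¹ = b_α / (a a_α), which is bounded. -/
lemma IsMatchingPair.of_left {β : OuterPoint} {a b : Circle → ℂ} (ha : MemGLinfty a)
    (hb : MemLp b ∞ arc) (h : ∀ᵐ t ∂arc, a t * a (shift β t) = b t * b (shift β t)) :
    IsMatchingPair β a b := by
  have ha' := ha.comp_shift β
  have hne : ∀ᵐ t ∂arc, b t ≠ 0 := by
    filter_upwards [h, ha.2.1, ha'.2.1] with t h1 h2 h3 h4
    rw [h4, zero_mul] at h1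
    exact mul_ne_zero h2 h3 h1
  refine ⟨ha, ⟨hb, hne, ?_⟩, h⟩
  have h1 : MemLp (fun t => (a t)⁻¹ * (a (shift β t))⁻¹) ∞ arc := ha'.2.2.mul ha.2.2
  have h2 : MemLp (fun t => b (shift β t) * ((a t)⁻¹ * (a (shift β t))⁻¹)) ∞ arc :=
    h1.mul (memLp_comp β hb)
  refine h2.ae_eq ?_
  filter_upwards [h, ha.2.1, ha'.2.1, hne] with t h3 h4 h5 h6
  rw [Pi.inv_apply]
  field_simp
  rw [h3, mul_comm]

section Kernel

variable {p : ℝ≥0∞} [Fact (1 ≤ p)] [HasRieszProjection p] {β : OuterPoint} {a b : Circle → ℂ}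
  {ε : ℂ}

/-- Since d d_α = 1, J d is an involution on ker T(d), and (1/2)(I + ε J d) projects onto its
eigenspace for ε. The equation J d s = ε s is d s = ε J s, and it already puts s in ker T(d) because
J s is in `Minus`. -/
lemma mem_imProj_iff (hp : p ≠ ∞) (hε : ε * ε = 1) {d : Circle → ℂ} (hd : MemLp d ∞ arc)
    (hdd : ∀ᵐ t ∂arc, d t * d (shift β t) = 1) {s : Hardy p} :
    s ∈ imProj p β ε d ↔ mulOp p d s = ε • shiftJ p β s := by
  have hval : ∀ x : Hardy p, mulOp p d x ∈ Minus p →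
      ((1 / 2 : ℂ) • (ContinuousLinearMap.id ℂ (LpT p) + ε • shiftQP p β d)) x =
        (1 / 2 : ℂ) • ((x : LpT p) + ε • shiftJ p β (mulOp p d x)) := fun x hx => by
    change (1 / 2 : ℂ) • ((x : LpT p) + ε • shiftJ p β (rieszQ p (mulOp p d (rieszP p x)))) = _
    rw [rieszP_eq_self x.2, rieszQ_eq_self hx]
  constructor
  · rintro ⟨x, hx, hxs⟩
    have hx' : mulOp p d x ∈ Minus p := mem_ker_toeplitz.mp hx
    change ((1 / 2 : ℂ) • (ContinuousLinearMap.id ℂ (LpT p) + ε • shiftQP p β d)) x = s at hxs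
    rw [hval x hx'] at hxs
    rw [← hxs]
    simp only [map_smul, map_add, shiftJ_shiftJ]
    rw [shiftJ_mulOp β hd, mulOp_mulOp hd (memLp_comp β hd), mulOp_eq_self hdd]
    linear_combination (norm := module) (-(1 / 2 : ℂ)) • hε • (mulOp p d (x : LpT p))
  · intro h
    have hm : mulOp p d s ∈ Minus p := by
      rw [h]
      exact (Minus p).smul_mem _ (shiftJ_mem_Minus hp β s.2)
    refine ⟨s, mem_ker_toeplitz.mpr hm, ?_⟩
    change ((1 / 2 : ℂ) • (ContinuousLinearMap.id ℂ (LpT p) + ε • shiftQP p β d)) s = s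
    rw [hval s hm, h, map_smul, shiftJ_shiftJ, smul_smul, hε, one_smul, ← two_smul ℂ, smul_smul]
    norm_num

lemma mem_ker_toeplitz_add_hankel_iff (hp : p ≠ ∞) {f : Hardy p} :
    f ∈ (toeplitz p a + ε • hankel p β b).ker ↔
      mulOp p a f + ε • mulOp p b (shiftJ p β f) ∈ Minus p := by
  rw [LinearMap.mem_ker, ← Subtype.coe_inj]
  change rieszP p (mulOp p a f) + ε • rieszP p (mulOp p b (rieszQ p (shiftJ p β f))) = 0 ↔
    rieszP p _ = 0
  rw [rieszQ_eq_self (shiftJ_mem_Minus hp β f.2), map_add, map_smul]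

/-- The relation between an element `f` of the kernel of `T(a) ± H_α(b)` and the corresponding
element `s` of the kernel of `T(d)`. -/
lemma mem_ker_iff_exists (hp : p ≠ ∞) (hε : ε * ε = 1) (hab : IsMatchingPair β a b) {f : Hardy p} :
    f ∈ (toeplitz p a + ε • hankel p β b).ker ↔
      ∃ s ∈ imProj p β ε (fun t => b t / a (shift β t)),
        mulOp p (a / b) f + ε • shiftJ p β f =
          mulOp p (fun t => (a (shift β t))⁻¹) (s : LpT p) := by
  have ha := hab.left
  have hb := hab.right
  have ha' := ha.comp_shift β
  have hb' := hb.comp_shift β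
  have hu : MemLp (fun t => (a (shift β t))⁻¹) ∞ arc := ha'.2.2
  have hc : MemLp (a / b) ∞ arc := (ha.div hb).1
  have hd := (hb.div ha').1
  have hdd : ∀ᵐ t ∂arc, b t / a (shift β t) * (b (shift β t) / a (shift β (shift β t))) = 1 := by
    filter_upwards [hab.eq, ha.2.1, ha'.2.1] with t h1 h2 h3
    rw [shift_shift]
    field_simp
    rw [mul_comm (a _), h1]
  have hbc : ∀ x : LpT p, mulOp p b (mulOp p (a / b) x) = mulOp p a x :=
    mulOp_mulOp_eq hb.1 hc (by
      filter_upwards [hb.2.1] with t h1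
      rw [Pi.div_apply, mul_div_cancel₀ _ h1])
  have hbu : ∀ x : LpT p, mulOp p b (mulOp p (fun t => (a (shift β t))⁻¹) x) =
      mulOp p (fun t => b t / a (shift β t)) x :=
    mulOp_mulOp_eq hb.1 hu (Eventually.of_forall fun t => (div_eq_mul_inv _ _).symm)
  rw [mem_ker_toeplitz_add_hankel_iff hp]
  constructor
  · intro hη
    set η := mulOp p a f + ε • mulOp p b (shiftJ p β f) with hη_def
    -- The witness is s = ε J η. J turns a f + ε b J f into a_α J f + ε b_α f, and b_α / a_α = a / b
    -- by matching.
    have hus : mulOp p (fun t => (a (shift β t))⁻¹) (ε • shiftJ p β η) =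
        mulOp p (a / b) f + ε • shiftJ p β f := by
      have h1 : mulOp p (fun t => (a (shift β t))⁻¹)
          (mulOp p (fun t => a (shift β t)) (shiftJ p β f)) = shiftJ p β f := by
        rw [mulOp_mulOp hu ha'.1, mulOp_eq_self]
        filter_upwards [ha'.2.1] with t h2 using inv_mul_cancel₀ h2
      have h2 : mulOp p (fun t => (a (shift β t))⁻¹)
          (mulOp p (fun t => b (shift β t)) (f : LpT p)) = mulOp p (a / b) f := by
        refine mulOp_mulOp_eq hu hb'.1 ?_ _
        filter_upwards [hab.eq, ha'.2.1, hb.2.1] with t h3 h4 h5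
        rw [Pi.div_apply]
        field_simp
        rw [mul_comm, ← h3, mul_comm]
      rw [map_smul, hη_def, map_add, map_smul, shiftJ_mulOp β ha.1, shiftJ_mulOp β hb.1,
        shiftJ_shiftJ, map_add, map_smul, h1, h2]
      linear_combination (norm := module) hε • (mulOp p (a / b) (f : LpT p))
    refine ⟨ε • ⟨shiftJ p β η, shiftJ_mem_Hardy hp β hη⟩, ?_, hus.symm⟩
    rw [mem_imProj_iff hp hε hd hdd]
    change mulOp p _ (ε • shiftJ p β η) = ε • shiftJ p β (ε • shiftJ p β η)
    rw [← hbu, hus, map_add, map_smul, hbc, ← hη_def, map_smul, shiftJ_shiftJ, smul_smul, hε,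
      one_smul]
  · rintro ⟨s, hs, h⟩
    rw [mem_imProj_iff hp hε hd hdd] at hs
    have h1 := congrArg (mulOp p b) h
    rw [map_add, map_smul, hbc, hbu, hs] at h1
    rw [h1]
    exact (Minus p).smul_mem _ (shiftJ_mem_Minus hp β s.2)

/-- Let f = R T(a_α⁻¹) s, u = a_α⁻¹ and r = c f - u s, with c = a/b. T(c) R = I puts r in `Minus`,
and φ(s) = (1/2)(f - ε J r). From c c_α = 1 and d s = ε J s follows c J r = J f - ε u s, so c φ(s) +
ε J φ(s) = (1/2)(c f + u s - r) = u s. -/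
lemma phi_spec (hp : p ≠ ∞) (hε : ε * ε = 1) (hab : IsMatchingPair β a b)
    {R : Hardy p →L[ℂ] Hardy p} (hR : toeplitz p (a / b) * R = 1) {s : Hardy p}
    (hs : s ∈ imProj p β ε (fun t => b t / a (shift β t))) :
    phi p β ε a b R s ∈ Hardy p ∧
      mulOp p (a / b) (phi p β ε a b R s) + ε • shiftJ p β (phi p β ε a b R s) =
        mulOp p (fun t => (a (shift β t))⁻¹) (s : LpT p) := by
  have ha := hab.left
  have hb := hab.right
  have ha' := ha.comp_shift β
  have hb' := hb.comp_shift β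
  have hu : MemLp (fun t => (a (shift β t))⁻¹) ∞ arc := ha'.2.2
  have hc : MemLp (a / b) ∞ arc := (ha.div hb).1
  have hd := (hb.div ha').1
  have hdd : ∀ᵐ t ∂arc, b t / a (shift β t) * (b (shift β t) / a (shift β (shift β t))) = 1 := by
    filter_upwards [hab.eq, ha.2.1, ha'.2.1] with t h1 h2 h3
    rw [shift_shift]
    field_simp
    rw [mul_comm (a _), h1]
  rw [mem_imProj_iff hp hε hd hdd] at hs
  set f : Hardy p := R (toeplitz p (fun t => (a (shift β t))⁻¹) s) with hf
  set us := mulOp p (fun t => (a (shift β t))⁻¹) (s : LpT p) with hus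
  set r := mulOp p (a / b) (f : LpT p) - us with hr
  have hrm : r ∈ Minus p := by
    have h1 : toeplitz p (a / b) f = toeplitz p (fun t => (a (shift β t))⁻¹) s := by
      rw [hf, ← mul_apply_eq_comp, hR]
      rfl
    have h2 := congrArg Subtype.val h1
    change rieszP p _ = 0
    rw [hr, map_sub, sub_eq_zero]
    exact h2
  have hphi : phi p β ε a b R s = (1 / 2 : ℂ) • ((f : LpT p) - ε • shiftJ p β r) := by
    change (1 / 2 : ℂ) • ((f : LpT p) -
      ε • shiftJ p β (rieszQ p (mulOp p (a / b) (rieszP p (f : LpT p)))) +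
      ε • shiftJ p β (rieszQ p us)) = _
    rw [rieszP_eq_self f.2, ← rieszQ_eq_self hrm, hr, map_sub, map_sub]
    module
  clear_value r
  rw [hphi]
  refine ⟨(Hardy p).smul_mem _ ((Hardy p).sub_mem f.2
    ((Hardy p).smul_mem _ (shiftJ_mem_Hardy hp β hrm))), ?_⟩
  have hJs : shiftJ p β (s : LpT p) = ε • mulOp p (fun t => b t / a (shift β t)) (s : LpT p) := by
    rw [hs, smul_smul, hε, one_smul]
  -- J s = ε d s, and c a⁻¹ d = a_α⁻¹.
  have hcu : mulOp p (a / b) (mulOp p (fun t => (a t)⁻¹) (shiftJ p β (s : LpT p))) = ε • us := by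
    have hi : MemLp (fun t => (a t)⁻¹ * (b t / a (shift β t))) ∞ arc := hd.mul ha.2.2
    have hi' : MemLp (fun t => (a t)⁻¹) ∞ arc := ha.2.2
    rw [hJs, map_smul, map_smul, mulOp_mulOp hi' hd]
    congr 1
    refine mulOp_mulOp_eq hc hi ?_ _
    filter_upwards [ha.2.1, hb.2.1] with t h1 h2
    rw [Pi.div_apply]
    field_simp
  have hcc : mulOp p (a / b) (mulOp p (fun t => (a / b) (shift β t)) (shiftJ p β (f : LpT p))) =
      shiftJ p β f := by
    rw [mulOp_mulOp hc (memLp_comp β hc), mulOp_eq_self]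
    filter_upwards [hab.eq, hb.2.1, hb'.2.1] with t h1 h2 h3
    rw [Pi.div_apply, Pi.div_apply]
    field_simp
    exact h1
  have hJr : mulOp p (a / b) (shiftJ p β r) = shiftJ p β f - ε • us := by
    rw [hr, map_sub, shiftJ_mulOp β hc, hus, shiftJ_mulOp β hu, ← hus, map_sub, hcc]
    simp only [shift_shift]
    rw [hcu]
  rw [map_smul, map_smul, map_sub, map_sub (shiftJ p β), map_smul, map_smul, hJr, shiftJ_shiftJ, hr]
  linear_combination (norm := module)
    hε • us - (1 / 2 : ℂ) • hε • (mulOp p (a / b) (f : LpT p))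

omit [HasRieszProjection p] in
lemma mulOp_inv_injective {g : Circle → ℂ} (hg : MemGLinfty g) {f : LpT p}
    (h : mulOp p (fun t => (g t)⁻¹) f = 0) : f = 0 := by
  have h1 := congrArg (mulOp p g) h
  have hi : MemLp (fun t => (g t)⁻¹) ∞ arc := hg.2.2
  rwa [map_zero, mulOp_mulOp hg.1 hi, mulOp_eq_self] at h1
  filter_upwards [hg.2.1] with t h2 using mul_inv_cancel₀ h2

/-- Elements of the kernel of `T(a) ± H_α(b)` are the sums of values of `φ` and of solutions
of the homogeneous equation `c f = ∓ J f`. -/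
lemma mem_ker_iff_exists_add (hp : p ≠ ∞) (hε : ε * ε = 1) (hab : IsMatchingPair β a b)
    {R : Hardy p →L[ℂ] Hardy p} (hR : toeplitz p (a / b) * R = 1) {f : Hardy p} :
    f ∈ (toeplitz p a + ε • hankel p β b).ker ↔
      ∃ g ∈ Hardy p, mulOp p (a / b) g + ε • shiftJ p β g = 0 ∧
        ∃ y ∈ (imProj p β ε (fun t => b t / a (shift β t))).map (phi p β ε a b R).toLinearMap,
          g + y = f := by
  rw [mem_ker_iff_exists hp hε hab]
  constructor
  · rintro ⟨s, hs, h⟩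
    obtain ⟨h1, h2⟩ := phi_spec hp hε hab hR hs
    refine ⟨f - phi p β ε a b R s, (Hardy p).sub_mem f.2 h1, ?_, phi p β ε a b R s, ⟨s, hs, rfl⟩,
      sub_add_cancel _ _⟩
    rw [map_sub, map_sub, smul_sub, sub_add_sub_comm, h, h2, sub_self]
  · rintro ⟨g, hg, h, _, ⟨s, hs, rfl⟩, hf⟩
    refine ⟨s, hs, ?_⟩
    rw [← hf, ← (phi_spec hp hε hab hR hs).2, map_add, map_add, smul_add, add_add_add_comm, h,
      zero_add]
    rfl

lemma eq_zero_of_mem_map_phi (hp : p ≠ ∞) (hε : ε * ε = 1) (hab : IsMatchingPair β a b)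
    {R : Hardy p →L[ℂ] Hardy p} (hR : toeplitz p (a / b) * R = 1) {g : LpT p}
    (h : mulOp p (a / b) g + ε • shiftJ p β g = 0)
    (hg : g ∈ (imProj p β ε (fun t => b t / a (shift β t))).map (phi p β ε a b R).toLinearMap) :
    g = 0 := by
  obtain ⟨s, hs, rfl⟩ := hg
  have h1 : mulOp p (fun t => (a (shift β t))⁻¹) (s : LpT p) = 0 :=
    (phi_spec hp hε hab hR hs).2.symm.trans h
  have h2 : s = 0 := Subtype.ext (mulOp_inv_injective (hab.left.comp_shift β) h1)
  rw [h2, map_zero]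

end Kernel

/-! ### Representation of bounded functionals on `L^p` -/

section Dual

variable {p : ℝ≥0∞} [Fact (1 ≤ p)]

/-- The indicator function of a measurable set as an element of `L^p`. -/
def indLp (p : ℝ≥0∞) {s : Set Circle} (hs : MeasurableSet s) : LpT p :=
  indicatorConstLp p hs (measure_ne_top arc s) 1

/-- Countable additivity in norm: the symmetric difference of the union and a finite partial union
lies in a tail of small measure. Finiteness of p turns small measure into small norm. -/
lemma hasSum_indLp (hp : p ≠ ∞) {s : ℕ → Set Circle} (hs : ∀ i, MeasurableSet (s i))
    (hd : Pairwise (Function.onFun Disjoint s)) :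
    HasSum (fun i => indLp p (hs i)) (indLp p (MeasurableSet.iUnion hs)) := by
  have hpart : ∀ S : Finset ℕ, ∑ i ∈ S, indLp p (hs i) =
      indLp p (S.measurableSet_biUnion fun i _ => hs i) := fun S => by
    induction S using Finset.induction_on with
    | empty => simp [indLp]
    | insert i S hi ih =>
      rw [Finset.sum_insert hi, ih, indLp, indLp, ← indicatorConstLp_disjoint_union]
      · simp only [indLp, Finset.set_biUnion_insert]
      · exact Set.disjoint_iUnion₂_right.mpr fun j hj => hd fun h => hi (h ▸ hj)
  rw [HasSum]
  simp only [hpart]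
  refine tendsto_indicatorConstLp_set hp ?_
  have hfin : ∑' i, arc (s i) ≠ ∞ := by
    rw [← measure_iUnion hd hs]
    exact measure_ne_top _ _
  refine tendsto_of_tendsto_of_tendsto_of_le_of_le tendsto_const_nhds
    (ENNReal.tendsto_tsum_compl_atTop_zero hfin) (fun _ => zero_le) fun S => ?_
  refine le_trans (measure_mono ?_) (measure_iUnion_le fun i : {i // i ∉ S} => s i)
  rintro t (⟨h1, h2⟩ | ⟨h1, h2⟩)
  · obtain ⟨i, -, hi⟩ := Set.mem_iUnion₂.mp h1
    exact absurd (Set.mem_iUnion.mpr ⟨i, hi⟩) h2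
  · obtain ⟨i, hi⟩ := Set.mem_iUnion.mp h1
    exact Set.mem_iUnion.mpr ⟨⟨i, fun hS => h2 (Set.mem_iUnion₂.mpr ⟨i, hS, hi⟩)⟩, hi⟩

omit [Fact (1 ≤ p)] in
lemma coeFn_indLp {s : Set Circle} (hs : MeasurableSet s) :
    indLp p hs =ᵐ[arc] s.indicator fun _ => 1 := indicatorConstLp_coeFn

open Classical in
-- The set function s ↦ G(1_s) is a signed measure that vanishes on null sets, so w is its
-- Radon-Nikodym derivative.
lemma exists_density_real (hp : p ≠ ∞) (G : LpT p →L[ℝ] ℝ) :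
    ∃ w : Circle → ℝ, Measurable w ∧ Integrable w arc ∧
      ∀ s (hs : MeasurableSet s), G (indLp p hs) = ∫ t in s, w t ∂arc := by
  let m : SignedMeasure Circle :=
    { measureOf' := fun s => if hs : MeasurableSet s then G (indLp p hs) else 0
      empty' := by simp [indLp]
      not_measurable' := fun s hs => dif_neg hs
      m_iUnion' := fun s hs hd => by
        simp only [hs, MeasurableSet.iUnion hs, dif_pos]
        exact (hasSum_indLp hp hs hd).mapL G }
  have hm : ∀ s (hs : MeasurableSet s), m s = G (indLp p hs) := fun s hs => dif_pos hs
  have hac : m ≪ᵥ arc.toENNRealVectorMeasure := by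
    intro s h
    by_cases hs : MeasurableSet s
    · rw [Measure.toENNRealVectorMeasure_apply_measurable hs] at h
      have h0 : indLp p hs = 0 := by
        refine Lp.ext ?_
        refine (coeFn_indLp hs).trans ((indicator_meas_zero h).trans ?_)
        exact (Lp.coeFn_zero ℂ p arc).symm
      rw [hm s hs, h0, map_zero]
    · exact m.not_measurable hs
  have h := SignedMeasure.withDensityᵥ_rnDeriv_eq m arc hac
  refine ⟨m.rnDeriv arc, SignedMeasure.measurable_rnDeriv _ _, SignedMeasure.integrable_rnDeriv _ _,
    fun s hs => ?_⟩
  rw [← hm, ← withDensityᵥ_apply (SignedMeasure.integrable_rnDeriv m arc) hs, h]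

lemma exists_density (hp : p ≠ ∞) (F : LpT p →L[ℂ] ℂ) :
    ∃ w : Circle → ℂ, Measurable w ∧ Integrable w arc ∧
      ∀ s (hs : MeasurableSet s), F (indLp p hs) = ∫ t in s, w t ∂arc := by
  obtain ⟨u, hu, hui, hu'⟩ := exists_density_real hp (Complex.reCLM ∘L F.restrictScalars ℝ)
  obtain ⟨v, hv, hvi, hv'⟩ := exists_density_real hp (Complex.imCLM ∘L F.restrictScalars ℝ)
  refine ⟨fun t => (u t : ℂ) + v t * Complex.I, by fun_prop,
    hui.ofReal.add (hvi.ofReal.mul_const _), fun s hs => ?_⟩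
  rw [integral_add hui.ofReal.restrict (hvi.ofReal.mul_const _).restrict, integral_mul_const,
    integral_complex_ofReal, integral_complex_ofReal, ← hu' s hs, ← hv' s hs]
  exact (Complex.re_add_im _).symm

lemma clm_ext_indLp (hp : p ≠ ∞) {F G : LpT p →L[ℂ] ℂ}
    (h : ∀ s (hs : MeasurableSet s), F (indLp p hs) = G (indLp p hs)) : F = G := by
  refine ContinuousLinearMap.ext fun f => ?_
  refine Lp.induction hp (fun f => F f = G f) (fun c s hs hμ => ?_) (fun f g hf hg _ h1 h2 => ?_)
    (isClosed_eq F.continuous G.continuous) f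
  · have h1 : (Lp.simpleFunc.indicatorConst p hs hμ.ne c : LpT p) = c • indLp p hs := by
      rw [Lp.simpleFunc.coe_indicatorConst, indLp, indicatorConstLp, indicatorConstLp,
        ← MemLp.toLp_const_smul]
      refine MemLp.toLp_congr _ _ (Eventually.of_forall fun t => ?_)
      by_cases ht : t ∈ s <;> simp [ht]
    rw [h1, map_smul, map_smul, h]
  · rw [map_add, map_add, h1, h2]

variable {q : ℝ≥0∞} [Fact (1 ≤ q)] [p.HolderConjugate q]

omit [Fact (1 ≤ p)] [Fact (1 ≤ q)] in
/-- The norm in `L^q` of a bounded function is its norm as a functional on `L^p`. -/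
lemma eLpNorm_le_of_pairing_le (hp1 : 1 < p) (hp : p ≠ ∞) {v : Circle → ℂ} (hv : Measurable v)
    {N : ℝ} (hN : ∀ t, ‖v t‖ ≤ N) {C : ℝ} (hC : 0 ≤ C)
    (h : ∀ f : LpT p, ‖∫ t, f t * v t ∂arc‖ ≤ C * ‖f‖) : eLpNorm v q arc ≤ ENNReal.ofReal C := by
  have hq1 : 1 < q := (ENNReal.HolderConjugate.lt_top_iff_one_lt p q).mp hp.lt_top
  have hq : q ≠ ∞ := ((ENNReal.HolderConjugate.lt_top_iff_one_lt q p).mpr hp1).ne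
  have hpq : p.toReal.HolderConjugate q.toReal :=
    ENNReal.HolderConjugate.toReal_of_ne_top hp hq
  have hr : 1 < q.toReal := hpq.symm.lt
  set r := q.toReal with hr_def
  have hN0 : 0 ≤ N := (norm_nonneg _).trans (hN 1)
  -- The extremal function for Hölder's inequality: g v = |v|^r and |g|^p = |v|^r. Testing with it
  -- gives I ≤ C I^(1/p), hence I^(1/q) ≤ C. A negative power at zeros of v is harmless because of
  -- the factor conj v.
  let g : Circle → ℂ := fun t => conj (v t) * ((‖v t‖ ^ (r - 2) : ℝ) : ℂ)
  have hg_norm : ∀ t, ‖g t‖ = ‖v t‖ ^ (r - 1) := fun t => by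
    rw [norm_mul, RCLike.norm_conj, Complex.norm_real, Real.norm_of_nonneg (by positivity)]
    rcases (norm_nonneg (v t)).eq_or_lt with h0 | h0
    · rw [← h0, zero_mul, Real.zero_rpow (by linarith)]
    · rw [← Real.rpow_one_add' h0.le (by linarith)]
      ring_nf
  have hgv : ∀ t, g t * v t = ((‖v t‖ ^ r : ℝ) : ℂ) := fun t => by
    have h1 : g t * v t = ((‖v t‖ ^ 2 * ‖v t‖ ^ (r - 2) : ℝ) : ℂ) := by
      push_cast
      rw [← Complex.conj_mul']
      simp only [g]
      ring
    rw [h1]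
    congr 1
    rcases (norm_nonneg (v t)).eq_or_lt with h0 | h0
    · rw [← h0, zero_pow two_ne_zero, zero_mul, Real.zero_rpow (by linarith)]
    · rw [← Real.rpow_natCast, ← Real.rpow_add h0]
      norm_num
  have hgm : Measurable g := by fun_prop
  have hgp : MemLp g p arc := by
    refine MemLp.of_bound hgm.aestronglyMeasurable (N ^ (r - 1)) (Eventually.of_forall fun t => ?_)
    rw [hg_norm]
    exact Real.rpow_le_rpow (norm_nonneg _) (hN t) (by linarith)
  have hvq : MemLp v q arc := MemLp.of_bound hv.aestronglyMeasurable N (Eventually.of_forall hN)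
  set I : ℝ := ∫ t, ‖v t‖ ^ r ∂arc with hI
  have hI0 : 0 ≤ I := integral_nonneg fun t => by positivity
  have h1 := h (hgp.toLp g)
  have h2 : ∫ t, hgp.toLp g t * v t ∂arc = (I : ℂ) := by
    rw [hI, ← integral_complex_ofReal]
    refine integral_congr_ae ?_
    filter_upwards [hgp.coeFn_toLp] with t ht
    rw [ht, hgv]
  have h3 : ‖hgp.toLp g‖ = I ^ (p.toReal)⁻¹ := by
    rw [Lp.norm_toLp, hgp.eLpNorm_eq_integral_rpow_norm (one_pos.trans hp1).ne' hp,
      ENNReal.toReal_ofReal (by positivity)]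
    congr 1
    refine integral_congr_ae (Eventually.of_forall fun t => ?_)
    change ‖g t‖ ^ p.toReal = ‖v t‖ ^ r
    rw [hg_norm, ← Real.rpow_mul (norm_nonneg _), hpq.symm.sub_one_mul_conj]
  rw [h2, h3, Complex.norm_real, Real.norm_of_nonneg hI0] at h1
  rw [hvq.eLpNorm_eq_integral_rpow_norm (one_pos.trans hq1).ne' hq]
  refine ENNReal.ofReal_le_ofReal ?_
  change I ^ r⁻¹ ≤ C
  rcases hI0.eq_or_lt with h0 | h0
  · rw [← h0, Real.zero_rpow (inv_ne_zero (by linarith))]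
    exact hC
  · have h4 : I = I ^ r⁻¹ * I ^ (p.toReal)⁻¹ := by
      rw [← Real.rpow_add h0, add_comm, hpq.inv_add_inv_eq_one, Real.rpow_one]
    have h5 : 0 < I ^ (p.toReal)⁻¹ := by positivity
    exact le_of_mul_le_mul_right (h4.symm.trans_le h1) h5

/-- Bounded functionals on `L^p` are given by functions of the conjugate exponent. -/
theorem exists_eq_pairing (hp1 : 1 < p) (hp : p ≠ ∞) (F : LpT p →L[ℂ] ℂ) :
    ∃ (w : Circle → ℂ) (hw : MemLp w q arc), F = pairing p hw := by
  obtain ⟨w, hwm, hwi, hw⟩ := exists_density hp F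
  -- So far w is only integrable. Its truncations to |w| ≤ N represent F on functions cut off to the
  -- same set, so their L^q norms are at most ‖F‖, and Fatou's lemma gives w ∈ L^q.
  let e : ℕ → Set Circle := fun N => {t | ‖w t‖ ≤ N}
  have he : ∀ N, MeasurableSet (e N) := fun N => measurableSet_le hwm.norm measurable_const
  let v : ℕ → Circle → ℂ := fun N => (e N).indicator w
  have hvm : ∀ N, Measurable (v N) := fun N => hwm.indicator (he N)
  have hvb : ∀ N t, ‖v N t‖ ≤ N := fun N t => by
    by_cases ht : t ∈ e N
    · simp only [v, Set.indicator_of_mem ht]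
      exact ht
    · simp [v, ht]
  have hvq : ∀ N, MemLp (v N) q arc := fun N =>
    MemLp.of_bound (hvm N).aestronglyMeasurable N (Eventually.of_forall (hvb N))
  have h1e : ∀ N, MemLp ((e N).indicator (1 : Circle → ℂ)) ∞ arc := fun N =>
    (memLp_const (1 : ℂ)).indicator (he N)
  have hnorm : ∀ N (f : LpT p), ‖mulOp p ((e N).indicator 1) f‖ ≤ ‖f‖ := fun N f => by
    refine Lp.norm_le_norm_of_ae_le ?_
    filter_upwards [coeFn_mulOp p (h1e N) f] with t ht
    rw [ht]
    by_cases h : t ∈ e N <;> simp [h]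
  have hF : ∀ N, F ∘L mulOp p ((e N).indicator 1) = pairing p (hvq N) := fun N => by
    refine clm_ext_indLp hp fun s hs => ?_
    have h1 : mulOp p ((e N).indicator 1) (indLp p hs) = indLp p (hs.inter (he N)) := by
      refine Lp.ext ?_
      filter_upwards [coeFn_mulOp p (h1e N) (indLp p hs),
        coeFn_indLp (p := p) hs,
        coeFn_indLp (p := p) (hs.inter (he N))] with t h1 h2 h3
      rw [h1, h2, h3]
      by_cases ht : t ∈ s <;> by_cases ht' : t ∈ e N <;> simp [ht, ht']
    rw [ContinuousLinearMap.comp_apply, h1, hw, pairing_apply,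
      ← integral_indicator (hs.inter (he N))]
    refine integral_congr_ae ?_
    filter_upwards [coeFn_indLp (p := p) hs] with t ht
    rw [ht]
    by_cases ht : t ∈ s <;> by_cases ht' : t ∈ e N <;> simp [v, ht, ht']
  have hle : ∀ N, eLpNorm (v N) q arc ≤ ENNReal.ofReal ‖F‖ := fun N =>
    eLpNorm_le_of_pairing_le (p := p) hp1 hp (hvm N) (hvb N) (norm_nonneg F) fun f => by
      rw [← pairing_apply (hvq N), ← hF N]
      exact (F.le_opNorm _).trans (by gcongr; exact hnorm N f)
  have hlim : ∀ᵐ t ∂arc, Tendsto (fun N => v N t) atTop (nhds (w t)) :=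
    Eventually.of_forall fun t => by
      refine tendsto_const_nhds.congr' ?_
      filter_upwards [eventually_ge_atTop ⌈‖w t‖⌉₊] with N hN
      have ht : t ∈ e N := Nat.ceil_le.mp hN
      simp [v, ht]
  have hwq : MemLp w q arc := by
    refine ⟨hwm.aestronglyMeasurable, ?_⟩
    refine (Lp.eLpNorm_lim_le_liminf_eLpNorm (fun N => (hvm N).aestronglyMeasurable) w hlim).trans_lt
      (lt_of_le_of_lt ?_ (ENNReal.ofReal_lt_top (r := ‖F‖)))
    exact liminf_le_of_le (by isBoundedDefault) fun b hb => by
      obtain ⟨N, hN⟩ := hb.exists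
      exact hN.trans (hle N)
  refine ⟨w, hwq, clm_ext_indLp hp fun s hs => ?_⟩
  rw [hw, pairing_apply, ← integral_indicator hs]
  refine integral_congr_ae ?_
  filter_upwards [coeFn_indLp (p := p) hs] with t ht
  rw [ht]
  by_cases ht : t ∈ s <;> simp [ht]

end Dual

/-! ### Functions of a Hardy space are nonzero almost everywhere -/

lemma continuous_circle_coe : Continuous fun t : Circle => (t : ℂ) := continuous_subtype_val

lemma integral_arc_eq_circleAverage {φ : ℂ → ℝ} (hφ : Continuous φ) :
    ∫ t : Circle, φ t ∂arc = Real.circleAverage φ 0 1 := by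
  have hm : AEStronglyMeasurable (fun t : Circle => φ t) arc :=
    (hφ.comp continuous_circle_coe).aestronglyMeasurable
  rw [arc, integral_map measurable_toCircle.aemeasurable hm, AddCircle.integral_haarAddCircle,
    Real.circleAverage_def]
  congr 1
  rw [← AddCircle.intervalIntegral_preimage (2 * π) 0, zero_add]
  refine intervalIntegral.integral_congr fun θ _ => ?_
  simp [AddCircle.toCircle_apply_mk, circleMap, Circle.coe_exp, Real.two_pi_pos.ne']

open Polynomial in
/-- The mean value inequality for the subharmonic function `|P| ^ s`. -/
lemma norm_coeff_zero_rpow_le (P : ℂ[X]) {s : ℝ} (hs : 0 < s) :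
    ‖P.coeff 0‖ ^ s ≤ ∫ t : Circle, ‖P.eval (t : ℂ)‖ ^ s ∂arc := by
  by_cases hP : P = 0
  · simp [hP, Real.zero_rpow hs.ne']
  -- |P(0)| is at most the Mahler measure, the exponential of the mean of log |P|; Jensen's
  -- inequality for exp then compares with the mean of |P|^s.
  have hM : ‖P.coeff 0‖ ≤ P.mahlerMeasure := by
    simpa using P.norm_coeff_le_choose_mul_mahlerMeasure 0
  refine (Real.rpow_le_rpow (norm_nonneg _) hM hs.le).trans ?_
  have hcont : Continuous fun z : ℂ => ‖P.eval z‖ ^ s :=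
    (P.continuous.norm).rpow_const fun _ => Or.inr hs.le
  rw [integral_arc_eq_circleAverage hcont, Real.circleAverage_eq_intervalAverage]
  have : IsFiniteMeasure (volume.restrict (Set.uIoc 0 (2 * π))) := by
    rw [Set.uIoc_of_le Real.two_pi_pos.le]
    infer_instance
  have : NeZero (volume (Set.uIoc 0 (2 * π))) := ⟨by simp⟩
  -- At a zero `Real.log` is 0 and exp(s log x) = x^s fails, so the finitely many zeros on the
  -- circle are discarded.
  have hpos : ∀ᵐ θ : ℝ ∂volume.restrict (Set.uIoc 0 (2 * π)),
      0 < ‖P.eval (circleMap 0 1 θ)‖ := by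
    rw [ae_restrict_iff' measurableSet_uIoc]
    refine Set.Finite.measure_zero ?_ _
    simp only [norm_pos_iff, ne_eq, Set.compl_ofPred, Classical.not_imp, Decidable.not_not]
    refine Set.Finite.of_finite_image (f := circleMap 0 1) (P.roots.finite_toSet.subset ?_) ?_
    · rintro z ⟨θ, ⟨_, h⟩, rfl⟩
      exact (mem_roots hP).mpr h
    · refine Set.InjOn.mono (fun θ h => h.1)
        (injOn_circleMap_of_abs_sub_le one_ne_zero (by simp [abs_of_pos Real.pi_pos]))
  have hexp : ∀ᵐ θ : ℝ ∂volume.restrict (Set.uIoc 0 (2 * π)),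
      Real.exp (s * Real.log ‖P.eval (circleMap 0 1 θ)‖) = ‖P.eval (circleMap 0 1 θ)‖ ^ s := by
    filter_upwards [hpos] with θ hθ
    rw [Real.rpow_def_of_pos hθ, mul_comm]
  have hc' : Continuous fun θ : ℝ => ‖P.eval (circleMap 0 1 θ)‖ ^ s :=
    hcont.comp (continuous_circleMap 0 1)
  have hlog : (2 * π)⁻¹ * ∫ θ in (0 : ℝ)..2 * π, Real.log ‖P.eval (circleMap 0 1 θ)‖ =
      ⨍ θ in (0 : ℝ)..2 * π, Real.log ‖P.eval (circleMap 0 1 θ)‖ := by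
    rw [interval_average_eq, sub_zero, smul_eq_mul]
  rw [mahlerMeasure_def_of_ne_zero hP, ← Real.exp_mul, hlog, ← average_congr hexp]
  have hint : Integrable (fun θ : ℝ => s * Real.log ‖P.eval (circleMap 0 1 θ)‖)
      (volume.restrict (Set.uIoc 0 (2 * π))) := by
    refine Integrable.const_mul ?_ s
    rw [Set.uIoc_of_le Real.two_pi_pos.le]
    exact (P.intervalIntegrable_mahlerMeasure).1
  have hJ := convexOn_exp.map_average_le Real.continuous_exp.continuousOn isClosed_univ
    (by simp) hint ((integrable_congr hexp).mpr hc'.integrableOn_uIoc)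
  refine le_trans (le_of_eq ?_) hJ
  congr 1
  rw [average_eq, average_eq, integral_const_mul]
  simp only [smul_eq_mul]
  ring

section Uniqueness

variable {p : ℝ≥0∞} [Fact (1 ≤ p)]

open Polynomial in
lemma memLp_eval (P : ℂ[X]) (r : ℝ≥0∞) : MemLp (fun t : Circle => P.eval (t : ℂ)) r arc :=
  memLp_of_continuous (P.continuous.comp continuous_circle_coe) r

open Polynomial in
/-- Analytic polynomials as elements of `L^p`. -/
def polyLp (p : ℝ≥0∞) [Fact (1 ≤ p)] : ℂ[X] →ₗ[ℂ] LpT p where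
  toFun P := (memLp_eval P p).toLp
  map_add' P R := by
    rw [← MemLp.toLp_add]
    exact MemLp.toLp_congr _ _ (Eventually.of_forall fun t => by simp)
  map_smul' k P := by
    rw [RingHom.id_apply, ← MemLp.toLp_const_smul]
    exact MemLp.toLp_congr _ _ (Eventually.of_forall fun t => by simp)

open Polynomial in
lemma coeFn_polyLp (P : ℂ[X]) : polyLp p P =ᵐ[arc] fun t : Circle => P.eval (t : ℂ) :=
  MemLp.coeFn_toLp (memLp_eval P p)

open Polynomial in
lemma polyLp_X_pow (k : ℕ) : polyLp p (X ^ k) = monomialLp p k := by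
  refine Lp.ext ?_
  filter_upwards [coeFn_polyLp (p := p) (X ^ k), coeFn_monomialLp p k] with t h1 h2
  rw [h1, h2]
  simp

open Polynomial in
lemma fcoeff_polyLp_zero (P : ℂ[X]) : fcoeff (polyLp p P) 0 = P.coeff 0 := by
  rw [← fcoeffL_apply]
  induction P using Polynomial.induction_on' with
  | add P R h1 h2 => rw [map_add, map_add, h1, h2, coeff_add]
  | monomial k a =>
    rw [← C_mul_X_pow_eq_monomial, ← smul_eq_C_mul, map_smul, map_smul, polyLp_X_pow,
      fcoeffL_apply, fcoeff_monomialLp]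
    simp only [coeff_smul, coeff_X_pow]
    norm_cast

lemma integral_norm_rpow_le (f : LpT p) {s : ℝ} (hs : 0 < s) (hs1 : s ≤ 1) :
    Integrable (fun t => ‖f t‖ ^ s) arc ∧ ∫ t, ‖f t‖ ^ s ∂arc ≤ ‖f‖ ^ s := by
  have hi := (integrable_coeFn f).norm
  have hI : Integrable (fun t => ‖f t‖ ^ s) arc := by
    refine (hi.add (integrable_const (1 : ℝ))).mono'
      (hi.aestronglyMeasurable.aemeasurable.pow_const s).aestronglyMeasurable
      (Eventually.of_forall fun t => ?_)
    rw [Real.norm_of_nonneg (by positivity)]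
    change ‖f t‖ ^ s ≤ ‖f t‖ + 1
    rcases le_total ‖f t‖ 1 with h | h
    · exact (Real.rpow_le_one (norm_nonneg _) h hs.le).trans (by simp)
    · exact (Real.rpow_le_self_of_one_le h hs1).trans (by simp)
  refine ⟨hI, ?_⟩
  have h := (Real.concaveOn_rpow hs.le hs1).le_map_integral
    (continuousOn_id.rpow_const fun _ _ => Or.inr hs.le) isClosed_Ici
    (Eventually.of_forall fun t => norm_nonneg (f t)) hi hI
  exact h.trans (Real.rpow_le_rpow (integral_nonneg fun t => norm_nonneg _) (integral_norm_le f) hs.le)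

variable [HasRieszProjection p]

/-- The inequality for polynomials passes to the limit: x ↦ x^s is subadditive for s ≤ 1, so
replacing f by P costs at most ‖f - P‖^s once in the coefficient and once in the integral. -/
lemma norm_fcoeff_zero_rpow_le (hp : p ≠ ∞) {f : LpT p} (hf : f ∈ Hardy p) {s : ℝ} (hs : 0 < s)
    (hs1 : s ≤ 1) : ‖fcoeff f 0‖ ^ s ≤ ∫ t, ‖f t‖ ^ s ∂arc := by
  have hcl : f ∈ (LinearMap.range (polyLp p)).topologicalClosure := by
    refine Hardy_le_of_monomialLp_mem hp _ (Submodule.isClosed_topologicalClosure _)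
      (fun k hk => Submodule.le_topologicalClosure _ ?_) hf
    obtain ⟨k, rfl⟩ := Int.eq_ofNat_of_zero_le hk
    exact ⟨Polynomial.X ^ k, polyLp_X_pow k⟩
  have hsub : ∀ x y : ℝ, 0 ≤ x → 0 ≤ y → (x + y) ^ s ≤ x ^ s + y ^ s := fun x y hx hy =>
    Real.rpow_add_le_add_rpow hx hy hs.le hs1
  have hmono : ∀ x y : ℝ, 0 ≤ x → x ≤ y → x ^ s ≤ y ^ s := fun x y hx hy =>
    Real.rpow_le_rpow hx hy hs.le
  have key : ∀ P : Polynomial ℂ,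
      ‖fcoeff f 0‖ ^ s ≤ ∫ t, ‖f t‖ ^ s ∂arc + 2 * ‖f - polyLp p P‖ ^ s := fun P => by
    set g := f - polyLp p P with hg
    have h1 : ‖fcoeff f 0‖ ≤ ‖P.coeff 0‖ + ‖g‖ := by
      have h2 : fcoeff f 0 = P.coeff 0 + fcoeff g 0 := by
        rw [← fcoeff_polyLp_zero (p := p) P, ← fcoeffL_apply, ← fcoeffL_apply, ← fcoeffL_apply,
          hg, map_sub]
        ring
      rw [h2]
      exact (norm_add_le _ _).trans (by gcongr; exact (norm_fcoeff_le 0).trans (integral_norm_le g))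
    have h3 : ‖fcoeff f 0‖ ^ s ≤ ‖P.coeff 0‖ ^ s + ‖g‖ ^ s :=
      (hmono _ _ (norm_nonneg _) h1).trans (hsub _ _ (norm_nonneg _) (norm_nonneg _))
    have h4 : ∫ t : Circle, ‖P.eval (t : ℂ)‖ ^ s ∂arc ≤
        ∫ t, ‖f t‖ ^ s ∂arc + ∫ t, ‖g t‖ ^ s ∂arc := by
      rw [← integral_add (integral_norm_rpow_le f hs hs1).1 (integral_norm_rpow_le g hs hs1).1]
      refine integral_mono_ae (((integral_norm_rpow_le (polyLp p P) hs hs1).1).congr ?_)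
        ((integral_norm_rpow_le f hs hs1).1.add (integral_norm_rpow_le g hs hs1).1) ?_
      · filter_upwards [coeFn_polyLp (p := p) P] with t ht
        rw [ht]
      · filter_upwards [coeFn_polyLp (p := p) P, Lp.coeFn_sub f (polyLp p P)] with t h5 h6
        refine (hmono _ (‖f t‖ + ‖g t‖) (norm_nonneg _) ?_).trans
          (hsub _ _ (norm_nonneg _) (norm_nonneg _))
        rw [hg, h6, Pi.sub_apply, h5]
        have := norm_sub_le (f t) (f t - P.eval (t : ℂ))
        rwa [sub_sub_cancel] at this
    have h5 := norm_coeff_zero_rpow_le P hs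
    have h6 := (integral_norm_rpow_le g hs hs1).2
    linarith
  refine le_of_forall_pos_le_add fun δ hδ => ?_
  obtain ⟨_, ⟨P, rfl⟩, hP⟩ := Metric.mem_closure_iff.mp hcl ((δ / 2) ^ s⁻¹) (by positivity)
  refine (key P).trans ?_
  have h7 : ‖f - polyLp p P‖ ^ s ≤ δ / 2 := by
    rw [dist_eq_norm] at hP
    have h8 := hmono _ _ (norm_nonneg _) hP.le
    rwa [← Real.rpow_mul (by positivity), inv_mul_cancel₀ hs.ne', Real.rpow_one] at h8
  linarith

/-- Let s → 0 in the mean value inequality: the left side tends to 1, and ∫ |f|^s tends to the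
measure of {f ≠ 0}. -/
lemma ae_ne_zero_of_fcoeff_zero_ne_zero (hp : p ≠ ∞) {f : LpT p} (hf : f ∈ Hardy p)
    (h0 : fcoeff f 0 ≠ 0) : ∀ᵐ t ∂arc, f t ≠ 0 := by
  let s : ℕ → ℝ := fun k => 1 / ((k : ℝ) + 1)
  have hs0 : ∀ k, 0 < s k := fun k => by positivity
  have hs1 : ∀ k, s k ≤ 1 := fun k => by
    rw [div_le_one (by positivity)]
    linarith [(Nat.cast_nonneg k : (0 : ℝ) ≤ k)]
  have hslim : Tendsto s atTop (nhds 0) := tendsto_one_div_add_atTop_nhds_zero_nat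
  have hmeas := Lp.aestronglyMeasurable f
  let e : Set Circle := {t | f t ≠ 0}
  have he : MeasurableSet e :=
    (Lp.stronglyMeasurable f).measurable (measurableSet_singleton 0).compl
  have hlim1 : Tendsto (fun k => ‖fcoeff f 0‖ ^ s k) atTop (nhds 1) := by
    have := (Real.continuousAt_const_rpow (b := 0) (norm_ne_zero_iff.mpr h0)).tendsto.comp hslim
    rwa [Real.rpow_zero] at this
  have hlim2 : Tendsto (fun k => ∫ t, ‖f t‖ ^ s k ∂arc) atTop
      (nhds (∫ t, e.indicator (1 : Circle → ℝ) t ∂arc)) := by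
    refine tendsto_integral_of_dominated_convergence (fun t => ‖f t‖ + 1)
      (fun k => (integral_norm_rpow_le f (hs0 k) (hs1 k)).1.aestronglyMeasurable)
      ((integrable_coeFn f).norm.add (integrable_const 1)) (fun k => Eventually.of_forall fun t => ?_)
      (Eventually.of_forall fun t => ?_)
    · rw [Real.norm_of_nonneg (by positivity)]
      rcases le_total ‖f t‖ 1 with h | h
      · exact (Real.rpow_le_one (norm_nonneg _) h (hs0 k).le).trans (by simp)
      · exact (Real.rpow_le_self_of_one_le h (hs1 k)).trans (by simp)
    · by_cases ht : f t = 0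
      · have ht' : t ∉ e := fun h => h ht
        simp only [ht, norm_zero, Set.indicator_of_notMem ht', Real.zero_rpow (hs0 _).ne']
        exact tendsto_const_nhds
      · have ht' : t ∈ e := ht
        have := (Real.continuousAt_const_rpow (b := 0) (norm_ne_zero_iff.mpr ht)).tendsto.comp hslim
        rw [Real.rpow_zero] at this
        rw [Set.indicator_of_mem ht', Pi.one_apply]
        exact this
  have hle : 1 ≤ ∫ t, e.indicator (1 : Circle → ℝ) t ∂arc := le_of_tendsto_of_tendsto' hlim1 hlim2 fun k =>
    norm_fcoeff_zero_rpow_le hp hf (hs0 k) (hs1 k)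
  rw [integral_indicator_one he] at hle
  have h1 : arc.real e = 1 := le_antisymm measureReal_le_one hle
  have h2 : arc e = 1 := by
    rw [Measure.real, ENNReal.toReal_eq_one_iff] at h1
    exact h1
  exact (prob_compl_eq_zero_iff he).mpr h2

/-- A nonzero function of a Hardy space is nonzero almost everywhere. -/
theorem ae_ne_zero_of_mem_Hardy (hp : p ≠ ∞) {f : LpT p} (hf : f ∈ Hardy p) (h0 : f ≠ 0) :
    ∀ᵐ t ∂arc, f t ≠ 0 := by
  classical
  have hex : ∃ k : ℕ, fcoeff f k ≠ 0 := by
    by_contra! h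
    refine h0 (Lp_ext_of_fcoeff fun n => ?_)
    rw [← fcoeffL_apply n (0 : LpT p), map_zero]
    rcases lt_or_ge n 0 with hn | hn
    · exact hf n hn
    · obtain ⟨k, rfl⟩ := Int.eq_ofNat_of_zero_le hn
      exact h k
  -- Dividing by t^k, with k the least index of a nonzero coefficient, moves that coefficient to
  -- index 0.
  let k := Nat.find hex
  have hk : fcoeff f k ≠ 0 := Nat.find_spec hex
  have hlow : ∀ n : ℤ, n < k → fcoeff f n = 0 := fun n hn => by
    rcases lt_or_ge n 0 with hn' | hn'
    · exact hf n hn'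
    · obtain ⟨j, rfl⟩ := Int.eq_ofNat_of_zero_le hn'
      by_contra hj
      exact Nat.find_min hex (by exact_mod_cast hn) hj
  have hc := coeFn_mulOp p (memLp_zpow (-(k : ℤ)) ∞) f
  have hcoef : ∀ n, fcoeff (mulOp p (fun t : Circle => (t : ℂ) ^ (-(k : ℤ))) f) n =
      fcoeff f (n + k) := fun n => by
    rw [fcoeff_congr hc, fcoeff_zpow_mul, sub_neg_eq_add]
  have h := ae_ne_zero_of_fcoeff_zero_ne_zero hp
    (f := mulOp p (fun t : Circle => (t : ℂ) ^ (-(k : ℤ))) f)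
    (fun n hn => by rw [hcoef, hlow _ (by omega)]) (by rwa [hcoef, zero_add])
  filter_upwards [h, hc] with t h1 h2 h3
  rw [h2, h3, mul_zero] at h1
  exact h1 rfl

end Uniqueness

/-! ### Coburn's lemma -/

section Coburn

variable {p : ℝ≥0∞} [Fact (1 ≤ p)]

instance instCompleteSpaceHardy : CompleteSpace (Hardy p) := isClosed_Hardy.completeSpace_coe

lemma exists_functional_of_notMem {E : Type*} [NormedAddCommGroup E] [NormedSpace ℂ E]
    {V : Submodule ℂ E} (hV : IsClosed (V : Set E)) {x : E} (hx : x ∉ V) :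
    ∃ φ : E →L[ℂ] ℂ, φ x ≠ 0 ∧ ∀ y ∈ V, φ y = 0 := by
  have h : V.mkQL x ≠ 0 := by simpa using hx
  obtain ⟨φ, hφ⟩ := SeparatingDual.exists_ne_zero (R := ℂ) h
  exact ⟨φ ∘L V.mkQL, hφ, fun y hy => by simp [(Submodule.Quotient.mk_eq_zero V).mpr hy]⟩

variable {q : ℝ≥0∞} [Fact (1 ≤ q)] [p.HolderConjugate q]

lemma pairing_monomialLp {w : Circle → ℂ} (hw : MemLp w q arc) (k : ℤ) :
    pairing p hw (monomialLp p k) = fcoeff w (-k) := by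
  rw [pairing_apply, fcoeff, neg_neg]
  refine integral_congr_ae ?_
  filter_upwards [coeFn_monomialLp p k] with t ht
  rw [ht]

lemma pairing_mulOp_monomialLp {w g : Circle → ℂ} (hw : MemLp w q arc) (hg : MemLp g ∞ arc)
    (k : ℤ) :
    pairing p hw (mulOp p g (monomialLp p k)) = fcoeff (fun t => g t * w t) (-k) := by
  rw [pairing_apply, fcoeff, neg_neg]
  refine integral_congr_ae ?_
  filter_upwards [coeFn_monomialLp p k, coeFn_mulOp p hg (monomialLp p k)] with t ht h2
  rw [h2, ht]
  ring

omit [Fact (1 ≤ p)] [Fact (1 ≤ q)] in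
lemma integrable_coeFn_mul (f : LpT p) {w : Circle → ℂ} (hw : MemLp w q arc) :
    Integrable (fun t => f t * w t) arc :=
  MemLp.integrable_mul (Lp.memLp f) hw

variable [HasRieszProjection p]

variable (p) in
/-- The Riesz projection as an operator onto the Hardy space. -/
def projHardy : LpT p →L[ℂ] Hardy p := (rieszP p).codRestrict (Hardy p) fun f => rieszP_mem p f

lemma projHardy_coe (f : Hardy p) : projHardy p f = f := Subtype.ext (rieszP_eq_self f.2)

omit [HasRieszProjection p] in
lemma projHardy_mulOp (g : Circle → ℂ) (f : Hardy p) :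
    projHardy p (mulOp p g f) = toeplitz p g f := rfl

/-- A bounded functional on the Hardy space is the pairing with a function of the conjugate Hardy
space. -/
lemma exists_memCoHardy_of_functional (hp1 : 1 < p) (hp : p ≠ ∞) (φ : Hardy p →L[ℂ] ℂ) :
    ∃ (w : Circle → ℂ) (hw : MemLp w q arc), MemCoHardy w q ∧
      ∀ f, φ (projHardy p f) = pairing p hw f := by
  obtain ⟨w, hw, h⟩ := exists_eq_pairing (q := q) hp1 hp (φ ∘L projHardy p)
  have h' : ∀ f, φ (projHardy p f) = pairing p hw f := fun f => by rw [← h]; rfl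
  refine ⟨w, hw, ⟨hw, fun n hn => ?_⟩, h'⟩
  have h1 := h' (monomialLp p (-n))
  rw [pairing_monomialLp, neg_neg] at h1
  rw [← h1, show projHardy p (monomialLp p (-n)) = 0 from
    Subtype.ext (rieszP_eq_zero (monomialLp_mem_Minus (by omega))), map_zero]

/-- **Coburn's lemma**. -/
theorem toeplitz_injective_or_surjective (hp1 : 1 < p) (hp : p ≠ ∞) {g : Circle → ℂ}
    (hg : MemGLinfty g) (hcl : IsClosed ((toeplitz p g).range : Set (Hardy p))) :
    Function.Injective (toeplitz p g) ∨ Function.Surjective (toeplitz p g) := by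
  obtain ⟨q, _, _⟩ := exists_holderConjugate p
  by_contra! hno
  obtain ⟨hinj, hsurj⟩ := hno
  obtain ⟨f, hf, hf0⟩ : ∃ f : Hardy p, toeplitz p g f = 0 ∧ f ≠ 0 := by
    by_contra! h
    exact hinj ((injective_iff_map_eq_zero _).mpr h)
  obtain ⟨y, hy⟩ : ∃ y, y ∉ (toeplitz p g).range := by
    by_contra! h
    exact hsurj fun y => h y
  obtain ⟨φ, hφy, hφ⟩ := exists_functional_of_notMem hcl hy
  obtain ⟨w, hw, hwc, hφw⟩ := exists_memCoHardy_of_functional (q := q) hp1 hp φ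
  have hgw : MemLp (fun t => g t * w t) q arc := hw.mul hg.1
  have hcoef : ∀ n : ℤ, n ≤ 0 → fcoeff (fun t => g t * w t) n = 0 := fun n hn => by
    have h := pairing_mulOp_monomialLp (p := p) hw hg.1 (-n)
    rw [neg_neg] at h
    rw [← h, ← hφw]
    exact hφ _ ⟨⟨monomialLp p (-n), monomialLp_mem_Hardy (by omega)⟩, rfl⟩
  have hgwH : MemHardy (fun t => g t * w t) q := ⟨hgw, fun n hn => hcoef n hn.le⟩
  have hx : mulOp p g f ∈ Minus p := mem_ker_toeplitz.mp hf
  have hae : (fun t => mulOp p g (f : LpT p) t * w t) =ᵐ[arc]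
      fun t => (f : LpT p) t * (g t * w t) := by
    filter_upwards [coeFn_mulOp p hg.1 (f : LpT p)] with t ht
    rw [ht]
    ring
  -- The function f g w has no coefficients of index ≤ 0 as f · (g w), and none of index ≥ 0 as (g
  -- f) · w. It vanishes, and since f g ≠ 0 almost everywhere, so does w.
  have hzero : (fun t => (f : LpT p) t * (g t * w t)) =ᵐ[arc] 0 := by
    refine ae_eq_zero_of_fcoeff_eq_zero (integrable_coeFn_mul _ hgw) fun n => ?_
    rcases le_or_gt n 0 with hn | hn
    · rw [fcoeff_mul_Hardy hp hgwH f.2 hn, hcoef 0 le_rfl, mul_zero, ite_self]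
    · rw [← fcoeff_congr hae, fcoeff_mul_Minus hp hwc hx (by omega), if_neg (by omega)]
  have hw0 : w =ᵐ[arc] 0 := by
    filter_upwards [hzero, hg.2.1, ae_ne_zero_of_mem_Hardy hp f.2 (fun h => hf0 (Subtype.ext h))]
      with t h1 h2 h3
    simpa [h2, h3] using h1
  refine hφy ?_
  rw [← projHardy_coe y, hφw, pairing_apply, integral_eq_zero_of_ae]
  filter_upwards [hw0] with t ht
  rw [ht]
  simp

end Coburn

/-! ### Fredholm Toeplitz operators -/

section Fredholm

variable {p : ℝ≥0∞} [Fact (1 ≤ p)]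

variable (p) in
/-- The monomial `t ^ k` as an element of the Hardy space. -/
def monomialHardy (k : ℕ) : Hardy p := ⟨monomialLp p k, monomialLp_mem_Hardy (Int.natCast_nonneg k)⟩

lemma coe_monomialHardy (k : ℕ) : (monomialHardy p k : LpT p) = monomialLp p k := rfl

lemma linearIndependent_monomialHardy : LinearIndependent ℂ (monomialHardy p) := by
  rw [linearIndependent_iff']
  intro s g h i hi
  have h1 := congrArg (fun f : Hardy p => fcoeffL p i f) h
  simp only [Submodule.coe_sum, Submodule.coe_smul, map_sum, map_smul, coe_monomialHardy,
    fcoeffL_apply, fcoeff_monomialLp, Nat.cast_inj, ZeroMemClass.coe_zero, map_zero,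
    smul_eq_mul, mul_ite, mul_one, mul_zero] at h1
  simpa [Finset.sum_ite_eq, hi] using h1

/-- A Toeplitz operator is a Fredholm operator only if the Riesz projection is bounded, since
`H^p` is infinite-dimensional. -/
lemma hasRieszProjection_of_isFredholm {c : Circle → ℂ} (h : (toeplitz p c).IsFredholm) :
    HasRieszProjection p := by
  by_contra hno
  have hP : rieszP p = 0 := by
    rw [rieszP, dif_neg fun h => hno ⟨h⟩]
  have h0 : (toeplitz p c).ker = ⊤ := by
    refine eq_top_iff.mpr fun f _ => ?_
    rw [LinearMap.mem_ker]
    refine Subtype.ext ?_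
    change rieszP p (mulOp p c f) = 0
    rw [hP]
    rfl
  have hfin := h.finite_ker
  rw [h0] at hfin
  have hfin' : FiniteDimensional ℂ (Hardy p) := Module.Finite.equiv (Submodule.topEquiv)
  exact not_finite_iff_infinite.mpr inferInstance (linearIndependent_monomialHardy (p := p)).finite

variable [HasRieszProjection p]

lemma toeplitz_zpow_neg_mul (hp : p ≠ ∞) {k : ℤ} (hk : 0 ≤ k) :
    toeplitz p (fun t => (t : ℂ) ^ (-k)) * toeplitz p (fun t => (t : ℂ) ^ k) = 1 := by
  rw [toeplitz_mul_plus hp (memLp_zpow _ ∞) (memHardy_zpow hk ∞)]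
  refine toeplitz_eq_one (Eventually.of_forall fun t => ?_)
  rw [← zpow_add₀ (Circle.coe_ne_zero t), neg_add_cancel, zpow_zero]

lemma ker_toeplitz_inv :
    (toeplitz p fun t => (t : ℂ) ^ (-1 : ℤ)).ker = Submodule.span ℂ {monomialHardy p 0} := by
  ext f
  rw [mem_ker_toeplitz, mem_Minus_iff, Submodule.mem_span_singleton]
  constructor
  · intro h
    refine ⟨fcoeff f 0, Subtype.ext (Lp_ext_of_fcoeff fun n => ?_)⟩
    rw [Submodule.coe_smul, ← fcoeffL_apply, map_smul, fcoeffL_apply, coe_monomialHardy,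
      fcoeff_monomialLp, Nat.cast_zero, smul_eq_mul]
    split_ifs with h0
    · rw [h0, mul_one]
    · rw [mul_zero]
      rcases lt_or_gt_of_ne h0 with h1 | h1
      · exact (f.2 n h1).symm
      · have h2 := h (n - 1) (by omega)
        rw [fcoeff_congr (coeFn_mulOp p (memLp_zpow (-1) ∞) _), fcoeff_zpow_mul] at h2
        rw [← h2]
        congr 1
        ring
  · rintro ⟨z, rfl⟩ n hn
    rw [Submodule.coe_smul, map_smul, ← fcoeffL_apply, map_smul, fcoeffL_apply,
      fcoeff_congr (coeFn_mulOp p (memLp_zpow (-1) ∞) _), fcoeff_zpow_mul, coe_monomialHardy,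
      fcoeff_monomialLp, if_neg (by push_cast; omega), smul_zero]

lemma finrank_ker_toeplitz_inv :
    Module.finrank ℂ (toeplitz p fun t => (t : ℂ) ^ (-1 : ℤ)).ker = 1 := by
  rw [ker_toeplitz_inv, finrank_span_singleton (linearIndependent_monomialHardy.ne_zero 0)]

lemma toeplitz_inv_surjective (hp : p ≠ ∞) :
    Function.Surjective (toeplitz p fun t => (t : ℂ) ^ (-1 : ℤ)) := fun f =>
  ⟨toeplitz p (fun t => (t : ℂ) ^ (1 : ℤ)) f,
    congrArg (fun A : Hardy p →L[ℂ] Hardy p => A f) (toeplitz_zpow_neg_mul hp zero_le_one)⟩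

open scoped LinearMap.FiniteRangeSetoid in
open LinearMap.FiniteRangeSetoid in
lemma isFredholm_toeplitz_inv (hp : p ≠ ∞) :
    (toeplitz p fun t => (t : ℂ) ^ (-1 : ℤ)).IsFredholm := by
  set A := toeplitz p fun t => (t : ℂ) ^ (-1 : ℤ) with hA
  set S := toeplitz p fun t => (t : ℂ) ^ (1 : ℤ) with hS
  have hAS : ∀ f, A (S f) = f := fun f =>
    congrArg (fun A : Hardy p →L[ℂ] Hardy p => A f) (toeplitz_zpow_neg_mul hp zero_le_one)
  refine ContinuousLinearMap.IsFredholm.of_isQuasiInverse (v := S) ⟨?_, ?_⟩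
  · change S.toLinearMap ∘ₗ A.toLinearMap ≈ LinearMap.id
    rw [equiv_iff_hasFiniteRange]
    have hle : (S.toLinearMap ∘ₗ A.toLinearMap - LinearMap.id).range ≤ A.ker := by
      rintro _ ⟨f, rfl⟩
      rw [LinearMap.mem_ker]
      change A (S (A f) - f) = 0
      rw [map_sub, hAS, sub_self]
    have : FiniteDimensional ℂ A.ker := Module.finite_of_finrank_pos
      (by rw [hA, finrank_ker_toeplitz_inv]; exact one_pos)
    exact Submodule.fg_iff_finiteDimensional _ |>.mpr (Submodule.finiteDimensional_of_le hle)
  · have h : A.toLinearMap ∘ₗ S.toLinearMap = LinearMap.id := LinearMap.ext hAS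
    change A.toLinearMap ∘ₗ S.toLinearMap ≈ LinearMap.id
    rw [h]

/-- Each further factor t⁻¹ composes on the left with T(t⁻¹), which is onto with a one-dimensional
kernel and so has index 1. -/
lemma isFredholm_toeplitz_zpow_neg_mul (hp : p ≠ ∞) {g : Circle → ℂ} (hg : MemLp g ∞ arc)
    (hF : (toeplitz p g).IsFredholm) (k : ℕ) :
    (toeplitz p fun t => (t : ℂ) ^ (-(k : ℤ)) * g t).IsFredholm ∧
      (toeplitz p fun t => (t : ℂ) ^ (-(k : ℤ)) * g t).index = (toeplitz p g).index + k := by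
  induction k with
  | zero => simpa using hF
  | succ k ih =>
    set A := toeplitz p fun t => (t : ℂ) ^ (-(k : ℤ)) * g t
    set S := toeplitz p fun t => (t : ℂ) ^ (-1 : ℤ)
    have hcomp : (toeplitz p fun t => (t : ℂ) ^ (-((k + 1 : ℕ) : ℤ)) * g t) = S ∘L A := by
      refine Eq.trans ?_ (toeplitz_minus_mul hp (memLp_zpow_mul hg _)
        (memCoHardy_zpow (by norm_num) ∞)).symm
      congr 1
      funext t
      rw [← mul_assoc, ← zpow_add₀ (Circle.coe_ne_zero t)]
      congr 2
      push_cast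
      ring
    have hS : S.IsFredholm := isFredholm_toeplitz_inv hp
    rw [hcomp]
    constructor
    · obtain ⟨u, hu⟩ := ih.1.exists_isQuasiInverse
      obtain ⟨v, hv⟩ := hS.exists_isQuasiInverse
      exact ContinuousLinearMap.IsFredholm.of_isQuasiInverse (v := u ∘L v)
        (LinearMap.IsQuasiInverse.comp hu hv)
    · have := ih.1.finite_ker
      have := ih.1.finite_coker
      have := hS.finite_ker
      have := hS.finite_coker
      have h1 : (S.toLinearMap ∘ₗ A.toLinearMap).index = S.index + A.index :=
        LinearMap.index_comp _
      have h2 : S.index = 1 := by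
        rw [LinearMap.index_of_surjective (toeplitz_inv_surjective hp), finrank_ker_toeplitz_inv]
        rfl
      rw [ContinuousLinearMap.toLinearMap_comp, h1, h2, ih.2]
      push_cast
      ring

/-- By Coburn's lemma the kernel or the cokernel is zero, and index zero forces the other to vanish
too. -/
lemma isUnit_toeplitz_of_index_eq_zero (hp1 : 1 < p) (hp : p ≠ ∞) {g : Circle → ℂ}
    (hg : MemGLinfty g) (hF : (toeplitz p g).IsFredholm) (h0 : (toeplitz p g).index = 0) :
    IsUnit (toeplitz p g) := by
  have := hF.finite_ker
  have := hF.finite_coker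
  rw [ContinuousLinearMap.isUnit_iff_bijective]
  rcases toeplitz_injective_or_surjective hp1 hp hg hF.isClosed_range with h | h
  · refine ⟨h, ?_⟩
    rw [LinearMap.index_of_injective h, neg_eq_zero, Nat.cast_eq_zero,
      Module.finrank_zero_iff, Submodule.Quotient.subsingleton_iff] at h0
    exact LinearMap.range_eq_top.mp h0
  · refine ⟨?_, h⟩
    rw [LinearMap.index_of_surjective h, Nat.cast_eq_zero, Submodule.finrank_eq_zero] at h0
    exact LinearMap.ker_eq_bot.mp h0

/-- A Fredholm Toeplitz operator of index `κ` is invertible after multiplication of its symbol by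
`t ^ κ`, for `κ ≤ 0`. -/
theorem isUnit_toeplitz_mul_zpow (hp1 : 1 < p) (hp : p ≠ ∞) {g : Circle → ℂ}
    (hg : MemGLinfty g) (hF : (toeplitz p g).IsFredholm) {κ : ℤ}
    (hκ : (toeplitz p g).index = κ) (hκ0 : κ ≤ 0) :
    IsUnit (toeplitz p fun t => g t * (t : ℂ) ^ κ) := by
  obtain ⟨k, rfl⟩ : ∃ k : ℕ, κ = -k := ⟨κ.natAbs, by omega⟩
  obtain ⟨h1, h2⟩ := isFredholm_toeplitz_zpow_neg_mul hp hg.1 hF k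
  simp only [mul_comm (g _)]
  refine isUnit_toeplitz_of_index_eq_zero hp1 hp ⟨memLp_zpow_mul hg.1 _, ?_, ?_⟩ h1 ?_
  · filter_upwards [hg.2.1] with t ht using mul_ne_zero (zpow_ne_zero _ (Circle.coe_ne_zero t)) ht
  · refine (memLp_zpow_mul hg.2.2 k).ae_eq (Eventually.of_forall fun t => ?_)
    simp [mul_comm]
  · rw [h2, hκ, neg_add_cancel]

end Fredholm

/-! ### Wiener-Hopf factorization of symbols of invertible Toeplitz operators -/

section WienerHopf

lemma fcoeff_finset_sum {ι : Type*} (s : Finset ι) {F : ι → Circle → ℂ}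
    (h : ∀ i ∈ s, Integrable (F i) arc) (n : ℤ) :
    fcoeff (fun t => ∑ i ∈ s, F i t) n = ∑ i ∈ s, fcoeff (F i) n := by
  simp only [fcoeff, Finset.mul_sum]
  exact integral_finsetSum _ fun i hi => integrable_zpow_mul (h i hi) _

lemma fcoeff_mul_pow (f : Circle → ℂ) (j : ℕ) (n : ℤ) :
    fcoeff (fun t : Circle => f t * (t : ℂ) ^ j) n = fcoeff f (n - j) := by
  rw [← fcoeff_zpow_mul]
  simp only [zpow_natCast, mul_comm]

/-- Only the indices from 0 to j survive, so the analytic part is a polynomial and no projection on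
L^q is involved. -/
lemma exists_isAnalyticPart_mul_pow {f : Circle → ℂ} (hf : ∀ n : ℤ, 0 < n → fcoeff f n = 0)
    (j : ℕ) : ∃ u, MemHardy u ∞ ∧ IsAnalyticPart (fun t => f t * (t : ℂ) ^ j) u := by
  let F : ℕ → Circle → ℂ := fun i t => fcoeff f (i - j) * (t : ℂ) ^ (i : ℤ)
  have hF : ∀ i, MemLp (F i) ∞ arc := fun i => (memLp_zpow i ∞).const_mul _
  have hu : ∀ n : ℤ, fcoeff (fun t => ∑ i ∈ Finset.range (j + 1), F i t) n =
      if 0 ≤ n then fcoeff f (n - j) else 0 := fun n => by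
    rw [fcoeff_finset_sum _ fun i _ => (hF i).integrable le_top]
    simp only [F, fcoeff_const_mul, fcoeff_zpow]
    split_ifs with hn
    · obtain ⟨m, rfl⟩ := Int.eq_ofNat_of_zero_le hn
      simp only [Nat.cast_inj, mul_ite, mul_one, mul_zero, Finset.sum_ite_eq, Finset.mem_range]
      split_ifs with hm
      · rfl
      · exact (hf _ (by omega)).symm
    · exact Finset.sum_eq_zero fun i _ => by rw [if_neg (by omega), mul_zero]
  refine ⟨fun t => ∑ i ∈ Finset.range (j + 1), F i t,
    ⟨memLp_finsetSum _ fun i _ => hF i, fun n hn => ?_⟩, fun n => ?_⟩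
  · rw [hu, if_neg (by omega)]
  · rw [hu, fcoeff_mul_pow]

variable {p q : ℝ≥0∞} [Fact (1 ≤ p)] [Fact (1 ≤ q)] [p.HolderConjugate q] [HasRieszProjection p]

/-- The product of `x` and the nonanalytic part of `x⁻¹ t ^ j` has no coefficients of nonnegative
index. -/
lemma fcoeff_mul_analyticPart (hp : p ≠ ∞) {x y u : Circle → ℂ} (hx : MemCoHardy x p)
    (hy : MemCoHardy y q) (hxy : ∀ᵐ t ∂arc, x t * y t = 1) {j : ℕ} (hu : MemHardy u ∞)
    (hA : IsAnalyticPart (fun t => y t * (t : ℂ) ^ j) u) {n : ℤ} (hn : 0 ≤ n) :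
    fcoeff (fun t => x t * u t) n = if n = j then 1 else 0 := by
  have hyj : MemLp (fun t : Circle => y t * (t : ℂ) ^ j) q arc := by
    simpa only [zpow_natCast, mul_comm] using memLp_zpow_mul hy.1 j
  have huq := (hu.of_top q).1
  have hq : (1 : ℝ≥0∞) ≤ q := Fact.out
  -- y t^j - u has only coefficients of negative index, so a factor t still leaves it coanalytic;
  -- its product with x is t (t^j - x u).
  have hh : MemCoHardy (fun t : Circle => (t : ℂ) ^ (1 : ℤ) * (y t * (t : ℂ) ^ j - u t)) q := by
    refine ⟨memLp_zpow_mul (hyj.sub huq) 1, fun m hm => ?_⟩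
    rw [fcoeff_zpow_mul, fcoeff_sub (hyj.integrable hq) (huq.integrable hq), hA,
      if_pos (by omega), sub_self]
  have h1 := hx.mul_fcoeff hp hh (n := n + 1) (by omega)
  rw [if_neg (by omega)] at h1
  have hxu : Integrable (fun t => x t * u t) arc :=
    (hu.1.mul hx.1 : MemLp (fun t => x t * u t) p arc).integrable Fact.out
  have h2 := fcoeff_sub ((memLp_zpow j 1).integrable le_rfl) hxu n
  rw [fcoeff_zpow] at h2
  have h3 : fcoeff (fun t : Circle => (t : ℂ) ^ (j : ℤ) - x t * u t) n = 0 := by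
    rw [← h1, ← add_sub_cancel_right n 1, ← fcoeff_zpow_mul (1 : ℤ), add_sub_cancel_right]
    refine fcoeff_congr ?_ _
    filter_upwards [hxy] with t ht
    rw [zpow_natCast]
    linear_combination (-(t : ℂ) ^ (1 : ℤ) * (t : ℂ) ^ j) * ht
  rw [h3] at h2
  exact (sub_eq_zero.mp h2.symm).symm

/-- The symbol of an invertible Toeplitz operator has a Wiener-Hopf factorization. -/
theorem exists_isWienerHopf_of_isUnit (hp1 : 1 < p) (hp : p ≠ ∞) {g : Circle → ℂ}
    (hg : MemGLinfty g) (hU : IsUnit (toeplitz p g)) :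
    ∃ gm gp, IsWienerHopf p q g 0 gm gp := by
  obtain ⟨U, hU⟩ := hU
  set B : Hardy p →L[ℂ] Hardy p := ↑U⁻¹ with hB
  have hTB : ∀ y, toeplitz p g (B y) = y := fun y => by
    have := congrArg (fun A : Hardy p →L[ℂ] Hardy p => A y) U.mul_inv
    rwa [hU] at this
  have hBT : ∀ y, B (toeplitz p g y) = y := fun y => by
    have := congrArg (fun A : Hardy p →L[ℂ] Hardy p => A y) U.inv_mul
    rwa [hU] at this
  -- f = T(g)⁻¹ 1 will be g₊⁻¹, and x = g f will be g₋.
  set f := B (monomialHardy p 0) with hf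
  set x := mulOp p g f with hx
  have hxg := coeFn_mulOp p hg.1 (f : LpT p)
  have hxc : ∀ n : ℤ, 0 ≤ n → fcoeff x n = if n = 0 then 1 else 0 := fun n hn => by
    have h1 := fcoeff_rieszP x n
    rw [if_pos hn, hx, ← coe_toeplitz, hTB, coe_monomialHardy, fcoeff_monomialLp] at h1
    exact h1.symm
  have hxH : MemCoHardy x p := ⟨Lp.memLp x, fun n hn => by rw [hxc n hn.le, if_neg hn.ne']⟩
  -- The functional y ↦ (T(g)⁻¹ y)₀ supplies the dual solution w, which turns out to be a multiple
  -- of g₋⁻¹.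
  obtain ⟨w, hw, hwc, hφ⟩ := exists_memCoHardy_of_functional (q := q) hp1 hp
    (fcoeffL p 0 ∘L (Hardy p).subtypeL ∘L B)
  replace hφ : ∀ y, fcoeff (B (projHardy p y)) 0 = pairing p hw y := hφ
  have hgw : MemLp (fun t => g t * w t) q arc := hw.mul hg.1
  have hgwc : ∀ n : ℤ, n ≤ 0 → fcoeff (fun t => g t * w t) n = if n = 0 then 1 else 0 :=
    fun n hn => by
      obtain ⟨k, rfl⟩ : ∃ k : ℕ, n = -k := ⟨n.natAbs, by omega⟩
      rw [← pairing_mulOp_monomialLp (p := p) hw hg.1, ← hφ, ← coe_monomialHardy,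
        projHardy_mulOp, hBT, coe_monomialHardy, fcoeff_monomialLp]
      simp only [neg_eq_zero, eq_comm]
  have hgwH : MemHardy (fun t => g t * w t) q :=
    ⟨hgw, fun n hn => by rw [hgwc n hn.le, if_neg hn.ne]⟩
  have hw0 : fcoeff w 0 = fcoeff f 0 := by
    have h := hφ (monomialHardy p 0)
    rw [projHardy_coe, ← hf, coe_monomialHardy, pairing_monomialLp] at h
    simpa using h.symm
  have hf0 : f ≠ 0 := fun h => linearIndependent_monomialHardy.ne_zero 0
    (show monomialHardy p 0 = 0 by rw [← hTB (monomialHardy p 0), ← hf, h, map_zero])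
  have hfne : ∀ᵐ t ∂arc, (f : LpT p) t ≠ 0 :=
    ae_ne_zero_of_mem_Hardy hp f.2 fun h => hf0 (Subtype.ext h)
  -- f · (g w) is analytic and (g f) · w is coanalytic, so this product is constant.
  have hprod : ∀ᵐ t ∂arc, (f : LpT p) t * (g t * w t) = fcoeff f 0 := by
    refine ae_eq_of_fcoeff_eq (integrable_coeFn_mul _ hgw) (integrable_const _) fun n => ?_
    rw [fcoeff_const]
    rcases le_total n 0 with hn | hn
    · rw [fcoeff_mul_Hardy hp hgwH f.2 hn, hgwc 0 le_rfl, if_pos rfl, mul_one]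
    · rw [← hw0, ← one_mul (fcoeff w 0), ← if_pos (c := (0 : ℤ) = 0) (t := (1 : ℂ)) (e := 0) rfl,
        ← hxc 0 le_rfl, ← hxH.mul_fcoeff hp hwc hn]
      refine fcoeff_congr ?_ n
      filter_upwards [hxg] with t ht
      rw [ht]
      ring
  have hf00 : fcoeff f 0 ≠ 0 := fun h0 => by
    have h1 : (fun t => g t * w t) =ᵐ[arc] fun _ => 0 := by
      filter_upwards [hprod, hfne] with t h1 h2
      rw [h0] at h1
      exact (mul_eq_zero.mp h1).resolve_left h2
    have h2 := hgwc 0 le_rfl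
    rw [fcoeff_congr h1, fcoeff_const, if_pos rfl, if_pos rfl] at h2
    exact zero_ne_one h2
  have hxinv : ∀ᵐ t ∂arc, (fcoeff f 0)⁻¹ * w t = (x t)⁻¹ := by
    filter_upwards [hprod, hfne, hg.2.1, hxg] with t h1 h2 h3 h4
    rw [h4, ← h1]
    have h5 : w t ≠ 0 := fun h5 => hf00 (by rw [← h1, h5, mul_zero, mul_zero])
    field_simp
  have hxi : MemCoHardy (x : Circle → ℂ)⁻¹ q := (hwc.const_mul _).congr hxinv
  refine ⟨x, (f : LpT p)⁻¹, ?_, ?_, ?_, ?_, hxH, hxi, ?_, B, fun j y hy => ?_⟩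
  · filter_upwards [hfne, hxg] with t h1 h2
    rw [h2, zpow_zero, mul_one, Pi.inv_apply, mul_assoc, mul_inv_cancel₀ h1, mul_one]
  · filter_upwards [hfne, hxg, hg.2.1] with t h1 h2 h3
    rw [h2]
    exact ⟨mul_ne_zero h3 h1, inv_ne_zero h1⟩
  · refine (hgwH.const_mul (fcoeff f 0)⁻¹).congr ?_
    filter_upwards [hprod, hfne] with t h1 h2
    rw [← h1, Pi.inv_apply]
    have h5 : g t * w t ≠ 0 := fun h5 => hf00 (by rw [← h1, h5, mul_zero])
    rw [mul_inv, inv_mul_cancel_right₀ h5]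
  · rw [inv_inv]
    exact ⟨Lp.memLp _, f.2⟩
  · rw [hxc 0 le_rfl, if_pos rfl]
  · obtain ⟨u, hu, hA⟩ := exists_isAnalyticPart_mul_pow hxi.2 j
    refine ⟨u, hu.of_top q, hA, ?_⟩
    have hcu := coeFn_mulOp p hu.1 (f : LpT p)
    let v : Hardy p := ⟨mulOp p u f, mulOp_mem_Hardy hp hu f.2⟩
    -- T(g)(f u) = P(x u) = t^j, so T(g)⁻¹ is the extension of g₊⁻¹ P g₋⁻¹.
    have hv : toeplitz p g v = y := by
      refine Subtype.ext (Lp_ext_of_fcoeff fun n => ?_)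
      rw [coe_toeplitz, fcoeff_rieszP, fcoeff_congr hy]
      simp only [← zpow_natCast]
      rw [fcoeff_zpow]
      by_cases h1 : 0 ≤ n
      · rw [if_pos h1, ← fcoeff_mul_analyticPart hp hxH hxi ?_ hu hA h1]
        · refine fcoeff_congr ?_ n
          filter_upwards [coeFn_mulOp p hg.1 (v : LpT p), hcu, hxg] with t h3 h4 h5
          rw [h3, h4, h5]
          ring
        · filter_upwards [hfne, hxg, hg.2.1] with t h1 h2 h3
          rw [Pi.inv_apply, h2, mul_inv_cancel₀ (mul_ne_zero h3 h1)]
      · rw [if_neg h1, if_neg (by omega)]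
    rw [← hv, hBT]
    filter_upwards [hcu] with t ht
    rw [Pi.inv_apply, inv_inv, mul_comm]
    exact ht

omit [Fact (1 ≤ q)] [p.HolderConjugate q] [HasRieszProjection p] in
lemma IsWienerHopf.mul_zpow {g gm gp : Circle → ℂ} {k : ℤ} (h : IsWienerHopf p q g k gm gp)
    (m : ℤ) : IsWienerHopf p q (fun t => g t * (t : ℂ) ^ m) (k + m) gm gp :=
  { h with
    eq := by
      filter_upwards [h.eq] with t ht
      rw [ht, zpow_add₀ (Circle.coe_ne_zero t)]
      ring }

end WienerHopf

/-! ### The homogeneous equation -/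

section Homogeneous

variable {p : ℝ≥0∞} [Fact (1 ≤ p)] [HasRieszProjection p] {β : OuterPoint}

omit [Fact (1 ≤ p)] [HasRieszProjection p] in
lemma alphaMinus_ne_zero (t : Circle) : alphaMinus β t ≠ 0 :=
  div_ne_zero (mul_ne_zero (lam_ne_zero β) (Circle.coe_ne_zero t)) (den_ne_zero β t)

omit [Fact (1 ≤ p)] [HasRieszProjection p] in
lemma memCoHardy_inv_alphaMinus : MemCoHardy (fun t => (alphaMinus β t)⁻¹) ∞ := by
  have h : MemCoHardy (fun t : Circle => -(lam β)⁻¹ * (t : ℂ) ^ (-1 : ℤ)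
      + conj (β : ℂ) / lam β) ∞ :=
    ((memCoHardy_zpow (by norm_num) ∞).const_mul _).add_top (memCoHardy_const _ ∞)
  refine h.congr (Eventually.of_forall fun t => ?_)
  have h1 := lam_ne_zero β
  have h2 := Circle.coe_ne_zero t
  simp only [alphaMinus, zpow_neg, zpow_one, inv_div]
  field_simp
  ring

/-- Both α₋ and α₋⁻¹ are bounded and coanalytic, and T is multiplicative on such symbols. -/
lemma isUnit_toeplitz_alphaMinus_pow (hp : p ≠ ∞) (k : ℕ) :
    IsUnit (toeplitz p fun t => alphaMinus β t ^ k) := by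
  have h1 := ((memCoHardy_alphaMinus β).pow_top p hp k).1
  have h2 := ((memCoHardy_inv_alphaMinus (β := β)).pow_top p hp k).1
  refine isUnit_iff_exists.mpr ⟨toeplitz p fun t => (alphaMinus β t)⁻¹ ^ k, ?_, ?_⟩
  · rw [toeplitz_minus_mul hp h2.1 h1, toeplitz_eq_one]
    refine Eventually.of_forall fun t => ?_
    rw [← mul_pow, mul_inv_cancel₀ (alphaMinus_ne_zero t), one_pow]
  · rw [toeplitz_minus_mul hp h1.1 h2, toeplitz_eq_one]
    refine Eventually.of_forall fun t => ?_
    rw [← mul_pow, inv_mul_cancel₀ (alphaMinus_ne_zero t), one_pow]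

lemma isUnit_toeplitz_alphaMinus_pow_mul (hp : p ≠ ∞) {g : Circle → ℂ} (hg : MemLp g ∞ arc)
    (hU : IsUnit (toeplitz p g)) (k : ℕ) :
    IsUnit (toeplitz p fun t => alphaMinus β t ^ k * g t) := by
  rw [← toeplitz_minus_mul hp hg ((memCoHardy_alphaMinus β).pow_top p hp k).1]
  exact (isUnit_toeplitz_alphaMinus_pow hp k).mul hU

/-- T(g) = T(t^(-κ)) T(g t^κ), and T(t^(-κ)) T(t^κ) = I for κ ≥ 0. -/
lemma toeplitz_mul_toeplitzRightInv (hp : p ≠ ∞) {g : Circle → ℂ} (hg : MemLp g ∞ arc) {κ : ℤ}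
    (hκ : 0 ≤ κ) (hU : IsUnit (toeplitz p fun t => g t * (t : ℂ) ^ κ)) :
    toeplitz p g * toeplitzRightInv p g κ = 1 := by
  have hgt : MemLp (fun t : Circle => g t * (t : ℂ) ^ κ) ∞ arc := by
    simpa only [mul_comm] using memLp_zpow_mul hg κ
  have h : toeplitz p g =
      toeplitz p (fun t => (t : ℂ) ^ (-κ)) * toeplitz p fun t => g t * (t : ℂ) ^ κ := by
    rw [toeplitz_minus_mul hp hgt (memCoHardy_zpow (by omega) ∞)]
    congr 1
    funext t
    rw [mul_left_comm, ← zpow_add₀ (Circle.coe_ne_zero t), neg_add_cancel, zpow_zero, mul_one]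
  rw [h, toeplitzRightInv, mul_assoc, Ring.mul_inverse_cancel_left _ _ hU,
    toeplitz_zpow_neg_mul hp hκ]

omit [HasRieszProjection p] in
lemma eq_zero_of_mulOp_mem_Minus {v : Circle → ℂ} (hU : IsUnit (toeplitz p v)) {g : LpT p}
    (hg : g ∈ Hardy p) (h : mulOp p v g ∈ Minus p) : g = 0 := by
  have h1 : (⟨g, hg⟩ : Hardy p) ∈ (toeplitz p v).ker := mem_ker_toeplitz.mpr h
  have h2 := ((ContinuousLinearMap.isUnit_iff_bijective.mp hU).1 :
    Function.Injective (toeplitz p v))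
  exact congrArg Subtype.val (h2 ((LinearMap.mem_ker.mp h1).trans (map_zero _).symm))

omit [Fact (1 ≤ p)] [HasRieszProjection p] in
lemma diskExt_congr {f g : Circle → ℂ} (h : f =ᵐ[arc] g) (z : ℂ) : diskExt f z = diskExt g z := by
  simp only [diskExt, fcoeff_congr h]

omit [HasRieszProjection p] in
lemma diskExt_smul (k : ℂ) (f : LpT p) (z : ℂ) : diskExt (k • f : LpT p) z = k * diskExt f z := by
  simp only [diskExt, ← fcoeffL_apply, map_smul, smul_eq_mul, mul_assoc, tsum_mul_left]

/-- If the kernel of a Toeplitz operator with matching symbol `v` is spanned by `f`, then the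
involution `J` acts on it as a sign `σ`, and the sign `-σ` determines which of the two homogeneous
equations `v g + ε J g = 0` has a nonzero solution. -/
lemma exists_sign (hp : p ≠ ∞) {v : Circle → ℂ} (hv : MemLp v ∞ arc)
    (hvv : ∀ᵐ t ∂arc, v t * v (shift β t) = 1)
    (hU : IsUnit (toeplitz p fun t => (t : ℂ) ^ (1 : ℤ) * v t)) {f : LpT p} (hf : f ∈ Hardy p)
    (hx : mulOp p v f ∈ Minus p) (hx1 : fcoeff (mulOp p v f) (-1) ≠ 0) :
    ∃ σ : ℂ, σ * σ = 1 ∧ shiftJ p β (mulOp p v f) = σ • f ∧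
      ∀ ε : ℂ, ε * ε = 1 → ∀ g ∈ Hardy p, mulOp p v g + ε • shiftJ p β g = 0 ↔
        g ∈ Submodule.span ℂ {((1 - ε * σ) / 2) • f} := by
  set x := mulOp p v f with hx_def
  -- Among nonnegative indices, t v g and t v f have at most the coefficient 0. With k the ratio of
  -- these coefficients, g - k f is in the zero kernel of T(t v).
  have hker : ∀ g ∈ Hardy p, mulOp p v g ∈ Minus p → ∃ k : ℂ, g = k • f := fun g hg hm => by
    refine ⟨fcoeff (mulOp p v g) (-1) / fcoeff x (-1), sub_eq_zero.mp ?_⟩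
    set k := fcoeff (mulOp p v g) (-1) / fcoeff x (-1) with hk
    refine eq_zero_of_mulOp_mem_Minus hU
      ((Hardy p).sub_mem hg ((Hardy p).smul_mem k hf)) (mem_Minus_iff.mpr fun n hn => ?_)
    rw [← mulOp_mulOp (memLp_zpow 1 ∞) hv, fcoeff_congr (coeFn_mulOp p (memLp_zpow 1 ∞) _),
      fcoeff_zpow_mul, map_sub, map_smul, ← hx_def, ← fcoeffL_apply, map_sub, map_smul,
      fcoeffL_apply, fcoeffL_apply, smul_eq_mul]
    rcases hn.eq_or_lt with rfl | hn
    · rw [zero_sub, hk, div_mul_cancel₀ _ hx1, sub_self]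
    · rw [mem_Minus_iff.mp hm _ (by omega), mem_Minus_iff.mp hx _ (by omega), mul_zero, sub_zero]
  -- v v_α = 1 gives v J x = J f in `Minus`, so J x is again in ker T(v) and is a multiple of f.
  have hvJ : mulOp p v (shiftJ p β x) = shiftJ p β f := by
    rw [hx_def, shiftJ_mulOp β hv, mulOp_mulOp hv (memLp_comp β hv), mulOp_eq_self hvv]
  obtain ⟨σ, hσ⟩ := hker _ (shiftJ_mem_Hardy hp β hx) (by
    rw [hvJ]
    exact shiftJ_mem_Minus hp β hf)
  have hJf : shiftJ p β f = σ • x := by rw [← hvJ, hσ, map_smul]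
  have hx0 : x ≠ 0 := fun h => hx1 (by rw [h, ← fcoeffL_apply, map_zero])
  have hσσ : σ * σ = 1 := by
    have h := shiftJ_shiftJ β x
    rw [hσ, map_smul, hJf, smul_smul] at h
    have h2 : (σ * σ - 1) • x = 0 := by rw [sub_smul, h, one_smul, sub_self]
    exact sub_eq_zero.mp ((smul_eq_zero.mp h2).resolve_right hx0)
  have hval : ∀ k ε : ℂ, mulOp p v (k • f) + ε • shiftJ p β (k • f) =
      (k * (1 + ε * σ)) • x := fun k ε => by
    rw [map_smul, map_smul, hJf, ← hx_def, smul_smul, smul_smul, ← add_smul]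
    congr 1
    ring
  refine ⟨σ, hσσ, hσ, fun ε hε g hg => ?_⟩
  -- Since (ε σ)² = 1, either ε σ = -1, where every multiple of f is a solution and (1 - ε σ)/2 = 1,
  -- or ε σ = 1, where only 0 is a solution and the spanning vector is 0.
  have hεσ : (1 - ε * σ) * (1 + ε * σ) = 0 := by linear_combination -ε * ε * hσσ - hε
  rw [Submodule.mem_span_singleton]
  constructor
  · intro h
    have hm : mulOp p v g ∈ Minus p := by
      rw [eq_neg_of_add_eq_zero_left h]
      exact (Minus p).neg_mem ((Minus p).smul_mem _ (shiftJ_mem_Minus hp β hg))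
    obtain ⟨k, rfl⟩ := hker g hg hm
    rw [hval] at h
    rcases mul_eq_zero.mp ((smul_eq_zero.mp h).resolve_right hx0) with hk | hk
    · exact ⟨0, by rw [hk, zero_smul, zero_smul]⟩
    · refine ⟨k, ?_⟩
      rw [show (1 - ε * σ) / 2 = 1 by linear_combination -hk / 2, one_smul]
  · rintro ⟨k, rfl⟩
    rw [smul_smul, hval]
    rw [show k * ((1 - ε * σ) / 2) * (1 + ε * σ) = 0 by linear_combination k / 2 * hεσ, zero_smul]

variable {q : ℝ≥0∞} [Fact (1 ≤ q)] [p.HolderConjugate q]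

/-- The solutions of the homogeneous equation are described by the signature. -/
theorem homogeneous_iff_mem_span (hp : p ≠ ∞) {c v cm cp : Circle → ℂ} {κ : ℤ} {n : ℕ}
    (hn : 2 * (n : ℤ) + κ = 1) (hv : MemLp v ∞ arc)
    (hvv : ∀ᵐ t ∂arc, v t * v (shift β t) = 1)
    (hvc : ∀ t : Circle, (t : ℂ) * v t = alphaMinus β t ^ (2 * n) * (c t * (t : ℂ) ^ κ))
    (hU : IsUnit (toeplitz p fun t => (t : ℂ) ^ (1 : ℤ) * v t))
    (h : IsWienerHopf p q c (-κ) cm cp) {ε : ℂ} (hε : ε * ε = 1) {g : LpT p} (hg : g ∈ Hardy p) :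
    mulOp p v g + ε • shiftJ p β g = 0 ↔
      g ∈ Submodule.span ℂ {((1 - ε * signature β κ cp) / 2) • h.plus_inv.1.toLp cp⁻¹} := by
  set f := h.plus_inv.1.toLp cp⁻¹ with hf_def
  have hcf : f =ᵐ[arc] cp⁻¹ := h.plus_inv.1.coeFn_toLp
  have hf : f ∈ Hardy p := fun n hn => by rw [fcoeff_congr hcf, h.plus_inv.2 n hn]
  obtain ⟨hm, hm0⟩ := (memCoHardy_alphaMinus β).pow_top p hp (2 * n)
  rw [fcoeff_alphaMinus_zero] at hm0
  -- The factorization gives v c₊⁻¹ = t⁻¹ α₋^(2n) c₋, whose leading coefficient, at index -1, is (λ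
  -- / conj β)^(2n) because c₋(∞) = 1.
  have hxc : ∀ j : ℤ, -1 ≤ j → fcoeff (mulOp p v f) j =
      if j = -1 then (lam β / conj (β : ℂ)) ^ (2 * n) else 0 := fun j hj => by
    have h1 := h.minus.mul_fcoeff hp (hm.of_top q) (n := j + 1) (by omega)
    rw [h.minus_infty, one_mul, hm0] at h1
    rw [← if_congr (show j + 1 = 0 ↔ j = -1 by omega) rfl rfl, ← h1,
      ← sub_neg_eq_add, ← fcoeff_zpow_mul]
    refine fcoeff_congr ?_ j
    filter_upwards [coeFn_mulOp p hv f, hcf, h.eq, h.ne_zero] with t h2 h3 h4 h5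
    have ht := Circle.coe_ne_zero t
    have h6 : c t * (t : ℂ) ^ κ = cm t * cp t := by
      rw [h4, mul_right_comm, mul_assoc (cm t), ← zpow_add₀ ht, neg_add_cancel, zpow_zero, mul_one]
    have h7 := hvc t
    rw [h6] at h7
    rw [h2, h3, Pi.inv_apply, ← div_eq_mul_inv, div_eq_iff h5.2, zpow_neg, zpow_one,
      ← mul_right_inj' ht, h7]
    field_simp
  have hL : lam β / conj (β : ℂ) ≠ 0 := div_ne_zero (lam_ne_zero β) (conj_coe_ne_zero β)
  have hx1 : fcoeff (mulOp p v f) (-1) = (lam β / conj (β : ℂ)) ^ (2 * n) := by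
    rw [hxc (-1) le_rfl, if_pos rfl]
  have hx : mulOp p v f ∈ Minus p := mem_Minus_iff.mpr fun j hj => by
    rw [hxc j (by omega), if_neg (by omega)]
  obtain ⟨σ, hσσ, hσ, hiff⟩ := exists_sign hp hv hvv hU hf hx (by
    rw [hx1]
    exact pow_ne_zero _ hL)
  -- Evaluating J x = σ f at 1/conj β gives σ f(1/conj β) = (λ / conj β)^(2n-1) = (λ / conj β)^(-κ).
  -- So the signature is σ⁻¹, which is σ.
  have hsig : signature β κ cp = σ := by
    have h1 := diskExt_shiftJ hp β hx
    rw [hσ, diskExt_smul, hx1, diskExt_congr hcf, ← inv_div, ← zpow_natCast,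
      ← zpow_neg_one (lam β / _), ← zpow_add₀ hL] at h1
    rw [signature, one_div]
    have h2 : (lam β / conj (β : ℂ)) ^ κ * (lam β / conj (β : ℂ)) ^ (-1 + ((2 * n : ℕ) : ℤ)) = 1 := by
      rw [← zpow_add₀ hL, show κ + (-1 + ((2 * n : ℕ) : ℤ)) = 0 by push_cast; omega, zpow_zero]
    linear_combination σ * (lam β / conj (β : ℂ)) ^ κ * h1 + σ * h2 -
      (lam β / conj (β : ℂ)) ^ κ * diskExt cp⁻¹ (conj (β : ℂ))⁻¹ * hσσ
  rw [hsig]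
  exact hiff ε hε g hg

/-- J g is in `Minus`, so a solution lies in ker T(v), which is zero. -/
lemma homogeneous_iff_eq_zero (hp : p ≠ ∞) {v : Circle → ℂ} (hU : IsUnit (toeplitz p v)) {ε : ℂ}
    {g : LpT p} (hg : g ∈ Hardy p) : mulOp p v g + ε • shiftJ p β g = 0 ↔ g = 0 := by
  refine ⟨fun h => eq_zero_of_mulOp_mem_Minus hU hg ?_, fun h => by simp [h]⟩
  rw [eq_neg_of_add_eq_zero_left h]
  exact (Minus p).neg_mem ((Minus p).smul_mem _ (shiftJ_mem_Minus hp β hg))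

end Homogeneous

/-! ### Reduction of the index by powers of `χ` -/

section Transfer

variable {p : ℝ≥0∞} [Fact (1 ≤ p)] [HasRieszProjection p] {β : OuterPoint}

variable (p) in
lemma memGLinfty_chi_pow (hp : p ≠ ∞) (β : OuterPoint) (n : ℕ) :
    MemGLinfty fun t => chi β t ^ n := by
  have h : MemCoHardy (fun t => (chi β t)⁻¹) ∞ :=
    (((memCoHardy_zpow (k := -1) (by norm_num) ∞).mul_top p hp
      (memCoHardy_alphaMinus β)).1).congr (Eventually.of_forall fun t => by
        simp only [zpow_neg, zpow_one, inv_mul_alphaMinus])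
  refine ⟨((memHardy_chi β).pow_top p hp n).1,
    Eventually.of_forall fun t => pow_ne_zero n (chi_ne_zero β t), ?_⟩
  refine (h.pow_top p hp n).1.1.ae_eq (Eventually.of_forall fun t => ?_)
  rw [Pi.inv_apply, inv_pow]

lemma isMatchingPair_chi_pow (hp : p ≠ ∞) {a b : Circle → ℂ} (hab : IsMatchingPair β a b) (n : ℕ) :
    IsMatchingPair β (fun t => a t / chi β t ^ n) (fun t => b t * chi β t ^ n) := by
  have h := memGLinfty_chi_pow p hp β n
  refine .of_left (hab.left.div h) (h.1.mul hab.right.1) ?_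
  filter_upwards [hab.eq] with t ht
  have h1 := pow_ne_zero n (chi_ne_zero β t)
  rw [chi_shift, inv_pow, div_inv_eq_mul, mul_mul_mul_comm, mul_inv_cancel₀ h1, ← ht]
  field_simp

/-- The function a f + ε b J f is unchanged: χ⁻ⁿ cancels χⁿ in the first term, and J(χⁿ f) = χ⁻ⁿ J f
in the second. -/
lemma mem_ker_toeplitz_add_hankel_chi_iff (hp : p ≠ ∞) {a b : Circle → ℂ} (ha : MemLp a ∞ arc)
    (hb : MemLp b ∞ arc) (n : ℕ) (ε : ℂ) {f : Hardy p} :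
    f ∈ (toeplitz p a + ε • hankel p β b).ker ↔
      toeplitz p (fun t => chi β t ^ n) f ∈ (toeplitz p (fun t => a t / chi β t ^ n) +
        ε • hankel p β fun t => b t * chi β t ^ n).ker := by
  have h := memGLinfty_chi_pow p hp β n
  have hi : MemLp (fun t => (chi β t ^ n)⁻¹) ∞ arc := h.2.2
  have hs : MemLp (fun t => chi β (shift β t) ^ n) ∞ arc := (h.comp_shift β).1
  have ha' : MemLp (fun t => a t / chi β t ^ n) ∞ arc := by
    simp only [div_eq_mul_inv]
    exact hi.mul ha
  have hb' : MemLp (fun t => b t * chi β t ^ n) ∞ arc := h.1.mul hb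
  rw [mem_ker_toeplitz_add_hankel_iff hp, mem_ker_toeplitz_add_hankel_iff hp, coe_toeplitz,
    rieszP_eq_self (mulOp_mem_Hardy hp ((memHardy_chi β).pow_top p hp n) f.2),
    shiftJ_mulOp β h.1, mulOp_mulOp_eq ha' h.1 (c := a), mulOp_mulOp_eq hb' hs (c := b)]
  · refine Eventually.of_forall fun t => ?_
    rw [chi_shift, inv_pow, mul_inv_cancel_right₀ (pow_ne_zero n (chi_ne_zero β t))]
  · exact Eventually.of_forall fun t => div_mul_cancel₀ _ (pow_ne_zero n (chi_ne_zero β t))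

lemma toeplitz_chi_neg_mul (hp : p ≠ ∞) (n : ℕ) :
    toeplitz p (fun t => chi β t ^ (-(n : ℤ))) * toeplitz p (fun t => chi β t ^ n) = 1 := by
  have hi : MemLp (fun t => chi β t ^ (-(n : ℤ))) ∞ arc := by
    simp only [zpow_neg, zpow_natCast]
    exact (memGLinfty_chi_pow p hp β n).2.2
  rw [toeplitz_mul_plus hp hi ((memHardy_chi β).pow_top p hp n), toeplitz_eq_one]
  refine Eventually.of_forall fun t => ?_
  rw [zpow_neg, zpow_natCast, inv_mul_cancel₀ (pow_ne_zero n (chi_ne_zero β t))]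

/-- T(χ⁻ⁿ) is only a left inverse of T(χⁿ). As χ vanishes at 1/conj β, T(χⁿ) is not onto for n > 0,
hence the intersection with its range. -/
lemma ker_toeplitz_add_hankel_eq_map (hp : p ≠ ∞) {a b : Circle → ℂ} (ha : MemLp a ∞ arc)
    (hb : MemLp b ∞ arc) (n : ℕ) (ε : ℂ) :
    (toeplitz p a + ε • hankel p β b).ker =
      ((toeplitz p (fun t => a t / chi β t ^ n) +
          ε • hankel p β fun t => b t * chi β t ^ n).ker ⊓
        (toeplitz p fun t => chi β t ^ n).range).map
      (toeplitz p fun t => chi β t ^ (-(n : ℤ))).toLinearMap := by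
  have hinv : ∀ f : Hardy p, toeplitz p (fun t => chi β t ^ (-(n : ℤ)))
      (toeplitz p (fun t => chi β t ^ n) f) = f := fun f =>
    congrArg (fun A : Hardy p →L[ℂ] Hardy p => A f) (toeplitz_chi_neg_mul hp n)
  ext f
  rw [mem_ker_toeplitz_add_hankel_chi_iff hp ha hb n]
  constructor
  · exact fun h => ⟨_, ⟨h, f, rfl⟩, hinv f⟩
  · rintro ⟨_, ⟨h, g, rfl⟩, rfl⟩
    have hg : (toeplitz p fun t => chi β t ^ (-(n : ℤ))).toLinearMap
        ((toeplitz p fun t => chi β t ^ n).toLinearMap g) = g := hinv g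
    rw [hg]
    exact h

end Transfer

/-! ### Homogeneous and particular solutions combined -/

section Kernel

variable {p : ℝ≥0∞} [Fact (1 ≤ p)] [HasRieszProjection p] {β : OuterPoint} {a b : Circle → ℂ}
  {ε : ℂ}

lemma map_phi_le_Hardy (hp : p ≠ ∞) (hε : ε * ε = 1) (hab : IsMatchingPair β a b)
    {R : Hardy p →L[ℂ] Hardy p} (hR : toeplitz p (a / b) * R = 1) :
    (imProj p β ε (fun t => b t / a (shift β t))).map (phi p β ε a b R).toLinearMap ≤ Hardy p := by
  rintro _ ⟨s, hs, rfl⟩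
  exact (phi_spec hp hε hab hR hs).1

/-- The kernel of `T(a) ± H(b)`, when the solutions of the homogeneous equation are known. -/
lemma ker_toeplitz_add_hankel_eq (hp : p ≠ ∞) (hε : ε * ε = 1) (hab : IsMatchingPair β a b)
    {R : Hardy p →L[ℂ] Hardy p} (hR : toeplitz p (a / b) * R = 1) {S : Submodule ℂ (LpT p)}
    (hS : S ≤ Hardy p)
    (h : ∀ g ∈ Hardy p, mulOp p (a / b) g + ε • shiftJ p β g = 0 ↔ g ∈ S) :
    Disjoint S
        ((imProj p β ε (fun t => b t / a (shift β t))).map (phi p β ε a b R).toLinearMap) ∧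
      (toeplitz p a + ε • hankel p β b).ker = (S ⊔ (imProj p β ε
        (fun t => b t / a (shift β t))).map (phi p β ε a b R).toLinearMap).comap
          (Hardy p).subtype := by
  constructor
  · exact Submodule.disjoint_def.mpr fun g hg hg' =>
      eq_zero_of_mem_map_phi hp hε hab hR ((h g (hS hg)).mpr hg) hg'
  · ext f
    rw [mem_ker_iff_exists_add hp hε hab hR, Submodule.mem_comap, Submodule.mem_sup]
    constructor
    · rintro ⟨g, hg, hg', y, hy, hgy⟩
      exact ⟨g, (h g hg).mp hg', y, hy, hgy⟩
    · rintro ⟨g, hg, y, hy, hgy⟩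
      exact ⟨g, hS hg, (h g (hS hg)).mpr hg, y, hy, hgy⟩

end Kernel

end

end GTH

/-! ### The main theorem -/

theorem theorem5p2 (p q : ℝ≥0∞) [Fact (1 ≤ p)] [p.HolderConjugate q] (hp1 : 1 < p) (hp : p < ∞)
    (β : OuterPoint) (a b c d : Circle → ℂ)
    (ha : MemGLinfty a) (hb : MemLp b ∞ arc)
    (hmatch : ∀ᵐ t ∂arc, a t * a (shift β t) = b t * b (shift β t))
    (hc : c = fun t => a t / b t) (hd : d = fun t => b t / a (shift β t))
    (hFc : (toeplitz p c).IsFredholm) (hFd : (toeplitz p d).IsFredholm)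
    (κ₁ κ₂ : ℤ) (hκ₁ : (toeplitz p c).index = κ₁) (hκ₂ : (toeplitz p d).index = κ₂)
    (hneg : κ₁ < 0) (hpos : 0 < κ₂)
    (n : ℕ) (hn : 2 * (n : ℤ) + κ₁ = 0 ∨ 2 * (n : ℤ) + κ₁ = 1)
    (a' b' c' : Circle → ℂ)
    (ha' : a' = fun t => a t * chi β t ^ (-(n : ℤ))) (hb' : b' = fun t => b t * chi β t ^ n)
    (hc' : c' = fun t => a' t / b' t) :
    IsUnit (toeplitz p fun t => c' t * (t : ℂ) ^ (2 * (n : ℤ) + κ₁)) ∧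
    toeplitz p c' * toeplitzRightInv p c' (2 * (n : ℤ) + κ₁) = 1 ∧
    (∃ cm cp : Circle → ℂ, IsWienerHopf p q c (-κ₁) cm cp) ∧
    ∀ R : Hardy p →L[ℂ] Hardy p, toeplitz p c' * R = 1 →
    ∀ ε : ℂ, (ε = 1 ∨ ε = -1) →
      (imProj p β ε d).map (phi p β ε a' b' R).toLinearMap ≤ Hardy p ∧
      (Odd κ₁ → ∀ (cm cp : Circle → ℂ) (h : IsWienerHopf p q c (-κ₁) cm cp),
        Disjoint (Submodule.span ℂ {((1 - ε * signature β κ₁ cp) / 2) • h.plus_inv.1.toLp cp⁻¹})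
          ((imProj p β ε d).map (phi p β ε a' b' R).toLinearMap) ∧
        (toeplitz p a + ε • hankel p β b).ker =
          ((Submodule.span ℂ {((1 - ε * signature β κ₁ cp) / 2) • h.plus_inv.1.toLp cp⁻¹} ⊔
              (imProj p β ε d).map (phi p β ε a' b' R).toLinearMap).comap (Hardy p).subtype ⊓
            (toeplitz p fun t => chi β t ^ n).range).map
          (toeplitz p fun t => chi β t ^ (-(n : ℤ))).toLinearMap) ∧
      (Even κ₁ →
        (toeplitz p a + ε • hankel p β b).ker =
          (((imProj p β ε d).map (phi p β ε a' b' R).toLinearMap).comap (Hardy p).subtype ⊓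
            (toeplitz p fun t => chi β t ^ n).range).map
          (toeplitz p fun t => chi β t ^ (-(n : ℤ))).toLinearMap) := by
  obtain rfl := hc'
  have hp' : p ≠ ∞ := hp.ne
  have : Fact (1 ≤ q) := ⟨ENNReal.HolderConjugate.one_le q p⟩
  have : HasRieszProjection p := hasRieszProjection_of_isFredholm hFc
  have hab : IsMatchingPair β a b := .of_left ha hb hmatch
  have hcG : MemGLinfty c := hc ▸ hab.left.div hab.right
  have hUc : IsUnit (toeplitz p fun t => c t * (t : ℂ) ^ κ₁) :=
    isUnit_toeplitz_mul_zpow hp1 hp' hcG hFc hκ₁ hneg.le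
  have ha'' : a' = fun t => a t / chi β t ^ n := by
    rw [ha']
    funext t
    rw [zpow_neg, zpow_natCast, div_eq_mul_inv]
  have hab' : IsMatchingPair β a' b' := by
    rw [ha'', hb']
    exact isMatchingPair_chi_pow hp' hab n
  have hv : MemGLinfty fun t => a' t / b' t := hab'.left.div hab'.right
  -- c' = c χ^(-2n) and χ⁻¹ = t⁻¹ α₋: up to powers of t, passing from c to c' only adds the factor
  -- α₋^(2n), which preserves invertibility.
  have hvc : ∀ (t : Circle) (κ : ℤ), (a' t / b' t) * (t : ℂ) ^ (2 * (n : ℤ) + κ) =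
      alphaMinus β t ^ (2 * n) * (c t * (t : ℂ) ^ κ) := fun t κ => by
    have ht := Circle.coe_ne_zero t
    rw [ha'', hb', hc, zpow_add₀ ht]
    simp only [chi, div_pow]
    rw [← Nat.cast_ofNat, ← Nat.cast_mul, zpow_natCast]
    have := alphaMinus_ne_zero (β := β) t
    field_simp
    ring
  have hvv : ∀ᵐ t ∂arc, a' t / b' t * (a' (shift β t) / b' (shift β t)) = 1 := by
    filter_upwards [hab'.eq, hab'.right.2.1, (hab'.right.comp_shift β).2.1] with t h1 h2 h3
    rw [div_mul_div_comm, h1, div_self (mul_ne_zero h2 h3)]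
  -- The factors χⁿ in b' and (χ_α)⁻ⁿ = χⁿ in a'_α cancel, so d is the same for both pairs.
  have hd' : (fun t => b' t / a' (shift β t)) = d := by
    rw [ha'', hb', hd]
    funext t
    simp only [chi_shift, inv_pow, div_inv_eq_mul]
    exact mul_div_mul_right _ _ (pow_ne_zero n (chi_ne_zero β t))
  have hcG' : MemLp (fun t : Circle => c t * (t : ℂ) ^ κ₁) ∞ arc := by
    simpa only [mul_comm] using memLp_zpow_mul hcG.1 κ₁
  have hU : IsUnit (toeplitz p fun t => a' t / b' t * (t : ℂ) ^ (2 * (n : ℤ) + κ₁)) := by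
    simp only [hvc]
    exact isUnit_toeplitz_alphaMinus_pow_mul hp' hcG' hUc (2 * n)
  refine ⟨hU, toeplitz_mul_toeplitzRightInv hp' hv.1 (by omega) hU, ?_, fun R hR ε hε => ?_⟩
  · have hcG2 : MemGLinfty fun t : Circle => c t * (t : ℂ) ^ κ₁ := by
      refine ⟨hcG', ?_, ?_⟩
      · filter_upwards [hcG.2.1] with t ht
          using mul_ne_zero ht (zpow_ne_zero _ (Circle.coe_ne_zero t))
      · refine (memLp_zpow_mul hcG.2.2 (-κ₁)).ae_eq (Eventually.of_forall fun t => ?_)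
        simp [mul_comm]
    -- The symbol c t^κ₁ factors with middle exponent 0; multiplying back by t^(-κ₁) gives the
    -- factorization of c.
    obtain ⟨cm, cp, h⟩ := exists_isWienerHopf_of_isUnit (q := q) hp1 hp' hcG2 hUc
    have h2 := h.mul_zpow (-κ₁)
    simp only [mul_assoc, ← zpow_add₀ (Circle.coe_ne_zero _), add_neg_cancel, zpow_zero,
      mul_one, zero_add] at h2
    exact ⟨cm, cp, h2⟩
  have hεε : ε * ε = 1 := by rcases hε with rfl | rfl <;> norm_num
  have hR' : toeplitz p (a' / b') * R = 1 := hR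
  have hker := ker_toeplitz_add_hankel_eq_map (β := β) hp' ha.1 hb n ε
  rw [← ha'', ← hb'] at hker
  refine ⟨hd' ▸ map_phi_le_Hardy hp' hεε hab' hR', fun hodd cm cp h => ?_, fun heven => ?_⟩
  · have hκ : 2 * (n : ℤ) + κ₁ = 1 := by
      obtain ⟨m, rfl⟩ := hodd
      omega
    rw [hκ] at hU
    have hhom := fun g hg => homogeneous_iff_mem_span (β := β) hp' hκ hv.1 hvv
      (fun t => by rw [← hvc, hκ, zpow_one, mul_comm]) (by simpa only [mul_comm] using hU) h hεε
      (g := g) hg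
    have hS : Submodule.span ℂ {((1 - ε * signature β κ₁ cp) / 2) • h.plus_inv.1.toLp cp⁻¹} ≤
        Hardy p := by
      rw [Submodule.span_singleton_le_iff_mem]
      refine (Hardy p).smul_mem _ fun j hj => ?_
      rw [fcoeff_congr h.plus_inv.1.coeFn_toLp, h.plus_inv.2 j hj]
    obtain ⟨hdisj, hK⟩ := ker_toeplitz_add_hankel_eq hp' hεε hab' hR' hS hhom
    rw [hd'] at hdisj hK
    exact ⟨hdisj, by rw [hker, hK]⟩
  · have hκ : 2 * (n : ℤ) + κ₁ = 0 := by
      obtain ⟨m, rfl⟩ := heven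
      omega
    simp only [hκ, zpow_zero, mul_one] at hU
    obtain ⟨-, hK⟩ := ker_toeplitz_add_hankel_eq hp' hεε hab' hR' (S := ⊥) bot_le fun g hg =>
      (homogeneous_iff_eq_zero hp' hU hg).trans (Submodule.mem_bot ℂ).symm
    rw [hd', bot_sup_eq] at hK
    rw [hker, hK]
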